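/- **Setting.** For a bounded open set $\mathcal A\subset\mathbb R^2$ with smooth boundary let $\vec n_{\partial\mathcal A}$ be the unit normal pointing inside $\mathcal A$ (the gradient of the signed distance that is positive in $\mathcal A$) and $H_{\partial\mathcal A}=-\nabla^{\tan}\cdot\vec n_{\partial\mathcal A}$. For $\delta\in(0,\tfrac12)$ and $r>0$, a bounded, open, simply connected $\mathcal A$ with smooth boundary is called $\delta$-close to a circle of radius $r$ if $\partial\mathcal A$ has an arc-length parametrization $\gamma:[0,L)\to\mathbb R^2$ such that $\tfrac r2$ is a tubular neighborhood width of $\partial\mathcal A$ and, for all $\theta\in[0,L)$, $$\tfrac{|L-2\pi r|}{2\pi r}\le\delta,\quad \big|\vec n_{\partial\mathcal A}(\gamma(\theta))+e^{2\pi i\theta/L}\big|\le\delta,\quad r\big|H_{\partial\mathcal A}(\gamma(\theta))-\tfrac1r\big|\le\delta,\quad r^2\big|(\nabla^{\tan}H_{\partial\mathcal A})(\gamma(\theta))\big|\le\delta .$$ Let $P\ge2$ and let $\chi=(\chi_1,\dots,\chi_P):\mathbb R^2\times[0,\infty)\to\{0,1\}^P$ be measurable (for instance the phase indicators of a varifold-BV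 or BV solution to multiphase mean curvature flow). Let $T_{ext}>0$, $r(t)=\sqrt{2(T_{ext}-t)}$, and let $\mathcal A(t)$, $t\in[0,T_{ext})$, be the open first phase of a two-phase solution to planar mean curvature flow, smoothly evolving (up to and including $t=0$), with simple closed boundary curve $\bar I(t)=\partial\mathcal A(t)$ and extinction time $T_{ext}$, such that for some $\delta_{\mathrm{asymp}}\in(0,\tfrac12)$ and all $t\in(0,T_{ext})$ the set $\mathcal A(t)$ is $\delta_{\mathrm{asymp}}$-close to a circle of radius $r(t)$. Write $\bar\chi_1(\cdot,t)$ for the indicator function of $\mathcal A(t)$. Let $C_\zeta\ge1$ and let $\zeta:\mathbb R\to[0,1]$ be smooth with $\zeta(s)=1$ for $|s|\le\frac1{16C_\zeta}$ and $\zeta(s)=0$ for $|s|>\frac1{8C_\zeta}$. Given $t_\chi>0$, $z:[0,t_\chi)\to\mathbb R^2$ and $T:[0,t_\chi)\to[0,T_{ext})$, put $r_T(t)=r(T(t))$, $\bar\chi_1^{z,T}(x,t)=\bar\chi_1(x-z(t),T(t))$, $\bar I^{z,T}(t)=z(t)+\bar I(T(t))$, $\vec n(x,t)=\vec n_{\partial\mathcal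 A(T(t))}(x-z(t))$ for $x\in\bar I^{z,T}(t)$, and $\rho=\rho_+-\rho_-$ with $$\rho_+(x,t)=\int_0^{\frac12r_T(t)}(\bar\chi_1^{z,T}-\chi_1)\big(x+\ell\,\vec n(x,t),t\big)\,\zeta\Big(\frac{\ell}{r_T(t)}\Big)d\ell,\qquad \rho_-(x,t)=\int_{-\frac12r_T(t)}^0(\chi_1-\bar\chi_1^{z,T})\big(x+\ell\,\vec n(x,t),t\big)\,\zeta\Big(\frac{\ell}{r_T(t)}\Big)d\ell .$$ Call $(t_\chi,z,T)$ a *space-time shift* if $t_\chi\in(0,\infty)$; $z\in W^{1,\infty}_{loc}((0,t_\chi);\mathbb R^2)$, continuous on $[0,t_\chi)$; $T\in W^{1,\infty}((0,t_\chi))$ (Lipschitz on $[0,t_\chi)$) restricts to a strictly increasing bijection $(0,t_\chi)\to(0,T_{ext})$; $z(0)=0$, $T(0)=0$; and, with $\mathfrak T=T-\mathrm{id}$, for almost every $t\in(0,t_\chi)$ $$\dot z(t)=\frac{6}{r_T^2(t)}\,\frac{1}{\mathcal H^1(\bar I^{z,T}(t))}\int_{\bar I^{z,T}(t)}\rho(\cdot,t)\,\vec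 n(\cdot,t)\,d\mathcal H^1,\qquad \dot{\mathfrak T}(t)=\frac{4}{r_T(t)}\,\frac{1}{\mathcal H^1(\bar I^{z,T}(t))}\int_{\bar I^{z,T}(t)}\rho(\cdot,t)\,d\mathcal H^1,$$ with $\mathcal H^1$ the one-dimensional Hausdorff measure (length). **Statement.** (i) In the above setting there is a space-time shift $(t_\chi,z,T)$, and it is unique: any other one has the same $t_\chi$ and the same $z$, $T$ on $[0,t_\chi)$. (ii) For every $\delta_{\mathrm{err}}\in(0,\tfrac12)$ there is a constant $C_0\ge1$, depending only on $\delta_{\mathrm{err}}$, such that in every setting as above with $C_\zeta\ge C_0$ the space-time shift satisfies, for almost every $t\in(0,t_\chi)$, $$|\dot z(t)|\le\delta_{\mathrm{err}}\frac1{r_T(t)},\qquad|\dot{\mathfrak T}(t)|\le\delta_{\mathrm{err}} .$$ -/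

import Mathlib

open Set Filter Topology MeasureTheory
open scoped ContDiff MeasureTheory

noncomputable section

namespace SpaceTimeShift

/-- The Euclidean plane. -/
abbrev Plane : Type := EuclideanSpace ℝ (Fin 2)

/-- Counter-clockwise rotation by 90 degrees. -/
def rotJ (v : Plane) : Plane := !₂[-(v 1), v 0]

/-- The point of the unit circle at angle `φ`. -/
def unitCirclePoint (φ : ℝ) : Plane := !₂[Real.cos φ, Real.sin φ]

/-- Signed distance to the boundary of `A`, positive inside `A`. -/
def signedDist (A : Set Plane) (x : Plane) : ℝ := Metric.infDist x Aᶜ - Metric.infDist x A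

/-- Unit normal of `∂A` pointing inside `A`: the gradient of the signed distance
(meaningful at the points of a smooth boundary). -/
def innerNormal (A : Set Plane) (x : Plane) : Plane := gradient (signedDist A) x

/-- Scalar mean curvature `H = - ∇^tan · n` of `∂A` at the point `γ θ`, where `γ` is a regular
parametrization of `∂A` and `n` is the inner unit normal; the tangential divergence of a field
along a curve is the component in direction of the unit tangent of its arc-length derivative. -/
def curvature (A : Set Plane) (γ : ℝ → Plane) (θ : ℝ) : ℝ :=
  -(inner ℝ (deriv (fun s => innerNormal A (γ s)) θ) (deriv γ θ) / ‖deriv γ θ‖ ^ 2)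

/-- `w` is a tubular neighborhood width of `∂A`: the map `(x, ℓ) ↦ x + ℓ n(x)` is one-to-one on
`∂A × (-w, w)`. For a smooth compact boundary this map is then automatically a diffeomorphism onto
the open `w`-neighborhood of `∂A`. -/
def IsTubularWidth (A : Set Plane) (w : ℝ) : Prop :=
  InjOn (fun p : Plane × ℝ => p.1 + p.2 • innerNormal A p.1) (frontier A ×ˢ Ioo (-w) w)

/-- `γ` (extended `L`-periodically to `ℝ`) is a smooth arc-length parametrization of the simple
closed curve `∂A`, of length `L`. -/
structure IsArcLengthParam (A : Set Plane) (L : ℝ) (γ : ℝ → Plane) : Prop where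
  length_pos : 0 < L
  smooth : ContDiff ℝ ∞ γ
  periodic : Function.Periodic γ L
  unit_speed : ∀ θ, ‖deriv γ θ‖ = 1
  injOn : InjOn γ (Ico 0 L)
  image_eq : γ '' Ico 0 L = frontier A

/-- The bounded, open, simply connected set `A` with smooth boundary is quantitatively close,
with parameter `δ`, to a circle of radius `r`. -/
structure IsCloseToCircle (δ r : ℝ) (A : Set Plane) : Prop where
  isOpen : IsOpen A
  isBounded : Bornology.IsBounded A
  simplyConnected : SimplyConnectedSpace A
  exists_param : ∃ (L : ℝ) (γ : ℝ → Plane), IsArcLengthParam A L γ ∧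
    IsTubularWidth A (r / 2) ∧
    |L - 2 * Real.pi * r| / (2 * Real.pi * r) ≤ δ ∧
    (∀ θ ∈ Ico 0 L,
      ‖innerNormal A (γ θ) - (-unitCirclePoint (2 * Real.pi * θ / L))‖ ≤ δ) ∧
    (∀ θ ∈ Ico 0 L, r * |curvature A γ θ - 1 / r| ≤ δ) ∧
    (∀ θ ∈ Ico 0 L, r ^ 2 * |deriv (curvature A γ) θ| ≤ δ)

/-- `(A t)`, `0 ≤ t < Text`, is (the first phase of) a smoothly evolving two-phase solution to
planar mean curvature flow with extinction time `Text`: the boundaries are simple closed curves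
with a regular parametrization `γ(·, t)` (of period one, positively oriented) that is smooth in
space-time up to the initial time, the normal velocity equals the curvature,
and the area vanishes as `t ↑ Text`. -/
structure IsSmoothMCF (Text : ℝ) (A : ℝ → Set Plane) : Prop where
  isOpen : ∀ t ∈ Ico 0 Text, IsOpen (A t)
  isBounded : ∀ t ∈ Ico 0 Text, Bornology.IsBounded (A t)
  exists_param : ∃ γ : ℝ → ℝ → Plane,
    ContDiffOn ℝ ∞ (fun p : ℝ × ℝ => γ p.1 p.2) (univ ×ˢ Ico 0 Text) ∧
    (∀ t ∈ Ico 0 Text,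
      Function.Periodic (fun θ => γ θ t) 1 ∧
      InjOn (fun θ => γ θ t) (Ico 0 1) ∧
      (fun θ => γ θ t) '' Ico 0 1 = frontier (A t) ∧
      ∀ θ, deriv (fun θ' => γ θ' t) θ ≠ 0 ∧
        innerNormal (A t) (γ θ t) =
          ‖deriv (fun θ' => γ θ' t) θ‖⁻¹ • rotJ (deriv (fun θ' => γ θ' t) θ)) ∧
    (∀ t ∈ Ioo 0 Text, ∀ θ,
      inner ℝ (deriv (fun s => γ θ s) t) (innerNormal (A t) (γ θ t)) =
        curvature (A t) (fun θ' => γ θ' t) θ)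
  extinction : Tendsto (fun t => volume (A t)) (𝓝[<] Text) (𝓝 0)

/-- The radius `r(t) = √(2 (Text - t))` of the circle shrinking to a point at time `Text`. -/
def radius (Text t : ℝ) : ℝ := Real.sqrt (2 * (Text - t))

/-- Smoothly evolving solution with extinction time `Text` whose phase is, at all positive times
before extinction, quantitatively close to the circle of radius `r(t)`. -/
structure IsNearlyCircularMCF (δ Text : ℝ) (A : ℝ → Set Plane) : Prop where
  mcf : IsSmoothMCF Text A
  close : ∀ t ∈ Ioo 0 Text, IsCloseToCircle δ (radius Text t) (A t)

/-- A measurable family of phase indicators `χ = (χ_1, …, χ_P) : ℝ² × [0, ∞) → {0,1}^P`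
(the values at negative times play no role). -/
def IsPhaseFamily {P : ℕ} (χ : Fin P → Plane → ℝ → ℝ) : Prop :=
  ∀ i, Measurable (fun p : Plane × ℝ => χ i p.1 p.2) ∧ ∀ x t, χ i x t = 0 ∨ χ i x t = 1

/-- Smooth cutoff `ζ : ℝ → [0,1]`, equal to `1` for `|s| ≤ 1/(16 C)` and to `0` for
`|s| > 1/(8 C)`. -/
structure IsCutoff (C : ℝ) (ζ : ℝ → ℝ) : Prop where
  smooth : ContDiff ℝ ∞ ζ
  mem_Icc : ∀ s, ζ s ∈ Icc (0 : ℝ) 1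
  eq_one : ∀ s, |s| ≤ 1 / (16 * C) → ζ s = 1
  eq_zero : ∀ s, 1 / (8 * C) < |s| → ζ s = 0

/-- The indicator `χ̄_1(x - z(t), T(t))` of the shifted phase. -/
def shiftedPhase (A : ℝ → Set Plane) (z : ℝ → Plane) (T : ℝ → ℝ) (x : Plane) (t : ℝ) : ℝ :=
  (A (T t)).indicator (fun _ => (1 : ℝ)) (x - z t)

/-- The shifted interface `z(t) + ∂A(T(t))`. -/
def shiftedInterface (A : ℝ → Set Plane) (z : ℝ → Plane) (T : ℝ → ℝ) (t : ℝ) : Set Plane :=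
  (fun y => z t + y) '' frontier (A (T t))

/-- The inner unit normal of the shifted interface. -/
def shiftedNormal (A : ℝ → Set Plane) (z : ℝ → Plane) (T : ℝ → ℝ) (x : Plane) (t : ℝ) : Plane :=
  innerNormal (A (T t)) (x - z t)

/-- Interface error height `ρ_+`. -/
def rhoPlus (Text : ℝ) (A : ℝ → Set Plane) (χ₁ : Plane → ℝ → ℝ) (ζ : ℝ → ℝ)
    (z : ℝ → Plane) (T : ℝ → ℝ) (x : Plane) (t : ℝ) : ℝ :=
  ∫ ℓ in (0 : ℝ)..(radius Text (T t) / 2),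
    (shiftedPhase A z T (x + ℓ • shiftedNormal A z T x t) t
      - χ₁ (x + ℓ • shiftedNormal A z T x t) t) * ζ (ℓ / radius Text (T t))

/-- Interface error height `ρ_-`. -/
def rhoMinus (Text : ℝ) (A : ℝ → Set Plane) (χ₁ : Plane → ℝ → ℝ) (ζ : ℝ → ℝ)
    (z : ℝ → Plane) (T : ℝ → ℝ) (x : Plane) (t : ℝ) : ℝ :=
  ∫ ℓ in (-(radius Text (T t) / 2))..(0 : ℝ),
    (χ₁ (x + ℓ • shiftedNormal A z T x t) t
      - shiftedPhase A z T (x + ℓ • shiftedNormal A z T x t) t) * ζ (ℓ / radius Text (T t))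

/-- Interface error height `ρ = ρ_+ - ρ_-`. -/
def rho (Text : ℝ) (A : ℝ → Set Plane) (χ₁ : Plane → ℝ → ℝ) (ζ : ℝ → ℝ)
    (z : ℝ → Plane) (T : ℝ → ℝ) (x : Plane) (t : ℝ) : ℝ :=
  rhoPlus Text A χ₁ ζ z T x t - rhoMinus Text A χ₁ ζ z T x t

/-- `(tχ, z, T)` is an admissible choice of time horizon, path of translations and time dilation:
`z ∈ W^{1,∞}_loc((0,tχ);ℝ²)` (locally Lipschitz, attaining its initial value continuously),
`T ∈ W^{1,∞}((0,tχ);(0,Text))` (Lipschitz) is a strictly increasing bijection,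
`(z(0), T(0)) = (0, 0)`, and the differential equations hold for almost every time. -/
structure IsShift (Text : ℝ) (A : ℝ → Set Plane) (χ₁ : Plane → ℝ → ℝ) (ζ : ℝ → ℝ)
    (tχ : ℝ) (z : ℝ → Plane) (T : ℝ → ℝ) : Prop where
  horizon_pos : 0 < tχ
  z_continuousOn : ContinuousOn z (Ico 0 tχ)
  z_locallyLipschitzOn : LocallyLipschitzOn (Ioo 0 tχ) z
  T_lipschitzOn : ∃ K, LipschitzOnWith K T (Ico 0 tχ)
  T_strictMonoOn : StrictMonoOn T (Ioo 0 tχ)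
  T_bijOn : BijOn T (Ioo 0 tχ) (Ioo 0 Text)
  z_zero : z 0 = 0
  T_zero : T 0 = 0
  ode : ∀ᵐ t ∂(volume.restrict (Ioo 0 tχ)),
    HasDerivAt z
      ((6 / radius Text (T t) ^ 2) •
        ⨍ x in shiftedInterface A z T t,
          rho Text A χ₁ ζ z T x t • shiftedNormal A z T x t ∂μH[1]) t ∧
    HasDerivAt (fun s => T s - s)
      ((4 / radius Text (T t)) *
        ⨍ x in shiftedInterface A z T t, rho Text A χ₁ ζ z T x t ∂μH[1]) t

end SpaceTimeShift

end

/-! The unknown is the curve (z, T), and the phase indicator enters the equations only through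
integrals. The point is that these integrals depend on (z, T) in a Lipschitz way although the phase
is merely measurable. Caratheodory theory then applies.

In tubular coordinates (θ, s) scaled by the radius, x = z + Φ(θ, s, T) with Φ = γ + r s n. The sign
of s decides membership in the shifted phase, and ρ = r * `errorHeight`. Both right-hand sides
become one integral over the fixed rectangle [0,1] × [-1/4,1/4], divided by the length
(`average_rho_eq_shiftVelocity`). Its integrand is (1_{s>0} - χ(z + Φ)) times a smooth weight g.
Only χ(z + Φ) depends roughly on the parameters.

For smooth χ, a derivative of χ(z + Φ) in z or T is a combination of its θ and s derivatives,
because ∂_θ Φ and ∂_s Φ span the plane. Integration by parts moves these derivatives onto g. There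
are no boundary terms: everything is periodic in θ, and g vanishes near s = ±1/4. The resulting
Lipschitz constant only involves sup |χ| ≤ 1 (`IsTransport.lipschitz_of_smooth`). Mollification
extends it to measurable χ, because Φ is a local diffeomorphism in (θ, s) and so pulls null sets
back to null sets. Nondegeneracy of Φ for |s| < 1/2 holds because a tubular width r/2 forces the
radius of curvature to be at least r/2 (`mul_inner_le_of_isTubularWidth`).

The two one-sided parts of the error height have opposite signs in their contribution to ρ, and each
is at most 1/(8C) in size. Hence |ρ| ≤ r/(8C), which gives |z'| ≤ 1/(C r) and |(T - id)'| ≤ 1/(2C).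
These are the bounds of (ii) with C₀ = 1/δ_err. The second one also keeps T' in [1/2, 3/2].

The Lipschitz constants may blow up as T approaches Text, so T is clamped to [0, c] with c < Text.
Each clamped problem has a unique integral curve, which reaches T = c by time 2c. Letting c increase
to Text and gluing gives the solution and its horizon. Grönwall gives uniqueness of the curve. The
horizon is unique because T is strictly increasing onto (0, Text). -/

noncomputable section

open scoped NNReal BoundedContinuousFunction

/-! ### Carathéodory equations: existence, Grönwall, and the integral form -/

section Caratheodory

/-- A bounded measurable field of vectors along the line is interval integrable. -/
theorem intervalIntegrable_of_norm_le {E : Type*} [NormedAddCommGroup E] {f : ℝ → E} {B : ℝ}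
    (hf : AEStronglyMeasurable f volume) (hB : ∀ t, ‖f t‖ ≤ B) (a b : ℝ) :
    IntervalIntegrable f volume a b := by
  rw [intervalIntegrable_iff]
  exact Measure.integrableOn_of_bounded (by simp) hf (Eventually.of_forall hB)

/-- The left side equals (c/lam)(1 - e^{-lam τ}). This gain of 1/lam makes the Picard operator
contract in an exponentially weighted norm on the whole half-line. -/
theorem exp_neg_mul_integral_exp_le {lam c τ : ℝ} (hlam : 0 < lam) (hc : 0 ≤ c) :
    Real.exp (-(lam * τ)) * ∫ s in (0 : ℝ)..τ, c * Real.exp (lam * s) ≤ c / lam := by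
  have h1 : ∫ s in (0 : ℝ)..τ, c * Real.exp (lam * s)
      = c / lam * (Real.exp (lam * τ) - 1) := by
    rw [intervalIntegral.integral_const_mul, intervalIntegral.integral_comp_mul_left Real.exp hlam.ne',
      integral_exp]
    simp
    field_simp
  rw [h1]
  have h2 : Real.exp (-(lam * τ)) * Real.exp (lam * τ) = 1 := by
    rw [← Real.exp_add]; simp
  have h3 : 0 < Real.exp (-(lam * τ)) := Real.exp_pos _
  have h4 : 0 ≤ c / lam := by positivity
  nlinarith [mul_nonneg h4 h3.le]

/-- Global Carathéodory existence theorem: a bounded field that is Lipschitz in the state,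
uniformly in time, and measurable in time along continuous curves, has integral curves. -/
theorem exists_integral_curve {E : Type*} [NormedAddCommGroup E] [NormedSpace ℝ E]
    [CompleteSpace E] {G : ℝ → E → E} {K : ℝ≥0} {B : ℝ}
    (hlip : ∀ t, LipschitzWith K (G t)) (hB : ∀ t u, ‖G t u‖ ≤ B)
    (hmeas : ∀ u : ℝ → E, Continuous u → AEStronglyMeasurable (fun t => G t (u t)) volume)
    (u₀ : E) :
    ∃ u : ℝ → E, Continuous u ∧ ∀ t, 0 ≤ t → u t = u₀ + ∫ s in (0 : ℝ)..t, G s (u s) := by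
  -- Chosen so that K / lam ≤ 1/2, the contraction factor below.
  set lam : ℝ := 2 * K + 1 with hlam_def
  have hlam : 0 < lam := by positivity
  have hB0 : 0 ≤ B := (norm_nonneg _).trans (hB 0 0)
  have hcurve : ∀ w : ℝ →ᵇ E, Continuous fun s => Real.exp (lam * s) • w s := fun w => by
    have := w.continuous
    fun_prop
  have hint : ∀ (w : ℝ →ᵇ E) (a b : ℝ),
      IntervalIntegrable (fun s => G s (Real.exp (lam * s) • w s)) volume a b := fun w a b =>
    intervalIntegrable_of_norm_le (hmeas _ (hcurve w)) (fun t => hB t _) a b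
  -- Picard operator for the rescaled unknown w(t) = e^{-lam t} u(t). The sup norm of w is the
  -- weighted norm of u, and `max t 0` freezes negative times so that w is bounded on all of ℝ.
  let op : (ℝ →ᵇ E) → ℝ → E := fun w t => Real.exp (-(lam * max t 0)) •
    (u₀ + ∫ s in (0 : ℝ)..max t 0, G s (Real.exp (lam * s) • w s))
  have hop_cont : ∀ w, Continuous (op w) := fun w => by
    have h1 : Continuous fun t => ∫ s in (0 : ℝ)..t, G s (Real.exp (lam * s) • w s) :=
      intervalIntegral.continuous_primitive (fun a b => hint w a b) 0
    have h2 := h1.comp (continuous_id.max continuous_const : Continuous fun t : ℝ => max t 0)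
    simp only [Function.comp_def] at h2
    fun_prop
  have hop_bdd : ∀ w t, ‖op w t‖ ≤ ‖u₀‖ + B / lam := fun w t => by
    have hτ : 0 ≤ max t 0 := le_max_right _ _
    simp only [op]
    generalize max t 0 = τ at hτ
    have h1 : ‖∫ s in (0 : ℝ)..τ, G s (Real.exp (lam * s) • w s)‖ ≤
        ∫ s in (0 : ℝ)..τ, B * Real.exp (lam * s) := by
      refine intervalIntegral.norm_integral_le_of_norm_le hτ ?_ ?_
      · refine Eventually.of_forall fun s hs => (hB _ _).trans ?_
        exact le_mul_of_one_le_right hB0 (Real.one_le_exp (mul_nonneg hlam.le hs.1.le))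
      · exact Continuous.intervalIntegrable (by fun_prop) _ _
    have h2 := exp_neg_mul_integral_exp_le (τ := τ) hlam hB0
    have h3 : Real.exp (-(lam * τ)) ≤ 1 := Real.exp_le_one_iff.2 (by nlinarith)
    have h4 := Real.exp_pos (-(lam * τ))
    rw [norm_smul, Real.norm_eq_abs, abs_of_pos h4]
    calc _ ≤ Real.exp (-(lam * τ)) * (‖u₀‖ + ∫ s in (0 : ℝ)..τ, B * Real.exp (lam * s)) := by
          gcongr
          exact (norm_add_le _ _).trans (by gcongr)
      _ ≤ _ := by
          rw [mul_add]
          exact add_le_add (mul_le_of_le_one_left (norm_nonneg _) h3) h2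
  let Ψ : (ℝ →ᵇ E) → (ℝ →ᵇ E) := fun w =>
    BoundedContinuousFunction.ofNormedAddCommGroup (op w) (hop_cont w) _ (hop_bdd w)
  have hΨ : ContractingWith (1 / 2) Ψ := by
    refine ⟨by norm_num, LipschitzWith.of_dist_le_mul fun w w' => ?_⟩
    rw [BoundedContinuousFunction.dist_le (by positivity)]
    intro t
    have hτ : 0 ≤ max t 0 := le_max_right _ _
    change dist (op w t) (op w' t) ≤ _
    simp only [op]
    generalize max t 0 = τ at hτ
    have h4 := Real.exp_pos (-(lam * τ))
    rw [dist_eq_norm, ← smul_sub, add_sub_add_left_eq_sub,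
      ← intervalIntegral.integral_sub (hint w _ _) (hint w' _ _), norm_smul, Real.norm_eq_abs,
      abs_of_pos h4]
    have h1 : ‖∫ s in (0 : ℝ)..τ,
        (G s (Real.exp (lam * s) • w s) - G s (Real.exp (lam * s) • w' s))‖ ≤
        ∫ s in (0 : ℝ)..τ, (K * dist w w') * Real.exp (lam * s) := by
      refine intervalIntegral.norm_integral_le_of_norm_le hτ ?_ ?_
      · refine Eventually.of_forall fun s _ => ?_
        rw [← dist_eq_norm]
        refine ((hlip s).dist_le_mul _ _).trans ?_
        rw [dist_eq_norm, ← smul_sub, norm_smul, Real.norm_eq_abs, Real.abs_exp, ← dist_eq_norm,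
          mul_assoc, mul_comm (dist w w')]
        gcongr
        exact BoundedContinuousFunction.dist_coe_le_dist s
      · exact Continuous.intervalIntegrable (by fun_prop) _ _
    have h2 := exp_neg_mul_integral_exp_le (τ := τ) (c := K * dist w w') hlam (by positivity)
    calc _ ≤ Real.exp (-(lam * τ)) * ∫ s in (0 : ℝ)..τ, (K * dist w w') * Real.exp (lam * s) := by
          gcongr
      _ ≤ K * dist w w' / lam := h2
      _ ≤ _ := by
          rw [div_le_iff₀ hlam]
          push_cast
          rw [hlam_def]
          have : 0 ≤ dist w w' := dist_nonneg
          nlinarith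
  set w := ContractingWith.fixedPoint Ψ hΨ
  have hw : Ψ w = w := ContractingWith.fixedPoint_isFixedPt hΨ
  refine ⟨fun s => Real.exp (lam * s) • w s, hcurve w, fun t ht => ?_⟩
  have h1 : w t = op w t := by
    conv_lhs => rw [← hw]
    rfl
  simp only
  conv_lhs => rw [h1]
  simp only [op]
  rw [max_eq_left ht, smul_smul, ← Real.exp_add]
  simp

/-- Integral form of Grönwall's inequality with zero initial value. -/
theorem eq_zero_of_norm_le_mul_integral {E : Type*} [NormedAddCommGroup E] {f : ℝ → E} {K a : ℝ}
    (hf : ContinuousOn f (Icc 0 a))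
    (h : ∀ t ∈ Icc 0 a, ‖f t‖ ≤ K * ∫ s in (0 : ℝ)..t, ‖f s‖) : ∀ t ∈ Icc 0 a, f t = 0 := by
  intro t ht
  have ha : 0 ≤ a := ht.1.trans ht.2
  -- Extending by constants outside [0, a] makes the primitive differentiable everywhere, so that
  -- the differential Grönwall inequality applies to it.
  set g : ℝ → ℝ := fun t => ‖f (projIcc 0 a ha t)‖ with hg
  have hgc : Continuous g :=
    (hf.domRestrict.comp continuous_projIcc).norm
  have hgf : ∀ t ∈ Icc 0 a, g t = ‖f t‖ := fun t ht => by
    simp only [hg, projIcc_of_mem ha ht]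
  have hint : ∀ t ∈ Icc 0 a, ∫ s in (0 : ℝ)..t, ‖f s‖ = ∫ s in (0 : ℝ)..t, g s := fun t ht => by
    refine intervalIntegral.integral_congr fun s hs => ?_
    rw [uIcc_of_le ht.1] at hs
    exact (hgf s ⟨hs.1, hs.2.trans ht.2⟩).symm
  have hd : ∀ t, HasDerivAt (fun t => ∫ s in (0 : ℝ)..t, g s) (g t) t := fun t =>
    intervalIntegral.integral_hasDerivAt_right (hgc.intervalIntegrable _ _)
      hgc.stronglyMeasurable.stronglyMeasurableAtFilter hgc.continuousAt
  have hgron := eq_zero_of_abs_deriv_le_mul_abs_self_of_eq_zero_right (a := 0) (b := a) (K := K)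
    (f := fun t => ∫ s in (0 : ℝ)..t, g s) (f' := g)
    (fun t _ => (hd t).continuousAt.continuousWithinAt)
    (fun t _ => (hd t).hasDerivWithinAt) (by simp) (fun s hs => by
      have hs' : s ∈ Icc 0 a := ⟨hs.1, hs.2.le⟩
      have h0 : 0 ≤ ∫ s in (0 : ℝ)..s, g s :=
        intervalIntegral.integral_nonneg hs.1 fun _ _ => norm_nonneg _
      rw [hgf s hs', norm_norm, Real.norm_of_nonneg h0, ← hint s hs']
      exact h s hs') t ht
  have := h t ht
  rw [hint t ht, hgron, mul_zero] at this
  exact norm_le_zero_iff.1 this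

/-- A curve that is continuous up to the initial time, locally Lipschitz afterwards, with an
almost everywhere derivative given by a bounded field, is the primitive of this field. -/
theorem eq_add_integral_of_ae_hasDerivAt {E : Type*} [NormedAddCommGroup E]
    [NormedSpace ℝ E] [CompleteSpace E] {u f : ℝ → E} {a B : ℝ}
    (hu : ContinuousOn u (Ico 0 a)) (hl : LocallyLipschitzOn (Ioo 0 a) u)
    (hf : AEStronglyMeasurable f volume) (hB : ∀ t, ‖f t‖ ≤ B)
    (hd : ∀ᵐ t ∂volume.restrict (Ioo 0 a), HasDerivAt u (f t) t) :
    ∀ t ∈ Ico 0 a, u t = u 0 + ∫ s in (0 : ℝ)..t, f s := by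
  intro t ht
  rcases eq_or_lt_of_le ht.1 with rfl | ht0
  · simp
  have hint := intervalIntegrable_of_norm_le hf hB
  have hB0 : 0 ≤ B := (norm_nonneg _).trans (hB 0)
  set F : ℝ → E := fun t => ∫ s in (0 : ℝ)..t, f s with hF
  have hFl : LipschitzWith (Real.toNNReal B) F := by
    refine LipschitzWith.of_dist_le_mul fun x y => ?_
    rw [dist_eq_norm, hF]
    simp only
    rw [intervalIntegral.integral_interval_sub_left (hint _ _) (hint _ _), Real.dist_eq,
      Real.coe_toNNReal _ hB0]
    exact intervalIntegral.norm_integral_le_of_norm_le_const fun s _ => hB s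
  have hFd : ∀ᵐ x, HasDerivAt F (f x) x := by
    have hloc : LocallyIntegrable f volume := by
      intro x
      refine ⟨Icc (x - 1) (x + 1), Icc_mem_nhds (by linarith) (by linarith), ?_⟩
      exact Measure.integrableOn_of_bounded (by simp) hf (Eventually.of_forall hB)
    filter_upwards [LocallyIntegrable.ae_hasDerivAt_integral hloc] with x hx using hx 0
  rw [ae_restrict_iff' measurableSet_Ioo] at hd
  -- On [c, t] with c > 0 both curves are Lipschitz, hence absolutely continuous, and their
  -- difference has zero derivative almost everywhere.
  have hconst : ∀ c ∈ Ioc 0 t, u c - F c = u t - F t := by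
    intro c hc
    have hsub : uIcc c t ⊆ Ioo 0 a := by
      rw [uIcc_of_le hc.2]
      exact fun x hx => ⟨hc.1.trans_le hx.1, hx.2.trans_lt ht.2⟩
    obtain ⟨K, hK⟩ := (hl.mono hsub).exists_lipschitzOnWith_of_compact isCompact_uIcc
    have hac : AbsolutelyContinuousOnInterval (u - F) c t :=
      hK.absolutelyContinuousOnInterval.sub hFl.lipschitzOnWith.absolutelyContinuousOnInterval
    obtain ⟨C, hC⟩ := hac.const_of_ae_hasDerivAt_zero (by
      filter_upwards [hd, hFd] with x h1 h2 hx
      simpa using! (h1 (hsub hx)).sub h2)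
    have h1 := hC c left_mem_uIcc
    have h2 := hC t right_mem_uIcc
    simp only [Pi.sub_apply] at h1 h2
    rw [h1, h2]
  -- No Lipschitz bound is available at time 0; continuity alone carries the constant value there.
  have hlim : Tendsto (fun c => u c - F c) (𝓝[Ioc 0 t] 0) (𝓝 (u 0 - F 0)) := by
    have h1 : Tendsto u (𝓝[Ioc 0 t] 0) (𝓝 (u 0)) :=
      (hu 0 ⟨le_rfl, ht0.trans ht.2⟩).mono (fun x hx => ⟨hx.1.le, hx.2.trans_lt ht.2⟩)
    exact h1.sub (hFl.continuous.continuousAt.tendsto.mono_left nhdsWithin_le_nhds)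
  have hne : (𝓝[Ioc 0 t] (0 : ℝ)).NeBot := by
    rw [nhdsWithin_Ioc_eq_nhdsGT ht0]
    infer_instance
  have := tendsto_nhds_unique hlim
    ((tendsto_const_nhds (x := u t - F t)).congr' (by
      filter_upwards [self_mem_nhdsWithin] with c hc using (hconst c hc).symm))
  have hF0 : F 0 = 0 := by simp [hF]
  rw [hF0, sub_zero] at this
  rw [this]
  simp [hF]

end Caratheodory
end

noncomputable section
open scoped NNReal

/-! ### Paths with a time change: clamping and uniqueness -/

section ShiftODE

variable {E : Type*} [NormedAddCommGroup E]

/-- Assumptions of Carathéodory type on the right-hand side, away from the final time. -/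
structure IsTimeChangeField (Text : ℝ) (F : ℝ → E → ℝ → E × ℝ) : Prop where
  snd_le : ∀ t z, ∀ T ∈ Ico 0 Text, |(F t z T).2| ≤ 1 / 2
  fst_le : ∀ c ∈ Ico 0 Text, ∃ B, ∀ t z, ∀ T ∈ Icc 0 c, ‖(F t z T).1‖ ≤ B
  lipschitz : ∀ c ∈ Ico 0 Text, ∃ K : ℝ≥0, ∀ t z z', ∀ T ∈ Icc 0 c, ∀ T' ∈ Icc 0 c,
    dist (F t z T) (F t z' T') ≤ K * dist (z, T) (z', T')
  measurable : ∀ c ∈ Ico 0 Text, ∀ u : ℝ → E × ℝ, Continuous u →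
    AEStronglyMeasurable (fun t => F t (u t).1 (max 0 (min (u t).2 c))) volume

/-- The velocity of `(z, T)`, with the time variable `T` clamped to `[0, c]`. -/
def clampedField (F : ℝ → E → ℝ → E × ℝ) (c t : ℝ) (p : E × ℝ) : E × ℝ :=
  F t p.1 (max 0 (min p.2 c)) + (0, 1)

theorem clamp_mem {c : ℝ} (hc : 0 ≤ c) (T : ℝ) : max 0 (min T c) ∈ Icc 0 c :=
  ⟨le_max_left _ _, max_le hc (min_le_right _ _)⟩

namespace IsTimeChangeField

variable {Text : ℝ} {F : ℝ → E → ℝ → E × ℝ}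

theorem exists_bound (hF : IsTimeChangeField Text F) {c : ℝ} (hc : c ∈ Ico 0 Text) :
    ∃ B, ∀ t p, ‖clampedField F c t p‖ ≤ B := by
  obtain ⟨B, hB⟩ := hF.fst_le c hc
  -- The 3/2 is the bound 1 + 1/2 for the rate of T.
  refine ⟨max B (3 / 2), fun t p => ?_⟩
  have hm := clamp_mem hc.1 p.2
  rw [Prod.norm_def]
  refine max_le ?_ ?_
  · simpa [clampedField] using Or.inl (hB t p.1 _ hm)
  · have := abs_le.1 (hF.snd_le t p.1 _ ⟨hm.1, hm.2.trans_lt hc.2⟩)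
    refine le_trans ?_ (le_max_right _ _)
    simp only [clampedField, Prod.snd_add, Real.norm_eq_abs]
    rw [abs_le]
    constructor <;> linarith [this.1, this.2]

theorem exists_lipschitz (hF : IsTimeChangeField Text F) {c : ℝ} (hc : c ∈ Ico 0 Text) :
    ∃ K : ℝ≥0, ∀ t, LipschitzWith K (clampedField F c t) := by
  obtain ⟨K, hK⟩ := hF.lipschitz c hc
  refine ⟨K, fun t => LipschitzWith.of_dist_le_mul fun p q => ?_⟩
  simp only [clampedField, dist_add_right]
  refine (hK t _ _ _ (clamp_mem hc.1 _) _ (clamp_mem hc.1 _)).trans ?_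
  gcongr
  rw [Prod.dist_eq, Prod.dist_eq]
  refine max_le_max le_rfl ?_
  have h1 : LipschitzWith 1 fun T : ℝ => max 0 (min T c) :=
    (LipschitzWith.id.min_const c).const_max 0
  simpa using h1.dist_le_mul p.2 q.2

theorem measurable_clampedField (hF : IsTimeChangeField Text F) {c : ℝ} (hc : c ∈ Ico 0 Text)
    {u : ℝ → E × ℝ} (hu : Continuous u) :
    AEStronglyMeasurable (fun t => clampedField F c t (u t)) volume :=
  (hF.measurable c hc u hu).add aestronglyMeasurable_const

/-- The rate 1 + (T - id)' stays away from 0. This makes T strictly increasing and forces it to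
reach every level c in finite time. -/
theorem clampedField_snd_mem (hF : IsTimeChangeField Text F) {c : ℝ} (hc : c ∈ Ico 0 Text)
    (t : ℝ) (p : E × ℝ) : (clampedField F c t p).2 ∈ Icc (1 / 2 : ℝ) (3 / 2) := by
  have hm := clamp_mem hc.1 p.2
  have := abs_le.1 (hF.snd_le t p.1 _ ⟨hm.1, hm.2.trans_lt hc.2⟩)
  simp only [clampedField, Prod.snd_add, mem_Icc]
  constructor <;> linarith [this.1, this.2]

end IsTimeChangeField

variable [NormedSpace ℝ E]

/-- A path `z` together with a time change `T` onto `(0, Text)`, both starting at zero, that solves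
`z' = (F t z T).1`, `(T - id)' = (F t z T).2` almost everywhere on `(0, a)`. -/
structure IsTimeChangeSolution (Text : ℝ) (F : ℝ → E → ℝ → E × ℝ) (a : ℝ) (z : ℝ → E)
    (T : ℝ → ℝ) : Prop where
  horizon_pos : 0 < a
  z_continuousOn : ContinuousOn z (Ico 0 a)
  z_locallyLipschitzOn : LocallyLipschitzOn (Ioo 0 a) z
  T_lipschitzOn : ∃ K, LipschitzOnWith K T (Ico 0 a)
  T_strictMonoOn : StrictMonoOn T (Ioo 0 a)
  T_bijOn : BijOn T (Ioo 0 a) (Ioo 0 Text)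
  z_zero : z 0 = 0
  T_zero : T 0 = 0
  ode : ∀ᵐ t ∂(volume.restrict (Ioo 0 a)),
    HasDerivAt z (F t (z t) (T t)).1 t ∧ HasDerivAt (fun s => T s - s) (F t (z t) (T t)).2 t

/-- Integral curves on `[0, a]` of the clamped field that start at zero and do not feel the
clamping. -/
structure IsClampedCurve (F : ℝ → E → ℝ → E × ℝ) (c a : ℝ) (u : ℝ → E × ℝ) : Prop where
  continuous : Continuous u
  eq_integral : ∀ t ∈ Icc 0 a, u t = ∫ s in (0 : ℝ)..t, clampedField F c s (u s)
  mem_Icc : ∀ t ∈ Icc 0 a, (u t).2 ∈ Icc 0 c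

namespace IsTimeChangeField

variable {Text : ℝ} {F : ℝ → E → ℝ → E × ℝ}

/-- Since T stays below c along the curve, the clamp at c and any clamp at a higher level are both
inactive. Curves for different levels can therefore be compared. -/
theorem _root_.IsClampedCurve.mono {c c' a a' : ℝ} {u : ℝ → E × ℝ}
    (hu : IsClampedCurve F c a u) (hcc : c ≤ c') (haa : a' ≤ a) : IsClampedCurve F c' a' u := by
  refine ⟨hu.continuous, fun t ht => ?_, fun t ht => ?_⟩
  · rw [hu.eq_integral t ⟨ht.1, ht.2.trans haa⟩]
    refine intervalIntegral.integral_congr fun s hs => ?_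
    rw [uIcc_of_le ht.1] at hs
    have := hu.mem_Icc s ⟨hs.1, hs.2.trans (ht.2.trans haa)⟩
    simp only [clampedField, min_eq_left this.2, min_eq_left (this.2.trans hcc)]
  · have := hu.mem_Icc t ⟨ht.1, ht.2.trans haa⟩
    exact ⟨this.1, this.2.trans hcc⟩

/-- Grönwall for the difference of two curves, using the uniform Lipschitz constant of the field
clamped at c. -/
theorem clampedCurve_unique (hF : IsTimeChangeField Text F) {c a : ℝ} (hc : c ∈ Ico 0 Text)
    {u v : ℝ → E × ℝ} (hu : IsClampedCurve F c a u) (hv : IsClampedCurve F c a v) :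
    EqOn u v (Icc 0 a) := by
  obtain ⟨B, hB⟩ := hF.exists_bound hc
  obtain ⟨K, hK⟩ := hF.exists_lipschitz hc
  have hiu := intervalIntegrable_of_norm_le (hF.measurable_clampedField hc hu.continuous)
    fun t => hB t (u t)
  have hiv := intervalIntegrable_of_norm_le (hF.measurable_clampedField hc hv.continuous)
    fun t => hB t (v t)
  have hcu := hu.continuous
  have hcv := hv.continuous
  intro t ht
  refine sub_eq_zero.1 (eq_zero_of_norm_le_mul_integral (f := fun t => u t - v t) (K := K)
    (by fun_prop) (fun t ht => ?_) t ht)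
  rw [hu.eq_integral t ht, hv.eq_integral t ht, ← intervalIntegral.integral_sub (hiu _ _) (hiv _ _),
    ← intervalIntegral.integral_const_mul]
  refine intervalIntegral.norm_integral_le_of_norm_le ht.1 (Eventually.of_forall fun s _ => ?_)
    (Continuous.intervalIntegrable (by fun_prop) _ _)
  rw [← dist_eq_norm, ← dist_eq_norm]
  exact (hK s).dist_le_mul _ _

variable [CompleteSpace E]

theorem snd_sub_mem (hF : IsTimeChangeField Text F) {c : ℝ} (hc : c ∈ Ico 0 Text)
    {u : ℝ → E × ℝ} (hu : Continuous u) {x y : ℝ} (hxy : x ≤ y)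
    (hx : u x = ∫ s in (0 : ℝ)..x, clampedField F c s (u s))
    (hy : u y = ∫ s in (0 : ℝ)..y, clampedField F c s (u s)) :
    (u y).2 - (u x).2 ∈ Icc ((y - x) / 2) (3 / 2 * (y - x)) := by
  obtain ⟨B, hB⟩ := hF.exists_bound hc
  have hm := hF.measurable_clampedField hc hu
  have hint := intervalIntegrable_of_norm_le hm fun t => hB t (u t)
  have h1 : u y - u x = ∫ s in x..y, clampedField F c s (u s) := by
    rw [hx, hy, intervalIntegral.integral_interval_sub_left (hint _ _) (hint _ _)]
  have h2 : (u y).2 - (u x).2 = ∫ s in x..y, (clampedField F c s (u s)).2 := by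
    rw [← Prod.snd_sub, h1]
    exact ((ContinuousLinearMap.snd ℝ E ℝ).intervalIntegral_comp_comm (hint x y)).symm
  have hint2 : IntervalIntegrable (fun s => (clampedField F c s (u s)).2) volume x y :=
    ⟨(hint x y).1.snd, (hint x y).2.snd⟩
  rw [h2]
  constructor
  · have := intervalIntegral.integral_mono_on (f := fun _ => (1 / 2 : ℝ)) hxy (by simp) hint2
      fun s _ => (hF.clampedField_snd_mem hc s (u s)).1
    simp at this ⊢
    linarith
  · have := intervalIntegral.integral_mono_on (g := fun _ => (3 / 2 : ℝ)) hxy hint2 (by simp)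
      fun s _ => (hF.clampedField_snd_mem hc s (u s)).2
    simp at this ⊢
    linarith

/-- Existence of integral curves until the time variable reaches a prescribed value. -/
theorem exists_clampedCurve (hF : IsTimeChangeField Text F) {c : ℝ} (hc0 : 0 < c)
    (hc : c < Text) :
    ∃ a u, 0 < a ∧ a ≤ 2 * c ∧ IsClampedCurve F c a u ∧ (u a).2 = c := by
  have hc' : c ∈ Ico 0 Text := ⟨hc0.le, hc⟩
  obtain ⟨B, hB⟩ := hF.exists_bound hc'
  obtain ⟨K, hK⟩ := hF.exists_lipschitz hc'
  obtain ⟨u, hu, hint⟩ := exists_integral_curve hK hB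
    (fun u hu => hF.measurable_clampedField hc' hu) 0
  simp only [zero_add] at hint
  have hu0 : u 0 = 0 := by rw [hint 0 le_rfl]; simp
  have hgrow : ∀ x y, 0 ≤ x → x ≤ y → (u y).2 - (u x).2 ∈ Icc ((y - x) / 2) (3 / 2 * (y - x)) :=
    fun x y hx hxy => hF.snd_sub_mem hc' hu hxy (hint x hx) (hint y (hx.trans hxy))
  -- T grows at rate at least 1/2 from 0, so it has passed c by time 2c.
  have hivt : c ∈ (fun t => (u t).2) '' Icc 0 (2 * c) := by
    refine intermediate_value_Icc (by linarith) (by fun_prop) ⟨?_, ?_⟩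
    · simp [hu0, hc0.le]
    · have := (hgrow 0 (2 * c) le_rfl (by linarith)).1
      simp [hu0] at this ⊢
      linarith
  obtain ⟨a, ha, hac⟩ := hivt
  simp only at hac
  refine ⟨a, u, ?_, ha.2, ⟨hu, fun t ht => hint t ht.1, fun t ht => ?_⟩, hac⟩
  · rcases eq_or_lt_of_le ha.1 with rfl | h
    · simp [hu0] at hac; linarith
    · exact h
  · have h1 := (hgrow 0 t le_rfl ht.1).1
    have h2 := (hgrow t a ht.1 ht.2).1
    have h3 := ht.1
    have h4 := ht.2
    simp [hu0] at h1
    constructor <;> linarith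

/-- Solutions coincide with integral curves of the clamped field on compact time intervals. -/
theorem exists_clampedCurve_of_solution (hF : IsTimeChangeField Text F) {b a c : ℝ} {z : ℝ → E}
    {T : ℝ → ℝ} (hS : IsTimeChangeSolution Text F b z T) (ha : a ∈ Ioo 0 b)
    (hc : c ∈ Ico 0 Text) (hTc : T a ≤ c) :
    ∃ u, IsClampedCurve F c a u ∧ ∀ t ∈ Icc 0 a, u t = (z t, T t) := by
  have hTcont : ContinuousOn T (Ico 0 b) := hS.T_lipschitzOn.choose_spec.continuousOn
  have hsub : Icc 0 a ⊆ Ico 0 b := fun x hx => ⟨hx.1, hx.2.trans_lt ha.2⟩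
  have hcont : ContinuousOn (fun t => (z t, T t)) (Ico 0 b) := hS.z_continuousOn.prodMk hTcont
  -- Constant extension outside [0, a]: the measurability hypothesis on the field requires a curve
  -- that is continuous on all of ℝ.
  set u : ℝ → E × ℝ := fun t => (fun t => (z t, T t)) (projIcc 0 a ha.1.le t) with hu
  have huc : Continuous u := (hcont.mono hsub).domRestrict.comp continuous_projIcc
  have hueq : ∀ t ∈ Icc 0 a, u t = (z t, T t) := fun t ht => by
    simp only [hu, projIcc_of_mem ha.1.le ht]
  have hmem : ∀ t ∈ Icc 0 a, (u t).2 ∈ Icc 0 c := fun t ht => by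
    rw [hueq t ht]
    rcases eq_or_lt_of_le ht.1 with rfl | h0
    · simpa [hS.T_zero] using hc.1
    · have htb : t ∈ Ioo 0 b := ⟨h0, ht.2.trans_lt ha.2⟩
      exact ⟨(hS.T_bijOn.mapsTo htb).1.le, (hS.T_strictMonoOn.monotoneOn htb ha ht.2).trans hTc⟩
  refine ⟨u, ⟨huc, fun t ht => ?_, hmem⟩, hueq⟩
  obtain ⟨B, hB⟩ := hF.exists_bound hc
  have hm := hF.measurable_clampedField hc huc
  have hu0 : u 0 = 0 := by
    rw [hueq 0 ⟨le_rfl, ha.1.le⟩, hS.z_zero, hS.T_zero]; rfl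
  have hl : LocallyLipschitzOn (Ioo 0 a) u := by
    have h1 : LocallyLipschitzOn (Ioo 0 a) fun t => (z t, T t) := by
      intro x hx
      obtain ⟨K, s, hs, hK⟩ := hS.z_locallyLipschitzOn ⟨hx.1, hx.2.trans ha.2⟩
      obtain ⟨K', hK'⟩ := hS.T_lipschitzOn
      refine ⟨max K K', s ∩ Ioo 0 a, ?_, (hK.mono inter_subset_left).prodMk
        (hK'.mono fun y hy => ⟨hy.2.1.le, hy.2.2.trans ha.2⟩)⟩
      exact inter_mem (nhdsWithin_mono _ (Ioo_subset_Ioo_right ha.2.le) hs) self_mem_nhdsWithin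
    intro x hx
    obtain ⟨K, s, hs, hK⟩ := h1 hx
    refine ⟨K, s ∩ Ioo 0 a, inter_mem hs self_mem_nhdsWithin, ?_⟩
    intro y hy y' hy'
    rw [hueq y ⟨hy.2.1.le, hy.2.2.le⟩, hueq y' ⟨hy'.2.1.le, hy'.2.2.le⟩]
    exact hK hy.1 hy'.1
  have hae : ∀ᵐ t ∂volume.restrict (Ioo 0 a), HasDerivAt u (clampedField F c t (u t)) t := by
    have hode := hS.ode
    rw [ae_restrict_iff' measurableSet_Ioo] at hode ⊢
    filter_upwards [hode] with x hx hxa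
    obtain ⟨h1, h2⟩ := hx ⟨hxa.1, hxa.2.trans ha.2⟩
    have hxI : x ∈ Icc 0 a := ⟨hxa.1.le, hxa.2.le⟩
    have hmx := hmem x hxI
    rw [hueq x hxI] at hmx ⊢
    have h3 : HasDerivAt T ((F x (z x) (T x)).2 + 1) x := by
      simpa using h2.fun_add (hasDerivAt_id' x)
    have h4 : HasDerivAt (fun t => (z t, T t)) (clampedField F c x (z x, T x)) x := by
      convert h1.prodMk h3 using 1
      simp only [clampedField]
      rw [min_eq_left hmx.2, max_eq_right hmx.1]
      ext <;> simp
    refine h4.congr_of_eventuallyEq ?_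
    filter_upwards [Ioo_mem_nhds hxa.1 hxa.2] with y hy using hueq y ⟨hy.1.le, hy.2.le⟩
  have hmain := eq_add_integral_of_ae_hasDerivAt (huc.continuousOn) hl hm
    (fun t => hB t (u t)) hae
  rw [hu0] at hmain
  simp only [zero_add] at hmain
  -- The integral identity is known on [0, a) only; at t = a it follows because the set where it
  -- holds is closed.
  rcases eq_or_lt_of_le ht.2 with rfl | hlt
  · have hcl : IsClosed {t | u t = ∫ s in (0 : ℝ)..t, clampedField F c s (u s)} := by
      refine isClosed_eq huc ?_
      exact intervalIntegral.continuous_primitive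
        (fun x y => intervalIntegrable_of_norm_le hm (fun t => hB t (u t)) x y) 0
    have hss : Ico 0 t ⊆ {t | u t = ∫ s in (0 : ℝ)..t, clampedField F c s (u s)} := hmain
    have := hcl.closure_subset_iff.2 hss
    rw [closure_Ico ha.1.ne] at this
    exact this ⟨ha.1.le, le_rfl⟩
  · exact hmain t ⟨ht.1, hlt⟩

/-- Up to time t both time changes stay below c = max (T t) (T' t) < Text. Both solutions are then
curves of the same clamped field, where uniqueness is known. -/
theorem solution_eqOn (hF : IsTimeChangeField Text F) {b b' : ℝ} {z z' : ℝ → E} {T T' : ℝ → ℝ}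
    (hS : IsTimeChangeSolution Text F b z T) (hS' : IsTimeChangeSolution Text F b' z' T')
    {t : ℝ} (ht0 : 0 ≤ t) (ht : t < b) (ht' : t < b') : z t = z' t ∧ T t = T' t := by
  rcases eq_or_lt_of_le ht0 with rfl | h0
  · exact ⟨hS.z_zero.trans hS'.z_zero.symm, hS.T_zero.trans hS'.T_zero.symm⟩
  have h1 := hS.T_bijOn.mapsTo ⟨h0, ht⟩
  have h2 := hS'.T_bijOn.mapsTo ⟨h0, ht'⟩
  have hc : max (T t) (T' t) ∈ Ico 0 Text := ⟨h1.1.le.trans (le_max_left _ _), max_lt h1.2 h2.2⟩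
  obtain ⟨u, hu, hueq⟩ := hF.exists_clampedCurve_of_solution hS ⟨h0, ht⟩ hc (le_max_left _ _)
  obtain ⟨v, hv, hveq⟩ := hF.exists_clampedCurve_of_solution hS' ⟨h0, ht'⟩ hc (le_max_right _ _)
  have := hF.clampedCurve_unique hc hu hv ⟨ht0, le_rfl⟩
  rw [hueq t ⟨ht0, le_rfl⟩, hveq t ⟨ht0, le_rfl⟩] at this
  exact Prod.mk.inj this

/-- If b' < b, the value T(b') < Text would be taken by T' at some t < b'. There T' = T, so T(t) =
T(b'), against strict monotonicity. -/
theorem horizon_le (hF : IsTimeChangeField Text F) {b b' : ℝ} {z z' : ℝ → E} {T T' : ℝ → ℝ}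
    (hS : IsTimeChangeSolution Text F b z T) (hS' : IsTimeChangeSolution Text F b' z' T') :
    b ≤ b' := by
  by_contra! hlt
  have hb' : b' ∈ Ioo 0 b := ⟨hS'.horizon_pos, hlt⟩
  obtain ⟨t, ht, hTt⟩ := hS'.T_bijOn.surjOn (hS.T_bijOn.mapsTo hb')
  have h1 := (hF.solution_eqOn hS hS' ht.1.le (ht.2.trans hlt) ht.2).2
  have h2 := hS.T_strictMonoOn ⟨ht.1, ht.2.trans hlt⟩ hb' ht.2
  linarith

end IsTimeChangeField
end ShiftODE
end

/-! ### Existence up to the maximal horizon, by exhaustion -/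

noncomputable section
open scoped NNReal

namespace IsTimeChangeField

variable {E : Type*} [NormedAddCommGroup E] [NormedSpace ℝ E]
  {Text : ℝ} {F : ℝ → E → ℝ → E × ℝ}

theorem lipschitzOnWith_clampedCurve (hF : IsTimeChangeField Text F) {c a : ℝ}
    (hc : c ∈ Ico 0 Text) {u : ℝ → E × ℝ} (hu : IsClampedCurve F c a u) :
    ∃ K, LipschitzOnWith K u (Icc 0 a) := by
  obtain ⟨B, hB⟩ := hF.exists_bound hc
  have hB0 : 0 ≤ B := (norm_nonneg _).trans (hB 0 0)
  have hint := intervalIntegrable_of_norm_le (hF.measurable_clampedField hc hu.continuous)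
    fun t => hB t (u t)
  refine ⟨B.toNNReal, LipschitzOnWith.of_dist_le_mul fun x hx y hy => ?_⟩
  rw [dist_eq_norm, hu.eq_integral x hx, hu.eq_integral y hy,
    intervalIntegral.integral_interval_sub_left (hint _ _) (hint _ _), Real.dist_eq,
      Real.coe_toNNReal _ hB0]
  exact intervalIntegral.norm_integral_le_of_norm_le_const fun s _ => hB s _

variable [CompleteSpace E]

theorem ae_hasDerivAt_clampedCurve (hF : IsTimeChangeField Text F) {c a : ℝ}
    (hc : c ∈ Ico 0 Text) {u : ℝ → E × ℝ} (hu : IsClampedCurve F c a u) :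
    ∀ᵐ t, t ∈ Ioo 0 a → HasDerivAt u (F t (u t).1 (u t).2 + (0, 1)) t := by
  obtain ⟨B, hB⟩ := hF.exists_bound hc
  have hm := hF.measurable_clampedField hc hu.continuous
  have hloc : LocallyIntegrable (fun s => clampedField F c s (u s)) volume := by
    intro x
    refine ⟨Icc (x - 1) (x + 1), Icc_mem_nhds (by linarith) (by linarith), ?_⟩
    exact Measure.integrableOn_of_bounded (by simp) hm (Eventually.of_forall fun t => hB t (u t))
  filter_upwards [LocallyIntegrable.ae_hasDerivAt_integral hloc] with t ht hta
  have h1 : HasDerivAt u (clampedField F c t (u t)) t := by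
    refine (ht 0).congr_of_eventuallyEq ?_
    filter_upwards [Ioo_mem_nhds hta.1 hta.2] with y hy using hu.eq_integral y ⟨hy.1.le, hy.2.le⟩
  have hmx := hu.mem_Icc t ⟨hta.1.le, hta.2.le⟩
  simpa only [clampedField, min_eq_left hmx.2, max_eq_right hmx.1] using h1

/-- Levels c_n increase to Text, and a_n is the time when the curve clamped at c_n reaches c_n. The
curves agree where they overlap, so they glue on [0, b) with b = sup a_n. This b is finite because
a_n ≤ 2 c_n. -/
theorem exists_solution (hF : IsTimeChangeField Text F) (hT : 0 < Text) :
    ∃ b z T, IsTimeChangeSolution Text F b z T := by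
  -- The shift by 2 makes c_0 = Text / 2 positive.
  set c : ℕ → ℝ := fun n => Text * (1 - 1 / (n + 2)) with hc_def
  have hfrac : ∀ n : ℕ, (0 : ℝ) < 1 / (n + 2) ∧ (1 : ℝ) / (n + 2) ≤ 1 / 2 := fun n => by
    have : (0 : ℝ) ≤ n := n.cast_nonneg
    exact ⟨by positivity, by gcongr; linarith⟩
  have hc0 : ∀ n, 0 < c n := fun n => mul_pos hT (by linarith [(hfrac n).2])
  have hcT : ∀ n, c n < Text := fun n => by
    simp only [hc_def]
    nlinarith [(hfrac n).1]
  have hcm : ∀ n, c n ∈ Ico 0 Text := fun n => ⟨(hc0 n).le, hcT n⟩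
  have hcmono : StrictMono c := fun m n hmn => by
    simp only [hc_def]
    have : (m : ℝ) < n := by exact_mod_cast hmn
    gcongr
  have hclim : Tendsto c atTop (𝓝 Text) := by
    have h1 : Tendsto (fun n : ℕ => (1 : ℝ) / (n + 2)) atTop (𝓝 0) := by
      have := (tendsto_const_div_atTop_nhds_zero_nat (1 : ℝ)).comp (tendsto_add_atTop_nat 2)
      refine this.congr fun n => ?_
      simp
    simpa [hc_def] using (h1.const_sub 1).const_mul Text
  choose a u ha0 ha2 hcurve hend using fun n => hF.exists_clampedCurve (hc0 n) (hcT n)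
  have hagree0 : ∀ {n m : ℕ} {t : ℝ}, n ≤ m → 0 ≤ t → t ≤ a n → t ≤ a m → u n t = u m t :=
    fun {n m t} hnm h0 hn hm =>
      hF.clampedCurve_unique (hcm m) ((hcurve n).mono (hcmono.monotone hnm) hn)
        ((hcurve m).mono le_rfl hm) ⟨h0, le_rfl⟩
  have hagree : ∀ {n m : ℕ} {t : ℝ}, 0 ≤ t → t ≤ a n → t ≤ a m → u n t = u m t :=
    fun {n m t} h0 hn hm => by
      rcases le_total n m with h | h
      · exact hagree0 h h0 hn hm
      · exact (hagree0 h h0 hm hn).symm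
  -- If a_m ≤ a_n for n < m, the two curves agree at a_m. There one has T = c_m while the other has
  -- T ≤ c_n < c_m.
  have hamono : StrictMono a := fun n m hnm => by
    by_contra! hle
    have h1 := hagree (n := m) (m := n) (ha0 m).le le_rfl hle
    have h2 := ((hcurve n).mem_Icc (a m) ⟨(ha0 m).le, hle⟩).2
    rw [← h1, hend] at h2
    exact absurd (hcmono hnm) (not_lt.2 h2)
  have habdd : BddAbove (range a) :=
    ⟨2 * Text, by rintro _ ⟨n, rfl⟩; linarith [ha2 n, hcT n]⟩
  set b : ℝ := ⨆ n, a n with hb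
  have hab : ∀ n, a n < b := fun n => (hamono n.lt_succ_self).trans_le (le_ciSup habdd _)
  have hex : ∀ t, t < b → ∃ n, t < a n := fun t ht => exists_lt_of_lt_ciSup ht
  classical
  set w : ℝ → E × ℝ := fun t => if h : ∃ n, t < a n then u (Nat.find h) t else 0 with hw
  have hwu : ∀ n t, 0 ≤ t → t ≤ a n → w t = u n t := fun n t h0 hn => by
    have h : ∃ n, t < a n := ⟨n + 1, hn.trans_lt (hamono n.lt_succ_self)⟩
    simp only [hw, dif_pos h]
    exact hagree h0 (Nat.find_spec h).le hn
  have hgrow : ∀ x y, 0 ≤ x → x ≤ y → y < b →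
      (w y).2 - (w x).2 ∈ Icc ((y - x) / 2) (3 / 2 * (y - x)) := fun x y hx hxy hy => by
    obtain ⟨n, hn⟩ := hex y hy
    rw [hwu n y (hx.trans hxy) hn.le, hwu n x hx (hxy.trans hn.le)]
    exact hF.snd_sub_mem (hcm n) (hcurve n).continuous hxy
      ((hcurve n).eq_integral x ⟨hx, hxy.trans hn.le⟩)
      ((hcurve n).eq_integral y ⟨hx.trans hxy, hn.le⟩)
  have hw0 : w 0 = 0 := by
    rw [hwu 0 0 le_rfl (ha0 0).le, (hcurve 0).eq_integral 0 ⟨le_rfl, (ha0 0).le⟩]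
    simp
  have hwcont : ContinuousOn w (Ico 0 b) := by
    intro t ht
    obtain ⟨n, hn⟩ := hex t ht.2
    have h1 : ContinuousWithinAt (u n) (Ico 0 b) t := (hcurve n).continuous.continuousWithinAt
    refine h1.congr_of_eventuallyEq ?_ (hwu n t ht.1 hn.le)
    filter_upwards [self_mem_nhdsWithin, mem_nhdsWithin_of_mem_nhds (Iio_mem_nhds hn)]
      with x hx hxn using hwu n x hx.1 (le_of_lt hxn)
  have hstrict : StrictMonoOn (fun t => (w t).2) (Ico 0 b) := fun x hx y hy hxy => by
    have := (hgrow x y hx.1 hxy.le hy.2).1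
    simp only
    linarith
  refine ⟨b, fun t => (w t).1, fun t => (w t).2, (ha0 0).trans (hab 0), hwcont.fst, ?_, ?_,
    hstrict.mono Ioo_subset_Ico_self, ⟨?_, (hstrict.mono Ioo_subset_Ico_self).injOn, ?_⟩,
    by simp [hw0], by simp [hw0], ?_⟩
  · intro t ht
    obtain ⟨n, hn⟩ := hex t ht.2
    obtain ⟨K, hK⟩ := hF.lipschitzOnWith_clampedCurve (hcm n) (hcurve n)
    refine ⟨K, Ioo 0 (a n), mem_nhdsWithin_of_mem_nhds (Ioo_mem_nhds ht.1 hn), ?_⟩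
    intro x hx y hy
    simp only
    rw [hwu n x hx.1.le hx.2.le, hwu n y hy.1.le hy.2.le]
    refine le_trans ?_ (hK ⟨hx.1.le, hx.2.le⟩ ⟨hy.1.le, hy.2.le⟩)
    rw [Prod.edist_eq (u n x)]
    exact le_max_left _ _
  · refine ⟨2, LipschitzOnWith.of_dist_le_mul fun x hx y hy => ?_⟩
    wlog hxy : x ≤ y generalizing x y
    · rw [dist_comm, dist_comm x]
      exact this y hy x hx (le_of_not_ge hxy)
    have := hgrow x y hx.1 hxy hy.2
    rw [dist_comm, dist_comm x, Real.dist_eq, Real.dist_eq, abs_of_nonneg (sub_nonneg.2 hxy),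
      abs_le]
    push_cast
    constructor <;> linarith [this.1, this.2]
  · intro t ht
    obtain ⟨n, hn⟩ := hex t ht.2
    have h1 := (hgrow 0 t le_rfl ht.1.le ht.2).1
    have h2 := ((hcurve n).mem_Icc t ⟨ht.1.le, hn.le⟩).2
    rw [← hwu n t ht.1.le hn.le] at h2
    simp [hw0] at h1
    exact ⟨by linarith [ht.1], h2.trans_lt (hcT n)⟩
  · intro y hy
    obtain ⟨n, hn⟩ := (hclim.eventually (lt_mem_nhds hy.2)).exists
    have hsub : Icc 0 (a n) ⊆ Ico 0 b := fun x hx => ⟨hx.1, hx.2.trans_lt (hab n)⟩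
    have hyI : y ∈ Icc ((fun t => (w t).2) 0) ((fun t => (w t).2) (a n)) := by
      simp only [hw0, hwu n _ (ha0 n).le le_rfl, hend]
      exact ⟨hy.1.le, hn.le⟩
    obtain ⟨t, ht, hty⟩ := intermediate_value_Icc (ha0 n).le (hwcont.snd.mono hsub) hyI
    refine ⟨t, ⟨lt_of_le_of_ne ht.1 ?_, (hsub ht).2⟩, hty⟩
    rintro rfl
    simp [hw0] at hty
    exact hy.1.ne hty
  · rw [ae_restrict_iff' measurableSet_Ioo]
    have hall := ae_all_iff.2 fun n => hF.ae_hasDerivAt_clampedCurve (hcm n) (hcurve n)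
    filter_upwards [hall] with t ht htb
    obtain ⟨n, hn⟩ := hex t htb.2
    have h1 := ht n ⟨htb.1, hn⟩
    rw [← hwu n t htb.1.le hn.le] at h1
    have h2 : HasDerivAt w (F t (w t).1 (w t).2 + (0, 1)) t := by
      refine h1.congr_of_eventuallyEq ?_
      filter_upwards [Ioo_mem_nhds htb.1 hn] with y hy using hwu n y hy.1.le hy.2.le
    have h3 : HasDerivAt (fun t => (w t).1) (F t (w t).1 (w t).2).1 t := by
      have := (ContinuousLinearMap.fst ℝ E ℝ).hasFDerivAt.comp_hasDerivAt t h2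
      simpa [Function.comp_def] using this
    have h4 : HasDerivAt (fun t => (w t).2) ((F t (w t).1 (w t).2).2 + 1) t := by
      have := (ContinuousLinearMap.snd ℝ E ℝ).hasFDerivAt.comp_hasDerivAt t h2
      simpa [Function.comp_def] using this
    exact ⟨h3, by simpa using h4.fun_sub (hasDerivAt_id' t)⟩

/-- Existence and uniqueness of the path and of the time change. -/
theorem exists_unique_solution (hF : IsTimeChangeField Text F) (hT : 0 < Text) :
    ∃ b z T, IsTimeChangeSolution Text F b z T ∧
      ∀ b' z' T', IsTimeChangeSolution Text F b' z' T' →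
        b' = b ∧ EqOn z' z (Ico 0 b) ∧ EqOn T' T (Ico 0 b) := by
  obtain ⟨b, z, T, hS⟩ := hF.exists_solution hT
  refine ⟨b, z, T, hS, fun b' z' T' hS' => ?_⟩
  have hbb : b' = b := le_antisymm (hF.horizon_le hS' hS) (hF.horizon_le hS hS')
  subst hbb
  exact ⟨rfl, fun t ht => (hF.solution_eqOn hS' hS ht.1 ht.2 ht.2).1,
    fun t ht => (hF.solution_eqOn hS' hS ht.1 ht.2 ht.2).2⟩

end IsTimeChangeField
end

noncomputable section
open scoped NNReal ENNReal

/-! ### One-dimensional Hausdorff measure along C¹ curves -/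

section Length

variable {V : Type*} [NormedAddCommGroup V] [NormedSpace ℝ V] [MeasurableSpace V] [BorelSpace V]

/-- Length estimate on a piece of curve whose velocity is close to a constant vector. -/
theorem hausdorffMeasure_image_of_deriv_near {γ : ℝ → V} (hγ : Differentiable ℝ γ) {v : V} {ε : ℝ}
    (hε : 0 ≤ ε) {J E : Set ℝ} (hJ : Convex ℝ J) (hv : ∀ θ ∈ J, ‖deriv γ θ - v‖ ≤ ε) (hE : E ⊆ J) :
    μH[1] (γ '' E) ≤ ENNReal.ofReal (‖v‖ + ε) * volume E ∧
      ENNReal.ofReal (‖v‖ - ε) * volume E ≤ μH[1] (γ '' E) := by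
  -- Mean value inequality for γ minus its linear model. Hence γ stretches distances by a factor
  -- between ‖v‖ - ε and ‖v‖ + ε. The upper measure bound uses γ itself, the lower one its Lipschitz
  -- inverse.
  have hmv : ∀ s ∈ J, ∀ t ∈ J, ‖(γ t - γ s) - (t - s) • v‖ ≤ ε * |t - s| := fun s hs t ht => by
    have hd : ∀ x ∈ J, HasDerivWithinAt (fun x => γ x - x • v) (deriv γ x - v) J x := fun x _ => by
      have := (hγ x).hasDerivAt.fun_sub ((hasDerivAt_id' x).smul_const v)
      rw [one_smul] at this
      exact this.hasDerivWithinAt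
    have := Convex.norm_image_sub_le_of_norm_hasDerivWithin_le hd hv hJ hs ht
    rw [Real.norm_eq_abs] at this
    convert this using 2
    rw [sub_smul]
    abel
  constructor
  · have hlip : LipschitzOnWith (‖v‖ + ε).toNNReal γ E := by
      refine LipschitzOnWith.of_dist_le_mul fun s hs t ht => ?_
      rw [Real.coe_toNNReal _ (by positivity), dist_eq_norm, Real.dist_eq]
      have h1 := hmv t (hE ht) s (hE hs)
      have h2 := norm_le_insert' (γ s - γ t) ((s - t) • v)
      rw [norm_smul, Real.norm_eq_abs] at h2
      linarith
    have := hlip.hausdorffMeasure_image_le zero_le_one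
    simpa [hausdorffMeasure_real, ENNReal.ofReal] using this
  · rcases le_or_gt ‖v‖ ε with h | h
    · rw [ENNReal.ofReal_of_nonpos (by linarith)]
      simp
    have hpos : 0 < ‖v‖ - ε := by linarith
    have hlow : ∀ s ∈ E, ∀ t ∈ E, (‖v‖ - ε) * |s - t| ≤ ‖γ s - γ t‖ := fun s hs t ht => by
      have h1 := hmv t (hE ht) s (hE hs)
      have h2 := norm_le_insert (γ s - γ t) ((s - t) • v)
      rw [norm_smul, Real.norm_eq_abs] at h2
      linarith
    have hinj : InjOn γ E := fun s hs t ht hst => by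
      have := hlow s hs t ht
      rw [hst, sub_self, norm_zero] at this
      have h3 : |s - t| ≤ 0 := by
        by_contra! hc
        linarith [mul_pos hpos hc]
      linarith [abs_nonpos_iff.1 h3]
    have hlip : LipschitzOnWith (‖v‖ - ε)⁻¹.toNNReal (Function.invFunOn γ E) (γ '' E) := by
      refine LipschitzOnWith.of_dist_le_mul ?_
      rintro _ ⟨s, hs, rfl⟩ _ ⟨t, ht, rfl⟩
      rw [hinj.leftInvOn_invFunOn hs, hinj.leftInvOn_invFunOn ht,
        Real.coe_toNNReal _ (by positivity), Real.dist_eq, dist_eq_norm, ← div_eq_inv_mul,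
        le_div_iff₀' hpos]
      exact hlow s hs t ht
    have := hlip.hausdorffMeasure_image_le zero_le_one
    rw [hinj.leftInvOn_invFunOn.image_image, hausdorffMeasure_real, ENNReal.rpow_one] at this
    calc _ ≤ ENNReal.ofReal (‖v‖ - ε) * (((‖v‖ - ε)⁻¹.toNNReal : ℝ≥0∞) * μH[1] (γ '' E)) := by
          gcongr
      _ = _ := by
          rw [← mul_assoc]
          change ENNReal.ofReal (‖v‖ - ε) * ENNReal.ofReal (‖v‖ - ε)⁻¹ * _ = _
          rw [← ENNReal.ofReal_mul hpos.le, mul_inv_cancel₀ hpos.ne']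
          simp

/-- Replacing the constant speed ‖v‖ by the actual speed costs one more ε, and the resulting
estimate no longer mentions v. Estimates on different pieces can therefore be summed. -/
theorem hausdorffMeasure_image_piece {γ : ℝ → V} (hγ : Differentiable ℝ γ) {v : V} {ε : ℝ}
    (hε : 0 ≤ ε) {J E : Set ℝ} (hJ : Convex ℝ J) (hv : ∀ θ ∈ J, ‖deriv γ θ - v‖ ≤ ε) (hE : E ⊆ J)
    (hEm : MeasurableSet E) :
    μH[1] (γ '' E) ≤ ∫⁻ θ in E, (‖deriv γ θ‖ₑ + ENNReal.ofReal (2 * ε)) ∧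
      ∫⁻ θ in E, ‖deriv γ θ‖ₑ ≤ μH[1] (γ '' E) + ENNReal.ofReal (2 * ε) * volume E := by
  obtain ⟨h1, h2⟩ := hausdorffMeasure_image_of_deriv_near hγ hε hJ hv hE
  constructor
  · refine h1.trans ?_
    rw [← setLIntegral_const]
    refine setLIntegral_mono' hEm fun θ hθ => ?_
    rw [← ofReal_norm, ← ENNReal.ofReal_add (norm_nonneg _) (by positivity)]
    refine ENNReal.ofReal_le_ofReal ?_
    have := norm_le_insert (deriv γ θ) v
    linarith [hv θ (hE hθ)]
  · calc _ ≤ ∫⁻ θ in E, (ENNReal.ofReal (‖v‖ - ε) + ENNReal.ofReal (2 * ε)) := by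
          refine setLIntegral_mono' hEm fun θ hθ => ?_
          rw [← ofReal_norm]
          refine le_trans (ENNReal.ofReal_le_ofReal ?_) ENNReal.ofReal_add_le
          have := norm_le_insert' (deriv γ θ) v
          linarith [hv θ (hE hθ)]
      _ ≤ _ := by
          rw [setLIntegral_const, add_mul]
          gcongr

/-- The length of the image of a measurable set under an injective `C¹` curve. -/
theorem hausdorffMeasure_image_curve {γ : ℝ → V} (hγ : ContDiff ℝ 1 γ) (hinj : InjOn γ (Ico 0 1))
    {E : Set ℝ} (hE : E ⊆ Ico 0 1) (hEm : MeasurableSet E) :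
    μH[1] (γ '' E) = ∫⁻ θ in E, ‖deriv γ θ‖ₑ := by
  have hdiff : Differentiable ℝ γ := hγ.differentiable one_ne_zero
  have hcont : Continuous (deriv γ) := hγ.continuous_deriv le_rfl
  have hvol : volume E ≤ 1 := (measure_mono hE).trans (by simp)
  have hkey : ∀ ε : ℝ, 0 < ε → μH[1] (γ '' E) ≤ (∫⁻ θ in E, ‖deriv γ θ‖ₑ) + ENNReal.ofReal (2 * ε) ∧
      ∫⁻ θ in E, ‖deriv γ θ‖ₑ ≤ μH[1] (γ '' E) + ENNReal.ofReal (2 * ε) := by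
    intro ε hε
    -- Cut [0, 1) into N intervals on which γ' oscillates by at most ε. The total error is 2ε times
    -- the volume of E, hence at most 2ε.
    have huc := isCompact_Icc.uniformContinuousOn_of_continuous (hcont.continuousOn (s := Icc 0 1))
    obtain ⟨δ, hδ, hδε⟩ := Metric.uniformContinuousOn_iff_le.1 huc ε hε
    obtain ⟨N, hN⟩ := exists_nat_gt (1 / δ)
    have hN0 : (0 : ℝ) < N := (by positivity : (0 : ℝ) < 1 / δ).trans hN
    have hNδ : 1 / (N : ℝ) < δ := by
      rw [div_lt_comm₀ hN0 hδ]; exact hN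
    set J : Fin N → Set ℝ := fun k => Ico (k / N : ℝ) ((k + 1) / N) with hJ
    have hJsub : ∀ k, J k ⊆ Icc 0 1 := fun k x hx => by
      have h1 : (k : ℝ) + 1 ≤ N := by exact_mod_cast k.2
      refine ⟨le_trans (by positivity) hx.1, hx.2.le.trans ?_⟩
      rw [div_le_one hN0]; exact h1
    have hJd : Pairwise (Function.onFun Disjoint J) := by
      intro k l hkl
      wlog hlt : k < l generalizing k l
      · exact (this hkl.symm (lt_of_le_of_ne (not_lt.1 hlt) hkl.symm)).symm
      refine Set.disjoint_left.2 fun x hx hx' => ?_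
      have h1 : (k : ℝ) + 1 ≤ l := by exact_mod_cast hlt
      have h2 : ((k : ℝ) + 1) / N ≤ l / N := by gcongr
      linarith [hx.2, hx'.1]
    have hcover : E = ⋃ k, E ∩ J k := by
      rw [← inter_iUnion, eq_comm, inter_eq_left]
      intro x hx
      have hx' := hE hx
      have hx0 : 0 ≤ x * N := mul_nonneg hx'.1 hN0.le
      have hfl : ⌊x * N⌋₊ < N := by
        rw [Nat.floor_lt hx0]
        nlinarith [hx'.2]
      refine mem_iUnion.2 ⟨⟨⌊x * N⌋₊, hfl⟩, ?_, ?_⟩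
      · rw [div_le_iff₀ hN0]; exact Nat.floor_le hx0
      · rw [lt_div_iff₀ hN0]; exact Nat.lt_floor_add_one _
    have hEk : ∀ k, MeasurableSet (E ∩ J k) := fun k => hEm.inter measurableSet_Ico
    have hEd : Pairwise (Function.onFun Disjoint fun k => E ∩ J k) := fun k l hkl =>
      (hJd hkl).mono inter_subset_right inter_subset_right
    have hpiece := fun k : Fin N => hausdorffMeasure_image_piece hdiff hε.le
      (convex_Ico (k / N : ℝ) ((k + 1) / N)) (v := deriv γ (k / N)) (fun θ hθ => by
        rw [← dist_eq_norm]
        have hpos : (0 : ℝ) < 1 / N := by positivity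
        have hadd : (k + 1 : ℝ) / N = k / N + 1 / N := add_div _ _ _
        refine hδε _ (hJsub k hθ) _ (hJsub k ⟨le_rfl, by rw [hadd]; linarith⟩) ?_
        rw [Real.dist_eq, abs_of_nonneg (by linarith [hθ.1])]
        linarith [hθ.2]) (inter_subset_right (s := E) (t := J k)) (hEk k)
    have himage : μH[1] (γ '' E) = ∑ k, μH[1] (γ '' (E ∩ J k)) := by
      conv_lhs => rw [hcover, image_iUnion]
      rw [measure_iUnion, tsum_fintype]
      · intro k l hkl
        exact (hEd hkl).image hinj (inter_subset_left.trans hE) (inter_subset_left.trans hE)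
      · intro k
        exact (hEk k).image_of_continuousOn_injOn hγ.continuous.continuousOn
          (hinj.mono (inter_subset_left.trans hE))
    have hlint : ∀ f : ℝ → ℝ≥0∞, ∫⁻ θ in E, f θ = ∑ k, ∫⁻ θ in E ∩ J k, f θ := fun f => by
      conv_lhs => rw [hcover]
      rw [lintegral_iUnion hEk hEd, tsum_fintype]
    have hmeas : Measurable fun θ => ‖deriv γ θ‖ₑ := hcont.enorm.measurable
    constructor
    · rw [himage]
      refine (Finset.sum_le_sum fun k _ => (hpiece k).1).trans ?_
      rw [← hlint, lintegral_add_left hmeas, setLIntegral_const]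
      gcongr
      exact mul_le_of_le_one_right' hvol
    · rw [hlint]
      refine (Finset.sum_le_sum fun k _ => (hpiece k).2).trans ?_
      rw [Finset.sum_add_distrib, ← himage, ← Finset.mul_sum]
      gcongr
      have hvs : ∑ k, volume (E ∩ J k) = volume E := by
        have := hlint fun _ => 1
        simp only [setLIntegral_one] at this
        exact this.symm
      rw [hvs]
      exact mul_le_of_le_one_right' hvol
  have hε : ∀ ε : ℝ≥0, 0 < ε → ENNReal.ofReal (2 * ((ε : ℝ) / 2)) = ε := fun ε _ => by
    rw [mul_div_cancel₀ _ two_ne_zero, ENNReal.ofReal_coe_nnreal]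
  refine le_antisymm (ENNReal.le_of_forall_pos_le_add fun ε h0 _ => ?_)
    (ENNReal.le_of_forall_pos_le_add fun ε h0 _ => ?_)
  · rw [← hε ε h0]
    exact (hkey (ε / 2) (by positivity)).1
  · rw [← hε ε h0]
    exact (hkey (ε / 2) (by positivity)).2

/-- Integration along an injective `C¹` curve with respect to its length measure. -/
theorem setIntegral_image_curve {γ : ℝ → V} (hγ : ContDiff ℝ 1 γ) (hinj : InjOn γ (Ico 0 1))
    {G : Type*} [NormedAddCommGroup G] [NormedSpace ℝ G] (f : V → G) :
    ∫ x in γ '' Ico 0 1, f x ∂μH[1] = ∫ θ in Ico (0 : ℝ) 1, ‖deriv γ θ‖ • f (γ θ) := by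
  have hcont : Continuous (deriv γ) := hγ.continuous_deriv le_rfl
  have hs : MeasurableSet (Ico (0 : ℝ) 1) := measurableSet_Ico
  have hemb : MeasurableEmbedding ((Ico (0 : ℝ) 1).domRestrict γ) :=
    hγ.continuous.continuousOn.measurableEmbedding hs hinj
  -- The length measure on the curve is the push-forward of the speed density. The change of
  -- variables then needs no regularity of f.
  have hmap : Measure.map ((Ico (0 : ℝ) 1).domRestrict γ)
      (Measure.comap (↑) (volume.withDensity fun θ => (‖deriv γ θ‖₊ : ℝ≥0∞))) =
      (μH[1] : Measure V).restrict (γ '' Ico 0 1) := by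
    refine Measure.ext fun t ht => ?_
    rw [hemb.map_apply, (MeasurableEmbedding.subtype_coe hs).comap_apply, Measure.restrict_apply ht]
    have hset : ((↑) : Ico (0 : ℝ) 1 → ℝ) '' ((Ico (0 : ℝ) 1).domRestrict γ ⁻¹' t) =
        Ico 0 1 ∩ γ ⁻¹' t := by
      ext x
      simp [and_comm]
    have hm : MeasurableSet (Ico (0 : ℝ) 1 ∩ γ ⁻¹' t) := hs.inter (hγ.continuous.measurable ht)
    rw [hset, withDensity_apply _ hm, inter_comm t, ← image_inter_preimage,
      hausdorffMeasure_image_curve hγ hinj inter_subset_left hm]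
    rfl
  rw [← hmap, hemb.integral_map]
  simp only [Set.domRestrict_apply, ← Function.comp_apply (f := f)]
  rw [← (MeasurableEmbedding.subtype_coe hs).integral_map
    (g := fun θ => (f ∘ γ) θ), map_comap_subtype_coe hs,
    setIntegral_withDensity_eq_setIntegral_smul₀ (by fun_prop) _ hs]
  rfl

end Length
end

noncomputable section
namespace SpaceTimeShift

/-! ### The moving frame in the plane -/

section Rotation

@[simp] theorem rotJ_apply_zero (v : Plane) : rotJ v 0 = -(v 1) := rfl

@[simp] theorem rotJ_apply_one (v : Plane) : rotJ v 1 = v 0 := rfl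

theorem inner_plane (v w : Plane) : inner ℝ v w = v 0 * w 0 + v 1 * w 1 := by
  simp [PiLp.inner_apply, Fin.sum_univ_two, mul_comm]

/-- Rotation by 90 degrees as a continuous linear map. -/
def rotJL : Plane →L[ℝ] Plane :=
  LinearMap.toContinuousLinearMap
    { toFun := rotJ
      map_add' := fun v w => by ext i; fin_cases i <;> simp [rotJ]; ring
      map_smul' := fun c v => by ext i; fin_cases i <;> simp [rotJ] }

theorem inner_rotJ_self (v : Plane) : inner ℝ (rotJ v) v = 0 := by
  simp [inner_plane]; ring

theorem inner_rotJ_rotJ (v w : Plane) : inner ℝ (rotJ v) (rotJ w) = inner ℝ v w := by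
  simp [inner_plane]; ring

theorem norm_rotJ (v : Plane) : ‖rotJ v‖ = ‖v‖ := by
  rw [norm_eq_sqrt_real_inner, norm_eq_sqrt_real_inner v, inner_rotJ_rotJ]

theorem norm_sq_smul_eq (v w : Plane) :
    ‖v‖ ^ 2 • w = (inner ℝ w v : ℝ) • v + (inner ℝ w (rotJ v) : ℝ) • rotJ v := by
  have h : ‖v‖ ^ 2 = v 0 * v 0 + v 1 * v 1 := by
    rw [← real_inner_self_eq_norm_sq, inner_plane]
  ext i
  fin_cases i <;> simp [inner_plane, h] <;> ring

/-- The unit normal on the left of a velocity vector. -/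
def unitNormal (v : Plane) : Plane := ‖v‖⁻¹ • rotJ v

theorem norm_unitNormal {v : Plane} (hv : v ≠ 0) : ‖unitNormal v‖ = 1 := by
  rw [unitNormal, norm_smul, norm_rotJ, norm_inv, norm_norm, inv_mul_cancel₀ (norm_ne_zero_iff.2 hv)]

theorem inner_unitNormal_self (v : Plane) : inner ℝ (unitNormal v) v = 0 := by
  rw [unitNormal, real_inner_smul_left, inner_rotJ_self, mul_zero]

/-- Decomposition of a vector in the frame given by a velocity and its normal. -/
theorem frame_decomposition {v : Plane} (hv : v ≠ 0) (w : Plane) :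
    w = ((inner ℝ w v : ℝ) / ‖v‖ ^ 2) • v + (inner ℝ w (unitNormal v) : ℝ) • unitNormal v := by
  have hn : ‖v‖ ≠ 0 := norm_ne_zero_iff.2 hv
  have h := norm_sq_smul_eq v w
  have h2 : w = (‖v‖ ^ 2)⁻¹ • (‖v‖ ^ 2 • w) := by
    rw [smul_smul, inv_mul_cancel₀ (pow_ne_zero 2 hn), one_smul]
  conv_lhs => rw [h2, h]
  rw [unitNormal, real_inner_smul_right, smul_add, smul_smul, smul_smul, smul_smul]
  congr 2
  · field_simp
  · field_simp

end Rotation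

/-! ### Consequences of a tubular width -/

section Tubular

variable {A : Set Plane} {w : ℝ}

theorem signedDist_eq_zero_of_mem_frontier (hA : IsOpen A) {x : Plane} (hx : x ∈ frontier A) :
    signedDist A x = 0 := by
  rw [hA.frontier_eq] at hx
  rw [signedDist, Metric.infDist_zero_of_mem (show x ∈ Aᶜ from hx.2),
    Metric.infDist_zero_of_mem_closure hx.1, sub_zero]

/-- The gradient takes the default value 0 where differentiability fails, so a gradient of norm 1
already certifies differentiability. -/
theorem hasDerivAt_signedDist_normal {x : Plane} (hn : ‖innerNormal A x‖ = 1) :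
    HasDerivAt (fun ℓ : ℝ => signedDist A (x + ℓ • innerNormal A x)) 1 0 := by
  have hd : DifferentiableAt ℝ (signedDist A) x := by
    by_contra h
    rw [innerNormal, gradient_eq_zero_of_not_differentiableAt h] at hn
    simp at hn
  have h1 : HasDerivAt (fun ℓ : ℝ => x + ℓ • innerNormal A x) (innerNormal A x) 0 := by
    simpa using ((hasDerivAt_id' (0 : ℝ)).smul_const (innerNormal A x)).const_add x
  have h2 : HasFDerivAt (signedDist A) (fderiv ℝ (signedDist A) x) (x + (0 : ℝ) • innerNormal A x) := by
    simpa using hd.hasFDerivAt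
  have h3 := h2.comp_hasDerivAt (0 : ℝ) h1
  have h4 : fderiv ℝ (signedDist A) x (innerNormal A x) = 1 := by
    have h5 := hd.hasGradientAt.hasFDerivAt.fderiv
    rw [h5, InnerProductSpace.toDual_apply_apply]
    change inner ℝ (innerNormal A x) (innerNormal A x) = (1 : ℝ)
    rw [real_inner_self_eq_norm_sq, hn, one_pow]
  rwa [h4] at h3

/-- Within a tubular width, the normal segments enter the open set on the side of the normal. -/
theorem normal_mem_iff (hA : IsOpen A) (hw : IsTubularWidth A w) {x : Plane}
    (hx : x ∈ frontier A) (hn : ‖innerNormal A x‖ = 1) {ℓ : ℝ} (hℓ : |ℓ| < w) :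
    x + ℓ • innerNormal A x ∈ A ↔ 0 < ℓ := by
  have hw0 : 0 < w := (abs_nonneg ℓ).trans_lt hℓ
  have hd := hasDerivAt_signedDist_normal hn
  have h0 : signedDist A (x + (0 : ℝ) • innerNormal A x) = 0 := by
    simpa using signedDist_eq_zero_of_mem_frontier hA hx
  have hcont : Continuous fun ℓ : ℝ => x + ℓ • innerNormal A x := by fun_prop
  have hoff : ∀ ℓ, |ℓ| < w → ℓ ≠ 0 → x + ℓ • innerNormal A x ∉ frontier A := by
    intro ℓ hℓ hne hmem
    have := @hw (x, ℓ) ⟨hx, abs_lt.1 hℓ⟩ (x + ℓ • innerNormal A x, 0)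
      ⟨hmem, by simpa using hw0⟩ (by simp)
    exact hne (Prod.mk.inj this).2
  -- A connected piece of the segment that misses the frontier is covered by the disjoint open sets
  -- A and the complement of its closure. One point on each side, found from the slope of the signed
  -- distance at 0, then decides the whole half-segment.
  have hconn : ∀ S : Set ℝ, IsPreconnected S → (∀ ℓ ∈ S, |ℓ| < w ∧ ℓ ≠ 0) →
      ∀ a ∈ S, ∀ b ∈ S, x + a • innerNormal A x ∈ A → x + b • innerNormal A x ∈ A := by
    intro S hS hSw a ha b hb haA
    by_contra hbA
    have hpre := hS.image (fun ℓ : ℝ => x + ℓ • innerNormal A x) hcont.continuousOn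
    refine hbA (hpre.subset_left_of_subset_union hA (isClosed_closure (s := A)).isOpen_compl
      (disjoint_compl_right.mono_left subset_closure) ?_ ⟨_, mem_image_of_mem _ ha, haA⟩
      (mem_image_of_mem _ hb))
    rintro _ ⟨ℓ, hℓS, rfl⟩
    by_contra hcon
    rw [mem_union, not_or, notMem_compl_iff] at hcon
    exact hoff ℓ (hSw ℓ hℓS).1 (hSw ℓ hℓS).2 (by rw [hA.frontier_eq]; exact ⟨hcon.2, hcon.1⟩)
  have hpos : ∃ a ∈ Ioo 0 w, x + a • innerNormal A x ∈ A := by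
    have h1 : ∀ᶠ a in 𝓝[>] (0 : ℝ), 0 < slope (fun ℓ : ℝ => signedDist A (x + ℓ • innerNormal A x)) 0 a :=
      ((hasDerivAt_iff_tendsto_slope.1 hd).mono_left
        (nhdsWithin_mono _ fun y hy => ne_of_gt hy)).eventually (lt_mem_nhds one_pos)
    obtain ⟨a, ha, haw⟩ := (h1.and (Ioo_mem_nhdsGT hw0)).exists
    refine ⟨a, haw, ?_⟩
    rw [slope_def_field, h0, sub_zero, sub_zero] at ha
    have ha' := (div_pos_iff_of_pos_right haw.1).1 ha
    by_contra hmem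
    rw [signedDist, Metric.infDist_zero_of_mem (show _ ∈ Aᶜ from hmem)] at ha'
    linarith [Metric.infDist_nonneg (x := x + a • innerNormal A x) (s := A)]
  have hneg : ∃ a ∈ Ioo (-w) 0, x + a • innerNormal A x ∉ A := by
    have h1 : ∀ᶠ a in 𝓝[<] (0 : ℝ), 0 < slope (fun ℓ : ℝ => signedDist A (x + ℓ • innerNormal A x)) 0 a :=
      ((hasDerivAt_iff_tendsto_slope.1 hd).mono_left
        (nhdsWithin_mono _ fun y hy => ne_of_lt hy)).eventually (lt_mem_nhds one_pos)
    obtain ⟨a, ha, haw⟩ := (h1.and (Ioo_mem_nhdsLT (show -w < 0 by linarith))).exists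
    refine ⟨a, haw, fun hmem => ?_⟩
    rw [slope_def_field, h0, sub_zero, sub_zero] at ha
    have ha' : signedDist A (x + a • innerNormal A x) < 0 := by
      by_contra! hc
      linarith [div_nonpos_of_nonneg_of_nonpos hc haw.2.le]
    rw [signedDist, Metric.infDist_zero_of_mem hmem] at ha'
    linarith [Metric.infDist_nonneg (x := x + a • innerNormal A x) (s := Aᶜ)]
  rw [abs_lt] at hℓ
  constructor
  · intro hmem
    by_contra! hle
    rcases hle.lt_or_eq with hlt | rfl
    · obtain ⟨a, ha, haA⟩ := hneg
      refine haA (hconn (Ioo (-w) 0) isPreconnected_Ioo (fun y hy => ⟨?_, hy.2.ne⟩) ℓ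
        ⟨hℓ.1, hlt⟩ a ha hmem)
      rw [abs_lt]; exact ⟨hy.1, by linarith [hy.2]⟩
    · rw [hA.frontier_eq] at hx
      simp at hmem
      exact hx.2 hmem
  · intro hpos'
    obtain ⟨a, ha, haA⟩ := hpos
    refine hconn (Ioo 0 w) isPreconnected_Ioo (fun y hy => ⟨?_, hy.1.ne'⟩) a ha ℓ
      ⟨hpos', hℓ.2⟩ haA
    rw [abs_lt]; exact ⟨by linarith [hy.1], hy.2⟩

/-- The tubular width is at most the radius of curvature. -/
theorem mul_inner_le_of_isTubularWidth (hw : IsTubularWidth A w) {γ : ℝ → Plane}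
    (hγ : ContDiff ℝ 2 γ) (hper : Function.Periodic γ 1) (him : γ '' Ico 0 1 = frontier A)
    (hne : ∀ θ, deriv γ θ ≠ 0) (hn : ∀ θ, innerNormal A (γ θ) = unitNormal (deriv γ θ))
    {ℓ : ℝ} (hℓ : |ℓ| < w) (θ : ℝ) :
    ℓ * inner ℝ (deriv (deriv γ) θ) (unitNormal (deriv γ θ)) ≤ ‖deriv γ θ‖ ^ 2 := by
  by_contra! hlt
  have hγd : Differentiable ℝ γ := hγ.differentiable two_ne_zero
  have hγ' : ContDiff ℝ 1 (deriv γ) := ContDiff.deriv' (by simpa [one_add_one_eq_two] using hγ)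
  have hγ'd : Differentiable ℝ (deriv γ) := hγ'.differentiable one_ne_zero
  have hfr : ∀ s, γ s ∈ frontier A := fun s => by
    obtain ⟨y, hy, hys⟩ := hper.exists_mem_Ico₀ one_pos s
    rw [hys, ← him]
    exact mem_image_of_mem _ hy
  set p : Plane := γ θ + ℓ • unitNormal (deriv γ θ) with hp
  set f : ℝ → ℝ := fun s => ‖γ s - p‖ ^ 2 with hf
  have hf' : ∀ s, HasDerivAt f (2 * inner ℝ (γ s - p) (deriv γ s)) s := fun s =>
    ((hγd s).hasDerivAt.sub_const p).norm_sq
  have hderiv : deriv f = fun s => 2 * inner ℝ (γ s - p) (deriv γ s) := funext fun s => (hf' s).deriv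
  -- Beyond the focal distance the second derivative at θ of the squared distance to p is negative,
  -- so γ θ cannot be a nearest point to p.
  have hf'' : HasDerivAt (deriv f)
      (2 * (‖deriv γ θ‖ ^ 2 - ℓ * inner ℝ (deriv (deriv γ) θ) (unitNormal (deriv γ θ)))) θ := by
    rw [hderiv]
    have := (((hγd θ).hasDerivAt.sub_const p).inner ℝ (hγ'd θ).hasDerivAt).const_mul 2
    refine this.congr_deriv ?_
    rw [real_inner_self_eq_norm_sq, hp, sub_add_cancel_left, inner_neg_left, real_inner_smul_left,
      real_inner_comm (unitNormal _)]
    ring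
  have hcomp : IsCompact (frontier A) := by
    have : frontier A = γ '' Icc 0 1 := by
      refine Subset.antisymm ?_ ?_
      · rw [← him]; exact image_mono Ico_subset_Icc_self
      · rintro _ ⟨s, _, rfl⟩; exact hfr s
    rw [this]
    exact isCompact_Icc.image hγ.continuous
  obtain ⟨y, hy, hmin⟩ := hcomp.exists_isMinOn ⟨γ θ, hfr θ⟩
    (f := fun y => ‖y - p‖ ^ 2) (by fun_prop)
  rw [← him] at hy
  obtain ⟨θ₁, -, rfl⟩ := hy
  have hmin' : ∀ s, f θ₁ ≤ f s := fun s => hmin (hfr s)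
  have horth : inner ℝ (γ θ₁ - p) (deriv γ θ₁) = (0 : ℝ) := by
    have := IsLocalMin.hasDerivAt_eq_zero (Eventually.of_forall hmin') (hf' θ₁)
    linarith
  set ℓ₁ : ℝ := inner ℝ (p - γ θ₁) (unitNormal (deriv γ θ₁)) with hℓ₁
  have hdec : p - γ θ₁ = ℓ₁ • unitNormal (deriv γ θ₁) := by
    have := frame_decomposition (hne θ₁) (p - γ θ₁)
    rwa [← neg_sub (γ θ₁) p, inner_neg_left, horth, neg_zero, zero_div, zero_smul, zero_add,
      neg_sub] at this
  have hnorm1 : ‖γ θ₁ - p‖ = |ℓ₁| := by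
    rw [norm_sub_rev, hdec, norm_smul, norm_unitNormal (hne θ₁), mul_one, Real.norm_eq_abs]
  have hnorm : ‖γ θ - p‖ = |ℓ| := by
    rw [hp, sub_add_cancel_left, norm_neg, norm_smul, norm_unitNormal (hne θ), mul_one,
      Real.norm_eq_abs]
  have hle : |ℓ₁| ≤ |ℓ| := by
    have := hmin' θ
    simp only [hf, hnorm1, hnorm] at this
    simpa using (pow_le_pow_iff_left₀ (abs_nonneg _) (abs_nonneg _) two_ne_zero).1 this
  -- The nearest point γ θ₁ also sees p along its normal, at distance |ℓ₁| ≤ |ℓ| < w. Injectivity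
  -- identifies it with γ θ.
  have hinj := @hw (γ θ₁, ℓ₁) ⟨hfr θ₁, abs_lt.1 (hle.trans_lt hℓ)⟩ (γ θ, ℓ)
    ⟨hfr θ, abs_lt.1 hℓ⟩ (by
      simp only [hn]
      rw [← hdec, ← hp]
      abel)
  have hmin0 : ∀ s, f θ ≤ f s := fun s => by
    have h1 : f θ₁ = f θ := by simp only [hf, (Prod.mk.inj hinj).1]
    rw [← h1]; exact hmin' s
  have hneg : deriv (deriv f) θ < 0 := by
    rw [hf''.deriv]; linarith
  have hd0 : deriv f θ = 0 := IsLocalMin.deriv_eq_zero (Eventually.of_forall hmin0)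
  have hmax := isLocalMax_of_deriv_deriv_neg hneg hd0 (hf' θ).continuousAt
  -- A strict second-derivative sign makes θ a local maximum as well as a global minimum. So f is
  -- locally constant and its second derivative vanishes, a contradiction.
  have hconst : f =ᶠ[𝓝 θ] fun _ => f θ := by
    filter_upwards [hmax] with s hs using le_antisymm hs (hmin0 s)
  have : deriv (deriv f) θ = 0 := by
    rw [hconst.deriv.deriv_eq]
    simp
  linarith

end Tubular
end SpaceTimeShift
end

noncomputable section
open scoped NNReal ENNReal

/-! ### Mollification and null sets -/

section Approximation

open scoped Convolution in
/-- Bounded measurable functions are almost everywhere limits of equally bounded smooth ones. -/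
theorem exists_smooth_tendsto_ae {V : Type*} [NormedAddCommGroup V] [InnerProductSpace ℝ V]
    [FiniteDimensional ℝ V] [MeasurableSpace V] [BorelSpace V] {f : V → ℝ} (hf : Measurable f)
    (hb : ∀ x, |f x| ≤ 1) :
    ∃ g : ℕ → V → ℝ, (∀ k, ContDiff ℝ 1 (g k)) ∧ (∀ k x, |g k x| ≤ 1) ∧
      ∀ᵐ x, Tendsto (fun k => g k x) atTop (𝓝 (f x)) := by
  have hpos : ∀ k : ℕ, (0 : ℝ) < 1 / (k + 1) := fun k => Nat.one_div_pos_of_nat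
  let φ : ℕ → ContDiffBump (0 : V) := fun k =>
    ⟨1 / (k + 1), 2 * (1 / (k + 1)), hpos k, by linarith [hpos k]⟩
  have hloc : LocallyIntegrable f volume := by
    intro x
    refine ⟨Metric.ball x 1, Metric.ball_mem_nhds x one_pos, ?_⟩
    exact Measure.integrableOn_of_bounded (M := 1) measure_ball_lt_top.ne hf.aestronglyMeasurable
      (Eventually.of_forall fun x => by simpa using hb x)
  refine ⟨fun k => (φ k).normed volume ⋆[ContinuousLinearMap.lsmul ℝ ℝ, volume] f,
    fun k => ?_, fun k x => ?_, ?_⟩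
  · exact (φ k).hasCompactSupport_normed.contDiff_convolution_left _ (φ k).contDiff_normed hloc
  · simp only [← Real.norm_eq_abs, convolution_def]
    refine (norm_integral_le_of_norm_le (g := (φ k).normed volume) (φ k).integrable_normed
      (Eventually.of_forall fun t => ?_)).trans (φ k).integral_normed.le
    rw [ContinuousLinearMap.lsmul_apply, norm_smul, Real.norm_eq_abs, Real.norm_eq_abs,
      abs_of_nonneg ((φ k).nonneg_normed t)]
    exact mul_le_of_le_one_right ((φ k).nonneg_normed t) (hb _)
  · refine ContDiffBump.ae_convolution_tendsto_right_of_locallyIntegrable (K := 2) ?_ ?_ hloc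
    · simpa [φ] using! (tendsto_one_div_add_atTop_nhds_zero_nat (𝕜 := ℝ)).const_mul 2
    · exact Eventually.of_forall fun k => le_rfl

/-- A local diffeomorphism pulls back null sets to null sets. -/
theorem measure_preimage_null_of_hasStrictFDerivAt {E : Type*} [NormedAddCommGroup E]
    [NormedSpace ℝ E] [FiniteDimensional ℝ E] [MeasurableSpace E] [BorelSpace E] {μ : Measure E}
    [μ.IsAddHaarMeasure] {f : E → E} {s N : Set E}
    (hf : ∀ x ∈ s, ∃ f' : E ≃L[ℝ] E, HasStrictFDerivAt f (f' : E →L[ℝ] E) x) (hN : μ N = 0) :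
    μ (s ∩ f ⁻¹' N) = 0 := by
  refine measure_null_of_locally_null _ fun x hx => ?_
  obtain ⟨f', hf'⟩ := hf x hx.1
  set h := hf'.toOpenPartialHomeomorph f with hh
  have hxs : x ∈ h.source := hf'.mem_toOpenPartialHomeomorph_source
  have hcoe : ∀ y, h y = f y := fun y => by
    rw [hh, HasStrictFDerivAt.toOpenPartialHomeomorph_coe]
  refine ⟨(s ∩ f ⁻¹' N) ∩ h.source,
    inter_mem self_mem_nhdsWithin (mem_nhdsWithin_of_mem_nhds (h.open_source.mem_nhds hxs)), ?_⟩
  -- The local inverse is known to be differentiable only at images of points of s. The null set is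
  -- therefore cut down to these before it is mapped back.
  set D : Set E := N ∩ (h.target ∩ h.symm ⁻¹' s) with hD
  refine measure_mono_null (t := h.symm '' D) ?_
    (addHaar_image_eq_zero_of_differentiableOn_of_addHaar_eq_zero μ ?_
      (measure_mono_null inter_subset_left hN))
  · rintro y ⟨⟨hys, hyN⟩, hyh⟩
    refine ⟨h y, ⟨by rwa [hcoe], h.map_source hyh, ?_⟩, h.left_inv hyh⟩
    rw [mem_preimage, h.left_inv hyh]
    exact hys
  · rintro y ⟨-, hyt, hys⟩
    obtain ⟨g', hg'⟩ := hf _ hys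
    have hg : HasFDerivAt h (g' : E →L[ℝ] E) (h.symm y) := by
      refine hg'.hasFDerivAt.congr_of_eventuallyEq (Eventually.of_forall hcoe)
    exact (h.hasFDerivAt_symm hyt hg).differentiableAt.differentiableWithinAt

end Approximation

/-! ### Divergence theorem on the parameter box -/

section Divergence

/-- The parameter rectangle `[0, 1] × [-1/4, 1/4]`. -/
def paramBox : Set (Fin 2 → ℝ) := Icc ![0, -(1 / 4)] ![1, 1 / 4]

theorem mem_paramBox {x : Fin 2 → ℝ} :
    x ∈ paramBox ↔ x 0 ∈ Icc (0 : ℝ) 1 ∧ x 1 ∈ Icc (-(1 / 4) : ℝ) (1 / 4) := by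
  simp [paramBox, Pi.le_def, Fin.forall_fin_two]
  tauto

theorem isCompact_paramBox : IsCompact paramBox := isCompact_Icc

theorem measurableSet_paramBox : MeasurableSet paramBox := measurableSet_Icc

theorem volume_paramBox_lt_top : volume paramBox < ⊤ := isCompact_paramBox.measure_lt_top

theorem volume_real_paramBox : volume.real paramBox = 1 / 2 := by
  rw [paramBox, measureReal_def, Real.volume_Icc_pi_toReal]
  · simp [Fin.prod_univ_two]; norm_num
  · simp [Pi.le_def, Fin.forall_fin_two]

theorem insertNth_two (c : ℝ) (x : Fin 2 → ℝ) :
    (Fin.insertNth (2 : Fin 3) c x : Fin 3 → ℝ) = ![x 0, x 1, c] := by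
  ext i; fin_cases i <;> rfl

theorem insertNth_zero (c : ℝ) (x : Fin 2 → ℝ) :
    (Fin.insertNth (0 : Fin 3) c x : Fin 3 → ℝ) = ![c, x 0, x 1] := by
  ext i; fin_cases i <;> rfl

theorem insertNth_one (c : ℝ) (x : Fin 2 → ℝ) :
    (Fin.insertNth (1 : Fin 3) c x : Fin 3 → ℝ) = ![x 0, c, x 1] := by
  ext i; fin_cases i <;> rfl

/-- If `∂₂ H - ∂₀ P - ∂₁ Q` is bounded, where `P` is periodic in the variable `0` and `Q` vanishes
at the ends in the variable `1`, then the integrals of `H` over slices vary at a bounded rate. -/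
theorem norm_integral_slice_sub_le {E : Type*} [NormedAddCommGroup E] [NormedSpace ℝ E]
    [FiniteDimensional ℝ E] {H P Q : (Fin 3 → ℝ) → E} {C : ℝ}
    (hH : ContinuousOn H (Icc ![0, -(1 / 4), 0] ![1, 1 / 4, 1]))
    (hP : ContinuousOn P (Icc ![0, -(1 / 4), 0] ![1, 1 / 4, 1]))
    (hQ : ContinuousOn Q (Icc ![0, -(1 / 4), 0] ![1, 1 / 4, 1]))
    (hd : ∀ q : Fin 3 → ℝ, q 0 ∈ Ioo (0 : ℝ) 1 → q 1 ∈ Ioo (-(1 / 4) : ℝ) (1 / 4) →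
      q 2 ∈ Ioo (0 : ℝ) 1 →
      DifferentiableAt ℝ H q ∧ DifferentiableAt ℝ P q ∧ DifferentiableAt ℝ Q q ∧
        ‖fderiv ℝ H q (Pi.single 2 1) - fderiv ℝ P q (Pi.single 0 1)
          - fderiv ℝ Q q (Pi.single 1 1)‖ ≤ C)
    (hPper : ∀ s ∈ Icc (-(1 / 4) : ℝ) (1 / 4), ∀ τ ∈ Icc (0 : ℝ) 1, P ![1, s, τ] = P ![0, s, τ])
    (hQ0 : ∀ θ τ, Q ![θ, 1 / 4, τ] = 0 ∧ Q ![θ, -(1 / 4), τ] = 0) :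
    ‖(∫ x in paramBox, H ![x 0, x 1, 1]) - ∫ x in paramBox, H ![x 0, x 1, 0]‖ ≤ C / 2 := by
  set a : Fin 3 → ℝ := ![0, -(1 / 4), 0] with ha
  set b : Fin 3 → ℝ := ![1, 1 / 4, 1] with hb
  have hab : a ≤ b := by
    intro i; fin_cases i <;> simp [ha, hb]
  borelize E
  have : CompleteSpace E := FiniteDimensional.complete ℝ E
  -- The flux of (-P, -Q, H) through the box reduces to the two slices of H: the P faces cancel by
  -- periodicity and Q vanishes on its own. The box has volume 1/2, whence the bound C / 2.
  set f : Fin 3 → (Fin 3 → ℝ) → E := ![fun q => -P q, fun q => -Q q, H] with hf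
  set f' : Fin 3 → (Fin 3 → ℝ) → (Fin 3 → ℝ) →L[ℝ] E :=
    ![fun q => -fderiv ℝ P q, fun q => -fderiv ℝ Q q, fderiv ℝ H] with hf'
  have hdiv : ∀ q, ∑ i, f' i q (Pi.single i 1) = fderiv ℝ H q (Pi.single 2 1)
      - fderiv ℝ P q (Pi.single 0 1) - fderiv ℝ Q q (Pi.single 1 1) := fun q => by
    rw [Fin.sum_univ_three]
    simp [hf']
    abel
  have hint : ∀ q ∈ Set.pi univ (fun i => Ioo (a i) (b i)),
      q 0 ∈ Ioo (0 : ℝ) 1 ∧ q 1 ∈ Ioo (-(1 / 4) : ℝ) (1 / 4) ∧ q 2 ∈ Ioo (0 : ℝ) 1 := fun q hq => by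
    simpa [ha, hb, Fin.forall_fin_succ] using hq
  have hmeas : Measurable fun q => ∑ i, f' i q (Pi.single i 1) := by
    simp_rw [hdiv]
    exact ((measurable_fderiv_apply_const ℝ H _).sub (measurable_fderiv_apply_const ℝ P _)).sub
      (measurable_fderiv_apply_const ℝ Q _)
  have hae : Set.pi univ (fun i => Ioo (a i) (b i)) =ᵐ[volume] Icc a b := by
    rw [volume_pi]; exact Measure.univ_pi_Ioo_ae_eq_Icc
  have hvol : volume (Icc a b) < ⊤ := isCompact_Icc.measure_lt_top
  have hbound : ∀ᵐ q ∂volume.restrict (Icc a b), ‖∑ i, f' i q (Pi.single i 1)‖ ≤ C := by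
    rw [← Measure.restrict_congr_set hae, ae_restrict_iff' (MeasurableSet.univ_pi fun _ =>
      measurableSet_Ioo)]
    refine Eventually.of_forall fun q hq => ?_
    obtain ⟨h0, h1, h2⟩ := hint q hq
    rw [hdiv]
    exact (hd q h0 h1 h2).2.2.2
  have key := integral_divergence_of_hasFDerivAt_off_countable' a b hab f f' ∅ countable_empty
    (by
      intro i
      fin_cases i
      · exact hP.neg
      · exact hQ.neg
      · exact hH)
    (by
      rintro q ⟨hq, -⟩ i
      obtain ⟨h0, h1, h2⟩ := hint q hq
      obtain ⟨d1, d2, d3, -⟩ := hd q h0 h1 h2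
      fin_cases i
      · exact d2.hasFDerivAt.neg
      · exact d3.hasFDerivAt.neg
      · exact d1.hasFDerivAt)
    (Measure.integrableOn_of_bounded hvol.ne hmeas.aestronglyMeasurable hbound)
  have hface : Icc (a ∘ Fin.succAbove 2) (b ∘ Fin.succAbove 2) = paramBox := by
    rw [paramBox]
    congr 1 <;> (ext i; fin_cases i <;> rfl)
  have hrhs : ∑ i : Fin 3, ((∫ x in Icc (a ∘ Fin.succAbove i) (b ∘ Fin.succAbove i),
      f i (Fin.insertNth i (b i) x)) - ∫ x in Icc (a ∘ Fin.succAbove i) (b ∘ Fin.succAbove i),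
      f i (Fin.insertNth i (a i) x)) =
      (∫ x in paramBox, H ![x 0, x 1, 1]) - ∫ x in paramBox, H ![x 0, x 1, 0] := by
    rw [Fin.sum_univ_three, hface]
    simp only [insertNth_zero, insertNth_one, insertNth_two]
    have h1 := fun θ τ => (hQ0 θ τ).1
    have h2 := fun θ τ => (hQ0 θ τ).2
    simp only [one_div] at h1 h2
    have hP0 : ∫ x in Icc (a ∘ Fin.succAbove 0) (b ∘ Fin.succAbove 0), P ![1, x 0, x 1] =
        ∫ x in Icc (a ∘ Fin.succAbove 0) (b ∘ Fin.succAbove 0), P ![0, x 0, x 1] := by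
      refine setIntegral_congr_fun measurableSet_Icc fun x hx => ?_
      have h3 := hx.1 0
      have h4 := hx.2 0
      have h5 := hx.1 1
      have h6 := hx.2 1
      simp [ha, hb] at h3 h4 h5 h6
      exact hPper _ ⟨by linarith, by linarith⟩ _ ⟨h5, h6⟩
    simp only [hf, Matrix.cons_val_zero, Matrix.cons_val_one, Matrix.cons_val, integral_neg]
    rw [show b 0 = 1 from rfl, show a 0 = 0 from rfl, hP0]
    simp [ha, hb, h1, h2]
  rw [← hrhs, ← key]
  refine (norm_setIntegral_le_of_norm_le_const_ae hvol hbound).trans (le_of_eq ?_)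
  rw [measureReal_def, Real.volume_Icc_pi_toReal hab]
  simp [ha, hb, Fin.prod_univ_three]
  ring

end Divergence
end

/-! ### Transport of the parameters: Lipschitz bound for smooth phases -/

noncomputable section
open scoped NNReal ENNReal

namespace SpaceTimeShift

/-- The domain `ℝ × (-1/2, 1/2) × [0, Text)` of tubular coordinates `(θ, s, T)`. -/
def paramDomain (Text : ℝ) : Set (Fin 3 → ℝ) :=
  {q | q 1 ∈ Ioo (-(1 / 2) : ℝ) (1 / 2) ∧ q 2 ∈ Ico 0 Text}

theorem uniqueDiffOn_paramDomain (Text : ℝ) : UniqueDiffOn ℝ (paramDomain Text) := by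
  have h : paramDomain Text = Set.pi univ ![univ, Ioo (-(1 / 2) : ℝ) (1 / 2), Ico 0 Text] := by
    ext q
    simp [paramDomain, Fin.forall_fin_succ]
  rw [h]
  refine UniqueDiffOn.univ_pi (ι := Fin 3) (E := fun _ => ℝ) fun i => ?_
  fin_cases i
  · exact uniqueDiffOn_univ
  · exact uniqueDiffOn_Ioo _ _
  · exact uniqueDiffOn_Ico _ _

variable {E : Type*} [NormedAddCommGroup E] [NormedSpace ℝ E]

/-- Tubular coordinates `Φ` and a weight `g` such that constant vector fields and the velocity of
`Φ` in the last variable are combinations, with coefficients `a` and `b`, of the first two partial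
derivatives of `Φ`. -/
structure IsTransport (Text : ℝ) (Φ : (Fin 3 → ℝ) → Plane) (g : (Fin 3 → ℝ) → E)
    (a b : Fin 3 → (Fin 3 → ℝ) → ℝ) : Prop where
  coord_smooth : ContDiffOn ℝ 1 Φ (paramDomain Text)
  weight_smooth : ContDiffOn ℝ 1 g (paramDomain Text)
  fst_smooth : ∀ j, ContDiffOn ℝ 1 (fun q => a j q • g q) (paramDomain Text)
  snd_smooth : ∀ j, ContDiffOn ℝ 1 (fun q => b j q • g q) (paramDomain Text)
  decomposition : ∀ q ∈ paramDomain Text, ∀ j,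
    (![EuclideanSpace.single 0 1, EuclideanSpace.single 1 1,
      fderivWithin ℝ Φ (paramDomain Text) q (Pi.single 2 1)] : Fin 3 → Plane) j =
      a j q • fderivWithin ℝ Φ (paramDomain Text) q (Pi.single 0 1) +
      b j q • fderivWithin ℝ Φ (paramDomain Text) q (Pi.single 1 1)
  coord_periodic : ∀ s τ, ![0, s, τ] ∈ paramDomain Text → Φ ![1, s, τ] = Φ ![0, s, τ]
  weight_periodic : ∀ s τ, ![0, s, τ] ∈ paramDomain Text → g ![1, s, τ] = g ![0, s, τ]
  coeff_periodic : ∀ j s τ, ![0, s, τ] ∈ paramDomain Text → a j ![1, s, τ] = a j ![0, s, τ]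
  weight_zero : ∀ q, 1 / 4 ≤ |q 1| → g q = 0

/-- The path of parameters from `T` to `T'`. -/
def timePath (T T' : ℝ) (q : Fin 3 → ℝ) : Fin 3 → ℝ := ![q 0, q 1, T + q 2 * (T' - T)]

/-- The differential of `timePath`. -/
def timePathDeriv (T T' : ℝ) : (Fin 3 → ℝ) →L[ℝ] (Fin 3 → ℝ) :=
  ContinuousLinearMap.pi ![ContinuousLinearMap.proj 0, ContinuousLinearMap.proj 1,
    (T' - T) • ContinuousLinearMap.proj 2]

theorem hasFDerivAt_timePath (T T' : ℝ) (q : Fin 3 → ℝ) :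
    HasFDerivAt (timePath T T') (timePathDeriv T T') q := by
  rw [hasFDerivAt_pi']
  intro i
  fin_cases i
  · exact (ContinuousLinearMap.proj (R := ℝ) (φ := fun _ : Fin 3 => ℝ) 0).hasFDerivAt
  · exact (ContinuousLinearMap.proj (R := ℝ) (φ := fun _ : Fin 3 => ℝ) 1).hasFDerivAt
  · exact ((ContinuousLinearMap.proj (R := ℝ) (φ := fun _ : Fin 3 => ℝ) 2).hasFDerivAt.mul_const
      (T' - T)).const_add T

theorem timePathDeriv_zero (T T' : ℝ) : timePathDeriv T T' (Pi.single 0 1) = Pi.single 0 1 := by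
  ext i; fin_cases i <;> simp [timePathDeriv]

theorem timePathDeriv_one (T T' : ℝ) : timePathDeriv T T' (Pi.single 1 1) = Pi.single 1 1 := by
  ext i; fin_cases i <;> simp [timePathDeriv]

theorem timePathDeriv_two (T T' : ℝ) :
    timePathDeriv T T' (Pi.single 2 1) = (T' - T) • Pi.single 2 1 := by
  ext i; fin_cases i <;> simp [timePathDeriv]

theorem segment_mem_Icc {c T T' τ : ℝ} (hT : T ∈ Icc 0 c) (hT' : T' ∈ Icc 0 c)
    (hτ : τ ∈ Icc (0 : ℝ) 1) : T + τ * (T' - T) ∈ Icc 0 c := by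
  have h := (convex_Icc 0 c) hT hT' (sub_nonneg.2 hτ.2) hτ.1 (by ring)
  simp only [smul_eq_mul] at h
  convert h using 1
  ring

theorem timePath_mem {Text c T T' : ℝ} (hc : c < Text) (hT : T ∈ Icc 0 c) (hT' : T' ∈ Icc 0 c)
    {q : Fin 3 → ℝ} (h1 : q 1 ∈ Ioo (-(1 / 2) : ℝ) (1 / 2)) (h2 : q 2 ∈ Icc (0 : ℝ) 1) :
    timePath T T' q ∈ paramDomain Text :=
  ⟨h1, (segment_mem_Icc hT hT' h2).1, (segment_mem_Icc hT hT' h2).2.trans_lt hc⟩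

/-- For path parameter in the open interval (0, 1), nearby points still map into the domain, even if
an end of the path sits at time 0. One-sided differentiability of f up to time 0 thus suffices for a
full derivative here. -/
theorem hasFDerivAt_comp_timePath {Text c T T' : ℝ} (hc : c < Text) (hT : T ∈ Icc 0 c)
    (hT' : T' ∈ Icc 0 c) {f : (Fin 3 → ℝ) → E} (hf : ContDiffOn ℝ 1 f (paramDomain Text))
    {q : Fin 3 → ℝ} (h1 : q 1 ∈ Ioo (-(1 / 2) : ℝ) (1 / 2)) (h2 : q 2 ∈ Ioo (0 : ℝ) 1) :
    HasFDerivAt (fun q => f (timePath T T' q))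
      ((fderivWithin ℝ f (paramDomain Text) (timePath T T' q)).comp (timePathDeriv T T')) q := by
  have hmem := timePath_mem hc hT hT' h1 (Ioo_subset_Icc_self h2)
  have h3 := ((hf.differentiableOn one_ne_zero) _ hmem).hasFDerivWithinAt
  have h4 : {q : Fin 3 → ℝ | q 1 ∈ Ioo (-(1 / 2) : ℝ) (1 / 2) ∧ q 2 ∈ Ioo (0 : ℝ) 1} ∈ 𝓝 q := by
    refine IsOpen.mem_nhds ?_ ⟨h1, h2⟩
    exact (isOpen_Ioo.preimage (continuous_apply 1)).inter (isOpen_Ioo.preimage (continuous_apply 2))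
  exact (h3.comp q (hasFDerivAt_timePath T T' q).hasFDerivWithinAt fun q' hq' =>
    timePath_mem hc hT hT' hq'.1 (Ioo_subset_Icc_self hq'.2)).hasFDerivAt h4

theorem continuousOn_comp_timePath {Text c T T' : ℝ} (hc : c < Text) (hT : T ∈ Icc 0 c)
    (hT' : T' ∈ Icc 0 c) {f : (Fin 3 → ℝ) → E} (hf : ContDiffOn ℝ 1 f (paramDomain Text)) :
    ContinuousOn (fun q => f (timePath T T' q)) (Icc ![0, -(1 / 4), 0] ![1, 1 / 4, 1]) := by
  refine hf.continuousOn.comp (fun q _ =>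
    (hasFDerivAt_timePath T T' q).continuousAt.continuousWithinAt) fun q hq => ?_
  have h1 := hq.1 1
  have h2 := hq.2 1
  have h3 := hq.1 2
  have h4 := hq.2 2
  simp at h1 h2 h3 h4
  exact timePath_mem hc hT hT' ⟨by linarith, by linarith⟩ ⟨h3, h4⟩

variable {Text : ℝ} {Φ : (Fin 3 → ℝ) → Plane} {g : (Fin 3 → ℝ) → E}
  {a b : Fin 3 → (Fin 3 → ℝ) → ℝ}

/-- The integral of a phase against the weight in tubular coordinates. -/
def transportIntegral (Φ : (Fin 3 → ℝ) → Plane) (g : (Fin 3 → ℝ) → E) (χ : Plane → ℝ) (z : Plane)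
    (T : ℝ) : E :=
  ∫ x in paramBox, χ (z + Φ ![x 0, x 1, T]) • g ![x 0, x 1, T]

theorem plane_eq_sum (v : Plane) :
    v = v 0 • EuclideanSpace.single 0 1 + v 1 • EuclideanSpace.single 1 1 := by
  ext i; fin_cases i <;> simp

/-- Join (z, T) to (z', T') by a segment. Along it the derivative of χ(z + Φ) is Σ w_j (a_j ∂_θ +
b_j ∂_s) of the same function, where w is the increment of the parameters. Subtracting the
divergence of Σ w_j χ (a_j g, b_j g) removes every derivative of χ. The bound M thus involves only
the weights, which is what survives mollification. -/
theorem IsTransport.lipschitz_of_smooth [FiniteDimensional ℝ E] (h : IsTransport Text Φ g a b)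
    {c M : ℝ} (hc : c < Text)
    (hM : ∀ q : Fin 3 → ℝ, q 0 ∈ Icc (0 : ℝ) 1 → q 1 ∈ Icc (-(1 / 4) : ℝ) (1 / 4) → q 2 ∈ Icc 0 c →
      ‖fderivWithin ℝ g (paramDomain Text) q‖ ≤ M ∧
      ∀ j, ‖fderivWithin ℝ (fun q => a j q • g q) (paramDomain Text) q‖ ≤ M ∧
        ‖fderivWithin ℝ (fun q => b j q • g q) (paramDomain Text) q‖ ≤ M)
    {χ : Plane → ℝ} (hχ : ContDiff ℝ 1 χ) (hχ1 : ∀ x, |χ x| ≤ 1) (z z' : Plane) {T T' : ℝ}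
    (hT : T ∈ Icc 0 c) (hT' : T' ∈ Icc 0 c) :
    ‖transportIntegral Φ g χ z' T' - transportIntegral Φ g χ z T‖ ≤
      7 / 2 * M * dist (z, T) (z', T') := by
  set S := paramDomain Text with hS
  set w : Fin 3 → ℝ := ![(z' - z) 0, (z' - z) 1, T' - T] with hw
  set d : ℝ := dist (z, T) (z', T') with hd
  have hd0 : 0 ≤ d := dist_nonneg
  have hwd : ∀ j, |w j| ≤ d := by
    have h1 : ‖z' - z‖ ≤ d := by
      rw [hd, dist_comm, Prod.dist_eq, ← dist_eq_norm]; exact le_max_left _ _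
    have h2 : |T' - T| ≤ d := by
      rw [hd, dist_comm, Prod.dist_eq, ← Real.dist_eq]; exact le_max_right _ _
    intro j
    fin_cases j
    · exact (PiLp.norm_apply_le (z' - z) 0).trans h1
    · exact (PiLp.norm_apply_le (z' - z) 1).trans h1
    · exact h2
  let C : (Fin 3 → ℝ) → ℝ := fun q => χ (z + q 2 • (z' - z) + Φ (timePath T T' q))
  let G : (Fin 3 → ℝ) → E := fun q => g (timePath T T' q)
  let Pj : Fin 3 → (Fin 3 → ℝ) → E := fun j q => a j (timePath T T' q) • g (timePath T T' q)
  let Qj : Fin 3 → (Fin 3 → ℝ) → E := fun j q => b j (timePath T T' q) • g (timePath T T' q)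
  have hCc : ContinuousOn C (Icc ![0, -(1 / 4), 0] ![1, 1 / 4, 1]) :=
    hχ.continuous.comp_continuousOn (ContinuousOn.add (by fun_prop)
      (continuousOn_comp_timePath hc hT hT' h.coord_smooth))
  have hGc := continuousOn_comp_timePath hc hT hT' h.weight_smooth
  have hPc : ∀ j, ContinuousOn (Pj j) _ := fun j =>
    continuousOn_comp_timePath hc hT hT' (h.fst_smooth j)
  have hQc : ∀ j, ContinuousOn (Qj j) _ := fun j =>
    continuousOn_comp_timePath hc hT hT' (h.snd_smooth j)
  -- Seven terms of size M d: one from ∂_T g, and two for each of the three parameter directions.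
  have key := norm_integral_slice_sub_le (E := E) (C := 7 * M * d)
    (H := fun q => C q • G q) (P := fun q => ∑ j, w j • (C q • Pj j q))
    (Q := fun q => ∑ j, w j • (C q • Qj j q)) (hCc.smul hGc)
    (continuousOn_finsetSum _ fun j _ => (hCc.smul (hPc j)).const_smul (w j))
    (continuousOn_finsetSum _ fun j _ => (hCc.smul (hQc j)).const_smul (w j))
    ?_ ?_ ?_
  · have h1 : ∀ x : Fin 2 → ℝ, timePath T T' ![x 0, x 1, 1] = ![x 0, x 1, T'] := fun x => by
      ext i; fin_cases i <;> simp [timePath]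
    have h0 : ∀ x : Fin 2 → ℝ, timePath T T' ![x 0, x 1, 0] = ![x 0, x 1, T] := fun x => by
      ext i; fin_cases i <;> simp [timePath]
    simp only [C, G, h1, h0] at key
    simp at key
    simp only [transportIntegral]
    refine key.trans (le_of_eq ?_)
    ring
  · intro q h0 h1 h2
    have h1' : q 1 ∈ Ioo (-(1 / 2) : ℝ) (1 / 2) := ⟨by linarith [h1.1], by linarith [h1.2]⟩
    have hmem : timePath T T' q ∈ S := timePath_mem hc hT hT' h1' (Ioo_subset_Icc_self h2)
    set p := timePath T T' q with hp
    have hGd := hasFDerivAt_comp_timePath hc hT hT' h.weight_smooth h1' h2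
    have hPd := fun j => hasFDerivAt_comp_timePath hc hT hT' (h.fst_smooth j) h1' h2
    have hQd := fun j => hasFDerivAt_comp_timePath hc hT hT' (h.snd_smooth j) h1' h2
    have hΦd := hasFDerivAt_comp_timePath hc hT hT' h.coord_smooth h1' h2
    set DΦ := fderivWithin ℝ Φ S p with hDΦ
    have hzd : HasFDerivAt (fun q : Fin 3 → ℝ => z + q 2 • (z' - z))
        ((ContinuousLinearMap.proj (R := ℝ) (φ := fun _ : Fin 3 => ℝ) 2).smulRight (z' - z)) q :=
      ((ContinuousLinearMap.proj (R := ℝ) (φ := fun _ : Fin 3 => ℝ) 2).hasFDerivAt.smul_const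
        (z' - z)).const_add z
    have hχd := (hχ.differentiable one_ne_zero
      (z + q 2 • (z' - z) + Φ (timePath T T' q))).hasFDerivAt
    have hCd := hχd.comp q (hzd.add hΦd)
    set χ' := fderiv ℝ χ (z + q 2 • (z' - z) + Φ (timePath T T' q)) with hχ'
    set C' := χ'.comp (((ContinuousLinearMap.proj (R := ℝ) (φ := fun _ : Fin 3 => ℝ) 2).smulRight
      (z' - z)) + DΦ.comp (timePathDeriv T T')) with hC'
    have hCd' : HasFDerivAt C C' q := hCd
    have hHd := hCd'.fun_smul hGd
    have hPd' := HasFDerivAt.fun_sum (u := Finset.univ) fun j _ =>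
      ((hCd'.fun_smul (hPd j)).fun_const_smul (w j))
    have hQd' := HasFDerivAt.fun_sum (u := Finset.univ) fun j _ =>
      ((hCd'.fun_smul (hQd j)).fun_const_smul (w j))
    refine ⟨hHd.differentiableAt, hPd'.differentiableAt, hQd'.differentiableAt, ?_⟩
    have e1 := hHd.fderiv
    have e2 := hPd'.fderiv
    have e3 := hQd'.fderiv
    change ‖fderiv ℝ (fun q => C q • g (timePath T T' q)) q _ -
      fderiv ℝ (fun q => ∑ j, w j • (C q • (a j (timePath T T' q) • g (timePath T T' q)))) q _ -
      fderiv ℝ (fun q => ∑ j, w j • (C q • (b j (timePath T T' q) • g (timePath T T' q)))) q _‖ ≤ _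
    rw [e1, e2, e3]
    have hC0 : C' (Pi.single 0 1) = χ' (DΦ (Pi.single 0 1)) := by
      simp [hC', timePathDeriv_zero]
    have hC1 : C' (Pi.single 1 1) = χ' (DΦ (Pi.single 1 1)) := by
      simp [hC', timePathDeriv_one]
    have hC2 : C' (Pi.single 2 1) = χ' (z' - z) + (T' - T) * χ' (DΦ (Pi.single 2 1)) := by
      simp [hC', timePathDeriv_two]
    -- The decomposition hypothesis, applied under the differential of χ.
    have hdec : C' (Pi.single 2 1) =
        ∑ j, w j * (a j p * C' (Pi.single 0 1) + b j p * C' (Pi.single 1 1)) := by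
      have hj : ∀ j, a j p * C' (Pi.single 0 1) + b j p * C' (Pi.single 1 1) = χ'
        ((![EuclideanSpace.single 0 1, EuclideanSpace.single 1 1, DΦ (Pi.single 2 1)] :
          Fin 3 → Plane) j) := fun j => by
        rw [h.decomposition p hmem j, hC0, hC1, map_add, map_smul, map_smul, smul_eq_mul,
          smul_eq_mul]
      simp only [hj]
      rw [hC2, Fin.sum_univ_three]
      conv_lhs => rw [plane_eq_sum (z' - z)]
      simp [hw]
    obtain ⟨hMg, hMj⟩ := hM p ⟨h0.1.le, h0.2.le⟩ ⟨h1.1.le, h1.2.le⟩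
      (segment_mem_Icc hT hT' (Ioo_subset_Icc_self h2))
    have happ : ∀ (D : (Fin 3 → ℝ) →L[ℝ] E) (i : Fin 3), ‖D‖ ≤ M → ‖D (Pi.single i 1)‖ ≤ M :=
      fun D i hD => by
        refine (D.le_opNorm _).trans ?_
        rw [Pi.norm_single, norm_one, mul_one]
        exact hD
    have hCle : |C q| ≤ 1 := hχ1 _
    set Dg := fderivWithin ℝ g S p with hDg
    set DP := fun j => fderivWithin ℝ (fun q => a j q • g q) S p with hDP
    set DQ := fun j => fderivWithin ℝ (fun q => b j q • g q) S p with hDQ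
    -- All terms containing the differential of χ cancel by `hdec`; only the value of χ remains.
    have hR : (C q • Dg.comp (timePathDeriv T T') + C'.smulRight (g p)) (Pi.single 2 1) -
        (∑ j, w j • (C q • (DP j).comp (timePathDeriv T T') + C'.smulRight (a j p • g p)))
          (Pi.single 0 1) -
        (∑ j, w j • (C q • (DQ j).comp (timePathDeriv T T') + C'.smulRight (b j p • g p)))
          (Pi.single 1 1) =
        C q • ((T' - T) • Dg (Pi.single 2 1)
          - ∑ j, w j • (DP j (Pi.single 0 1) + DQ j (Pi.single 1 1))) := by
      simp only [add_apply, smul_apply, ContinuousLinearMap.comp_apply,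
        ContinuousLinearMap.smulRight_apply, timePathDeriv_zero,
        timePathDeriv_one, timePathDeriv_two, map_smul, Fin.sum_univ_three]
      rw [hdec, Fin.sum_univ_three]
      module
    refine (congrArg norm hR).trans_le ?_
    rw [norm_smul, Real.norm_eq_abs]
    have hlast : |T' - T| ≤ d := hwd 2
    calc _ ≤ 1 * (d * M + ∑ _j : Fin 3, d * (M + M)) := by
          gcongr
          refine (norm_sub_le _ _).trans (add_le_add ?_ ?_)
          · rw [norm_smul, Real.norm_eq_abs]
            gcongr
            exact happ _ _ hMg
          · refine (norm_sum_le _ _).trans (Finset.sum_le_sum fun j _ => ?_)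
            rw [norm_smul, Real.norm_eq_abs]
            gcongr
            · exact hwd j
            · exact (norm_add_le _ _).trans (add_le_add (happ _ _ (hMj j).1) (happ _ _ (hMj j).2))
      _ = 7 * M * d := by simp; ring
  · intro s hs τ hτ
    have hmem : ![0, s, T + τ * (T' - T)] ∈ paramDomain Text := by
      refine ⟨⟨?_, ?_⟩, (segment_mem_Icc hT hT' hτ).1, (segment_mem_Icc hT hT' hτ).2.trans_lt hc⟩
      · simpa using (by linarith [hs.1] : -(1 / 2) < s)
      · simpa using (by linarith [hs.2] : s < 1 / 2)
    have h1 : timePath T T' ![1, s, τ] = ![1, s, T + τ * (T' - T)] := by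
      ext i; fin_cases i <;> simp [timePath]
    have h0 : timePath T T' ![0, s, τ] = ![0, s, T + τ * (T' - T)] := by
      ext i; fin_cases i <;> simp [timePath]
    simp [C, Pj, h1, h0, h.coord_periodic _ _ hmem, h.weight_periodic _ _ hmem,
      h.coeff_periodic _ _ _ hmem]
  · intro θ τ
    constructor <;>
    · simp only [Qj]
      rw [h.weight_zero]
      · simp
      · simp [timePath, abs_of_pos]

end SpaceTimeShift
end

/-! ### Transport integrals of measurable phases -/

noncomputable section
open scoped NNReal ENNReal

namespace SpaceTimeShift

variable {E : Type*} [NormedAddCommGroup E] [NormedSpace ℝ E] {Text : ℝ}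
  {Φ : (Fin 3 → ℝ) → Plane} {g : (Fin 3 → ℝ) → E} {a b : Fin 3 → (Fin 3 → ℝ) → ℝ}

/-- The inclusion of a time slice, up to translation. -/
def sliceDeriv : (Fin 2 → ℝ) →L[ℝ] (Fin 3 → ℝ) :=
  ContinuousLinearMap.pi ![ContinuousLinearMap.proj 0, ContinuousLinearMap.proj 1, 0]

theorem hasFDerivAt_slice (T : ℝ) (x : Fin 2 → ℝ) :
    HasFDerivAt (fun x : Fin 2 → ℝ => (![x 0, x 1, T] : Fin 3 → ℝ)) sliceDeriv x := by
  rw [hasFDerivAt_pi']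
  intro i
  fin_cases i
  · exact (ContinuousLinearMap.proj (R := ℝ) (φ := fun _ : Fin 2 => ℝ) 0).hasFDerivAt
  · exact (ContinuousLinearMap.proj (R := ℝ) (φ := fun _ : Fin 2 => ℝ) 1).hasFDerivAt
  · exact hasFDerivAt_const T x

theorem contDiff_slice (T : ℝ) :
    ContDiff ℝ 1 (fun x : Fin 2 → ℝ => (![x 0, x 1, T] : Fin 3 → ℝ)) := by
  rw [contDiff_pi]
  intro i
  fin_cases i
  · exact contDiff_apply ℝ ℝ 0
  · exact contDiff_apply ℝ ℝ 1
  · exact contDiff_const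

theorem isOpen_strip : IsOpen {x : Fin 2 → ℝ | x 1 ∈ Ioo (-(1 / 2) : ℝ) (1 / 2)} :=
  isOpen_Ioo.preimage (continuous_apply 1)

theorem paramBox_subset_strip : paramBox ⊆ {x : Fin 2 → ℝ | x 1 ∈ Ioo (-(1 / 2) : ℝ) (1 / 2)} :=
  fun x hx => by
    have := (mem_paramBox.1 hx).2
    exact ⟨by linarith [this.1], by linarith [this.2]⟩

/-- The decompositions of the two constant fields put both basis vectors in the span of ∂_θ Φ and
∂_s Φ. The slice differential is therefore onto, hence invertible by dimension. -/
theorem IsTransport.exists_hasStrictFDerivAt (h : IsTransport Text Φ g a b) {T : ℝ}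
    (hT : T ∈ Ico 0 Text) {x : Fin 2 → ℝ} (hx : x 1 ∈ Ioo (-(1 / 2) : ℝ) (1 / 2)) :
    ∃ f' : (Fin 2 → ℝ) ≃L[ℝ] (Fin 2 → ℝ), HasStrictFDerivAt
      (fun x : Fin 2 → ℝ => EuclideanSpace.equiv (Fin 2) ℝ (Φ ![x 0, x 1, T]))
      (f' : (Fin 2 → ℝ) →L[ℝ] (Fin 2 → ℝ)) x := by
  set S := paramDomain Text
  set e := EuclideanSpace.equiv (Fin 2) ℝ
  have hmaps : MapsTo (fun x : Fin 2 → ℝ => (![x 0, x 1, T] : Fin 3 → ℝ))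
      {x : Fin 2 → ℝ | x 1 ∈ Ioo (-(1 / 2) : ℝ) (1 / 2)} S := fun y hy => ⟨hy, hT⟩
  have hnhds := isOpen_strip.mem_nhds hx
  have hcd : ContDiffAt ℝ 1 (fun x : Fin 2 → ℝ => e (Φ ![x 0, x 1, T])) x :=
    e.contDiff.contDiffAt.comp x
      ((h.coord_smooth.comp (contDiff_slice T).contDiffOn hmaps).contDiffAt hnhds)
  set p : Fin 3 → ℝ := ![x 0, x 1, T] with hp
  have hpS : p ∈ S := hmaps hx
  set DΦ := fderivWithin ℝ Φ S p with hDΦ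
  have hfd : HasFDerivAt (fun x : Fin 2 → ℝ => e (Φ ![x 0, x 1, T]))
      ((e : Plane →L[ℝ] (Fin 2 → ℝ)).comp (DΦ.comp sliceDeriv)) x := by
    have h1 := ((h.coord_smooth.differentiableOn one_ne_zero) p hpS).hasFDerivWithinAt
    have h2 := (h1.comp x (hasFDerivAt_slice T x).hasFDerivWithinAt hmaps).hasFDerivAt hnhds
    exact e.toContinuousLinearMap.hasFDerivAt.comp x h2
  set L := (e : Plane →L[ℝ] (Fin 2 → ℝ)).comp (DΦ.comp sliceDeriv) with hL
  have hs0 : sliceDeriv (Pi.single 0 1) = Pi.single 0 1 := by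
    ext i; fin_cases i <;> simp [sliceDeriv]
  have hs1 : sliceDeriv (Pi.single 1 1) = Pi.single 1 1 := by
    ext i; fin_cases i <;> simp [sliceDeriv]
  have hsurj : Function.Surjective L := by
    intro y
    have h0 := h.decomposition p hpS 0
    have h1 := h.decomposition p hpS 1
    simp only [Matrix.cons_val_zero, Matrix.cons_val_one] at h0 h1
    have hcomb : ∀ r s : ℝ, r • DΦ (Pi.single 0 1) + s • DΦ (Pi.single 1 1) =
        DΦ (sliceDeriv (r • Pi.single 0 1 + s • Pi.single 1 1)) := fun r s => by
      simp only [map_add, map_smul, hs0, hs1]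
    obtain ⟨v, hv⟩ : ∃ v, EuclideanSpace.single (0 : Fin 2) (1 : ℝ) = DΦ (sliceDeriv v) :=
      ⟨_, h0.trans (hcomb _ _)⟩
    obtain ⟨v', hv'⟩ : ∃ v, EuclideanSpace.single (1 : Fin 2) (1 : ℝ) = DΦ (sliceDeriv v) :=
      ⟨_, h1.trans (hcomb _ _)⟩
    refine ⟨y 0 • v + y 1 • v', ?_⟩
    rw [hL]
    simp only [ContinuousLinearMap.comp_apply, map_add, map_smul, ← hv, ← hv']
    ext i
    fin_cases i <;> simp [e]
  have hinj : Function.Injective L :=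
    LinearMap.injective_iff_surjective (f := (L : (Fin 2 → ℝ) →ₗ[ℝ] (Fin 2 → ℝ))).2 hsurj
  refine ⟨ContinuousLinearEquiv.ofBijective L (LinearMap.ker_eq_bot.2 hinj)
    (LinearMap.range_eq_top.2 hsurj), ?_⟩
  rw [ContinuousLinearEquiv.coe_ofBijective]
  exact hcd.hasStrictFDerivAt' hfd one_ne_zero

/-- Needed to pull almost everywhere convergence of mollified phases back to the parameter box;
local invertibility suffices. -/
theorem IsTransport.ae_paramBox (h : IsTransport Text Φ g a b) {T : ℝ} (hT : T ∈ Ico 0 Text)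
    (z : Plane) {p : Plane → Prop} (hp : ∀ᵐ y, p y) :
    ∀ᵐ x ∂volume.restrict paramBox, p (z + Φ ![x 0, x 1, T]) := by
  rw [ae_restrict_iff' measurableSet_paramBox]
  set N : Set (Fin 2 → ℝ) := {y | ¬ p (z + WithLp.toLp 2 y)} with hN
  have hN0 : volume N = 0 := by
    have h1 : ∀ᵐ y : Plane, p (z + y) := by
      have := (measurePreserving_add_left (volume : Measure Plane) z).quasiMeasurePreserving
      exact this.ae hp
    exact (PiLp.volume_preserving_toLp (Fin 2)).quasiMeasurePreserving.ae h1
  have hnull := measure_preimage_null_of_hasStrictFDerivAt (μ := volume)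
    (f := fun x : Fin 2 → ℝ => EuclideanSpace.equiv (Fin 2) ℝ (Φ ![x 0, x 1, T]))
    (s := {x : Fin 2 → ℝ | x 1 ∈ Ioo (-(1 / 2) : ℝ) (1 / 2)})
    (fun x hx => h.exists_hasStrictFDerivAt hT hx) hN0
  refine measure_mono_null ?_ hnull
  intro x hx
  simp only [mem_compl_iff, mem_ofPred_eq, Classical.not_imp] at hx
  exact ⟨paramBox_subset_strip hx.1, hx.2⟩

theorem IsTransport.continuousOn_slice (h : IsTransport Text Φ g a b) {T : ℝ}
    (hT : T ∈ Ico 0 Text) :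
    ContinuousOn (fun x : Fin 2 → ℝ => Φ ![x 0, x 1, T]) paramBox ∧
      ContinuousOn (fun x : Fin 2 → ℝ => g ![x 0, x 1, T]) paramBox :=
  ⟨h.coord_smooth.continuousOn.comp (contDiff_slice T).continuous.continuousOn
      fun _ hx => ⟨paramBox_subset_strip hx, hT⟩,
    h.weight_smooth.continuousOn.comp (contDiff_slice T).continuous.continuousOn
      fun _ hx => ⟨paramBox_subset_strip hx, hT⟩⟩

/-- Dominated convergence with dominating function ‖g‖ on the box. -/
theorem IsTransport.tendsto_transportIntegral (h : IsTransport Text Φ g a b) {T : ℝ}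
    (hT : T ∈ Ico 0 Text) (z : Plane) {χ : Plane → ℝ} {χk : ℕ → Plane → ℝ}
    (hk : ∀ k, Measurable (χk k)) (hk1 : ∀ k x, |χk k x| ≤ 1)
    (hlim : ∀ᵐ x, Tendsto (fun k => χk k x) atTop (𝓝 (χ x))) :
    Tendsto (fun k => transportIntegral Φ g (χk k) z T) atTop
      (𝓝 (transportIntegral Φ g χ z T)) := by
  obtain ⟨hΦc, hgc⟩ := h.continuousOn_slice hT
  refine tendsto_integral_of_dominated_convergence (fun x => ‖g ![x 0, x 1, T]‖)
    (fun k => ?_) ?_ (fun k => ?_) ?_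
  · refine AEStronglyMeasurable.smul ?_
      (hgc.aestronglyMeasurable_of_isCompact isCompact_paramBox measurableSet_paramBox)
    have h1 : AEMeasurable (fun x : Fin 2 → ℝ => z + Φ ![x 0, x 1, T])
      (volume.restrict paramBox) := (continuousOn_const.add hΦc).aemeasurable measurableSet_paramBox
    exact ((hk k).comp_aemeasurable h1).aestronglyMeasurable
  · exact (hgc.norm.integrableOn_compact isCompact_paramBox)
  · refine Eventually.of_forall fun x => ?_
    rw [norm_smul, Real.norm_eq_abs]
    exact mul_le_of_le_one_left (norm_nonneg _) (hk1 k _)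
  · filter_upwards [h.ae_paramBox hT z hlim] with x hx using hx.smul_const _

/-- Transport integrals of bounded measurable functions are Lipschitz in the parameters, uniformly
in the function. -/
theorem IsTransport.exists_lipschitz [FiniteDimensional ℝ E] (h : IsTransport Text Φ g a b)
    {c : ℝ} (hc : c < Text) :
    ∃ K : ℝ≥0, ∀ χ : Plane → ℝ, Measurable χ → (∀ x, |χ x| ≤ 1) → ∀ z z' : Plane,
      ∀ T ∈ Icc 0 c, ∀ T' ∈ Icc 0 c,
        dist (transportIntegral Φ g χ z T) (transportIntegral Φ g χ z' T') ≤
          K * dist (z, T) (z', T') := by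
  set S := paramDomain Text with hS
  have hud := uniqueDiffOn_paramDomain Text
  set N : (Fin 3 → ℝ) → ℝ := fun q => ‖fderivWithin ℝ g S q‖ +
    ∑ j, (‖fderivWithin ℝ (fun q => a j q • g q) S q‖ +
      ‖fderivWithin ℝ (fun q => b j q • g q) S q‖) with hN
  have hNc : ContinuousOn N S :=
    (h.weight_smooth.continuousOn_fderivWithin hud le_rfl).norm.add
      (continuousOn_finsetSum _ fun j _ =>
        ((h.fst_smooth j).continuousOn_fderivWithin hud le_rfl).norm.add
          ((h.snd_smooth j).continuousOn_fderivWithin hud le_rfl).norm)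
  have hmem : ∀ q : Fin 3 → ℝ, q ∈ Icc (![0, -(1 / 4), 0] : Fin 3 → ℝ) ![1, 1 / 4, c] ↔
      q 0 ∈ Icc (0 : ℝ) 1 ∧ q 1 ∈ Icc (-(1 / 4) : ℝ) (1 / 4) ∧ q 2 ∈ Icc 0 c := fun q => by
    simp [Pi.le_def, Fin.forall_fin_succ]
    tauto
  have hsub : Icc (![0, -(1 / 4), 0] : Fin 3 → ℝ) ![1, 1 / 4, c] ⊆ S := fun q hq => by
    obtain ⟨-, h1, h2⟩ := (hmem q).1 hq
    exact ⟨⟨by linarith [h1.1], by linarith [h1.2]⟩, h2.1, h2.2.trans_lt hc⟩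
  -- Compactness is the only reason for c < Text: the derivatives of the weights need not stay
  -- bounded near extinction.
  obtain ⟨M, hM⟩ := isCompact_Icc.exists_bound_of_continuousOn (hNc.mono hsub)
  have hbd : ∀ q : Fin 3 → ℝ, q 0 ∈ Icc (0 : ℝ) 1 → q 1 ∈ Icc (-(1 / 4) : ℝ) (1 / 4) →
      q 2 ∈ Icc 0 c → ‖fderivWithin ℝ g S q‖ ≤ max M 0 ∧
      ∀ j, ‖fderivWithin ℝ (fun q => a j q • g q) S q‖ ≤ max M 0 ∧
        ‖fderivWithin ℝ (fun q => b j q • g q) S q‖ ≤ max M 0 := fun q h0 h1 h2 => by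
    have hq : N q ≤ max M 0 :=
      ((le_abs_self _).trans (hM q ((hmem q).2 ⟨h0, h1, h2⟩))).trans (le_max_left _ _)
    have hsum : ∀ j, ‖fderivWithin ℝ (fun q => a j q • g q) S q‖ +
        ‖fderivWithin ℝ (fun q => b j q • g q) S q‖ ≤
        ∑ j, (‖fderivWithin ℝ (fun q => a j q • g q) S q‖ +
          ‖fderivWithin ℝ (fun q => b j q • g q) S q‖) := fun j =>
      Finset.single_le_sum (f := fun j => ‖fderivWithin ℝ (fun q => a j q • g q) S q‖ +
        ‖fderivWithin ℝ (fun q => b j q • g q) S q‖) (fun _ _ => by positivity)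
        (Finset.mem_univ j)
    simp only [hN] at hq
    have hg0 := norm_nonneg (fderivWithin ℝ g S q)
    refine ⟨le_trans ?_ hq, fun j => ⟨le_trans ?_ hq, le_trans ?_ hq⟩⟩
    · linarith [Finset.sum_nonneg (s := Finset.univ) (f := fun j =>
        ‖fderivWithin ℝ (fun q => a j q • g q) S q‖ +
        ‖fderivWithin ℝ (fun q => b j q • g q) S q‖) fun _ _ => by positivity]
    · linarith [hsum j, norm_nonneg (fderivWithin ℝ (fun q => b j q • g q) S q)]
    · linarith [hsum j, norm_nonneg (fderivWithin ℝ (fun q => a j q • g q) S q)]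
  refine ⟨⟨7 / 2 * max M 0, by positivity⟩, fun χ hχ hχ1 z z' T hT T' hT' => ?_⟩
  obtain ⟨χk, hk, hk1, hlim⟩ := exists_smooth_tendsto_ae hχ hχ1
  have hkm : ∀ k, Measurable (χk k) := fun k => (hk k).continuous.measurable
  have h1 := h.tendsto_transportIntegral ⟨hT.1, hT.2.trans_lt hc⟩ z hkm hk1 hlim
  have h2 := h.tendsto_transportIntegral ⟨hT'.1, hT'.2.trans_lt hc⟩ z' hkm hk1 hlim
  refine le_of_tendsto (h1.dist h2) (Eventually.of_forall fun k => ?_)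
  rw [dist_comm, dist_eq_norm]
  exact h.lipschitz_of_smooth hc hbd (hk k) (hk1 k) z z' hT hT'

end SpaceTimeShift
end

noncomputable section

namespace SpaceTimeShift

/-! ### Frenet formula -/

section Frame

theorem contDiffAt_unitNormal {n : ℕ∞} {v : Plane} (hv : v ≠ 0) : ContDiffAt ℝ n unitNormal v := by
  have h1 : ContDiffAt ℝ n (fun v : Plane => ‖v‖⁻¹) v :=
    (contDiffAt_norm ℝ hv).inv (norm_ne_zero_iff.2 hv)
  exact h1.smul rotJL.contDiff.contDiffAt

/-- Frenet formula for the normal of a regular curve. -/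
theorem hasDerivAt_unitNormal {X : ℝ → Plane} {X' : Plane} {θ : ℝ} (hX : HasDerivAt X X' θ)
    (hne : ∀ θ, X θ ≠ 0) :
    HasDerivAt (fun θ => unitNormal (X θ))
      (-((inner ℝ X' (unitNormal (X θ)) : ℝ) / ‖X θ‖ ^ 2) • X θ) θ := by
  have hd : DifferentiableAt ℝ (fun θ => unitNormal (X θ)) θ :=
    ((contDiffAt_unitNormal (n := 1) (hne θ)).differentiableAt (by norm_num)).comp θ
      hX.differentiableAt
  have hN := hd.hasDerivAt
  set N' := deriv (fun θ => unitNormal (X θ)) θ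
  -- Differentiating |n|² = 1 here and n · X = 0 next determines both frame components of n'.
  have h1 : inner ℝ N' (unitNormal (X θ)) = (0 : ℝ) := by
    have h2 := hN.norm_sq
    have h3 : (fun θ => ‖unitNormal (X θ)‖ ^ 2) = fun _ => (1 : ℝ) := by
      funext θ
      rw [norm_unitNormal (hne θ), one_pow]
    rw [h3] at h2
    have := h2.unique (hasDerivAt_const θ 1)
    rw [real_inner_comm]
    linarith
  have h4 : inner ℝ N' (X θ) = -(inner ℝ X' (unitNormal (X θ)) : ℝ) := by
    have h2 := hN.inner ℝ hX
    have h3 : (fun θ => inner ℝ (unitNormal (X θ)) (X θ)) = fun _ => (0 : ℝ) := by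
      funext θ
      exact inner_unitNormal_self _
    rw [h3] at h2
    have := h2.unique (hasDerivAt_const θ 0)
    rw [real_inner_comm X'] at this
    linarith
  have h5 := frame_decomposition (hne θ) N'
  rw [h1, h4, zero_smul, add_zero, neg_div] at h5
  rw [← h5]
  exact hN

end Frame

/-! ### Smooth families of closed curves -/

section Velocity

/-- The velocity of the curves `γ(·, t)`. -/
def velocity (γ : ℝ → ℝ → Plane) (θ t : ℝ) : Plane := deriv (fun θ' => γ θ' t) θ

variable {Text : ℝ} {γ : ℝ → ℝ → Plane}

/-- The space-time domain of an evolving curve. -/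
def curveDomain (Text : ℝ) : Set (ℝ × ℝ) := univ ×ˢ Ico 0 Text

/-- The θ-derivative is the space-time derivative within the domain applied to (1, 0), so smoothness
holds up to the initial time. -/
theorem contDiffOn_velocity
    (hγ : ContDiffOn ℝ ∞ (fun p : ℝ × ℝ => γ p.1 p.2) (curveDomain Text)) :
    ContDiffOn ℝ ∞ (fun p : ℝ × ℝ => velocity γ p.1 p.2) (curveDomain Text) := by
  have hud : UniqueDiffOn ℝ (curveDomain Text) := uniqueDiffOn_univ.prod (uniqueDiffOn_Ico _ _)
  have h1 : ContDiffOn ℝ ∞ (fun p => fderivWithin ℝ (fun p : ℝ × ℝ => γ p.1 p.2)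
      (curveDomain Text) p (1, 0)) (curveDomain Text) :=
    (hγ.fderivWithin hud (by simp)).clm_apply contDiffOn_const
  refine h1.congr fun p hp => ?_
  have h2 := ((hγ.differentiableOn (by simp)) p hp).hasFDerivWithinAt
  have h3 : HasDerivAt (fun θ => (θ, p.2)) ((1 : ℝ), (0 : ℝ)) p.1 :=
    (hasDerivAt_id' p.1).prodMk (hasDerivAt_const _ _)
  exact (h2.comp_hasDerivAt p.1 h3 (Eventually.of_forall fun θ =>
    (⟨mem_univ _, hp.2⟩ : (θ, p.2) ∈ curveDomain Text))).deriv

theorem contDiff_slice_curve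
    (hγ : ContDiffOn ℝ ∞ (fun p : ℝ × ℝ => γ p.1 p.2) (curveDomain Text)) {t : ℝ}
    (ht : t ∈ Ico 0 Text) : ContDiff ℝ ∞ fun θ => γ θ t := by
  rw [← contDiffOn_univ]
  have h1 : ContDiff ℝ ∞ fun θ : ℝ => (θ, t) := contDiff_id.prodMk contDiff_const
  exact hγ.comp h1.contDiffOn fun θ _ => ⟨mem_univ _, ht⟩

theorem hasDerivAt_velocity
    (hγ : ContDiffOn ℝ ∞ (fun p : ℝ × ℝ => γ p.1 p.2) (curveDomain Text)) {t : ℝ}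
    (ht : t ∈ Ico 0 Text) (θ : ℝ) : HasDerivAt (fun θ => γ θ t) (velocity γ θ t) θ :=
  ((contDiff_slice_curve hγ ht).differentiable (by simp) θ).hasDerivAt

theorem velocity_periodic {t : ℝ} (h : Function.Periodic (fun θ => γ θ t) 1) :
    Function.Periodic (fun θ => velocity γ θ t) 1 := fun θ => by
  have h1 : (fun θ => γ θ t) = fun θ => γ (θ + 1) t := funext fun θ => (h θ).symm
  simp only [velocity]
  conv_rhs => rw [h1]
  exact (deriv_comp_add_const (fun θ => γ θ t) 1 θ).symm

/-- A smoothly evolving family of regular closed curves whose radius of curvature is at least half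
of the radius of the shrinking circle. -/
structure IsRegularFamily (Text : ℝ) (γ : ℝ → ℝ → Plane) : Prop where
  smooth : ContDiffOn ℝ ∞ (fun p : ℝ × ℝ => γ p.1 p.2) (curveDomain Text)
  periodic : ∀ t ∈ Ico 0 Text, Function.Periodic (fun θ => γ θ t) 1
  regular : ∀ t ∈ Ico 0 Text, ∀ θ, velocity γ θ t ≠ 0
  focal : ∀ t ∈ Ico 0 Text, ∀ θ, radius Text t *
    |(inner ℝ (velocity (velocity γ) θ t) (unitNormal (velocity γ θ t)) : ℝ)| ≤
      2 * ‖velocity γ θ t‖ ^ 2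

end Velocity

/-! ### Tubular coordinates and their coefficients -/

section Weights

variable {Text : ℝ} {γ : ℝ → ℝ → Plane} {ζ : ℝ → ℝ}

theorem radius_pos {t : ℝ} (ht : t < Text) : 0 < radius Text t :=
  Real.sqrt_pos.2 (by linarith)

/-- Tubular coordinates around the evolving curve, scaled by the radius. -/
def tubularMap (Text : ℝ) (γ : ℝ → ℝ → Plane) (q : Fin 3 → ℝ) : Plane :=
  γ (q 0) (q 2) + (radius Text (q 2) * q 1) • unitNormal (velocity γ (q 0) (q 2))

/-- The density of the right-hand side of the shift equations in tubular coordinates. -/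
def tubularWeight (Text : ℝ) (γ : ℝ → ℝ → Plane) (ζ : ℝ → ℝ) (q : Fin 3 → ℝ) : Plane × ℝ :=
  (ζ (q 1) * ‖velocity γ (q 0) (q 2)‖) •
    ((6 / radius Text (q 2)) • unitNormal (velocity γ (q 0) (q 2)), (4 : ℝ))

/-- The vector fields generating the space-time shifts. -/
def shiftField (Text : ℝ) (γ : ℝ → ℝ → Plane) (j : Fin 3) (q : Fin 3 → ℝ) : Plane :=
  (![EuclideanSpace.single 0 1, EuclideanSpace.single 1 1,
      fderivWithin ℝ (tubularMap Text γ) (paramDomain Text) q (Pi.single 2 1)] : Fin 3 → Plane) j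

/-- Jacobian factor of tubular coordinates. -/
def tubularJacobian (Text : ℝ) (γ : ℝ → ℝ → Plane) (q : Fin 3 → ℝ) : ℝ :=
  ‖velocity γ (q 0) (q 2)‖ ^ 2 - radius Text (q 2) * q 1 *
    inner ℝ (velocity (velocity γ) (q 0) (q 2)) (unitNormal (velocity γ (q 0) (q 2)))

/-- Tangential coefficient of the fields `shiftField`. -/
def tangentCoeff (Text : ℝ) (γ : ℝ → ℝ → Plane) (j : Fin 3) (q : Fin 3 → ℝ) : ℝ :=
  inner ℝ (shiftField Text γ j q) (velocity γ (q 0) (q 2)) / tubularJacobian Text γ q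

/-- Normal coefficient of the fields `shiftField`. -/
def normalCoeff (Text : ℝ) (γ : ℝ → ℝ → Plane) (j : Fin 3) (q : Fin 3 → ℝ) : ℝ :=
  inner ℝ (shiftField Text γ j q) (unitNormal (velocity γ (q 0) (q 2))) / radius Text (q 2)

namespace IsRegularFamily

/-- With K the normal part of γ'', the focal bound r |K| ≤ 2 |γ'|² and |s| < 1/2 give r s K < |γ'|².
-/
theorem tubularJacobian_pos (hγ : IsRegularFamily Text γ) {q : Fin 3 → ℝ}
    (hq : q ∈ paramDomain Text) : 0 < tubularJacobian Text γ q := by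
  have hv : 0 < ‖velocity γ (q 0) (q 2)‖ := norm_pos_iff.2 (hγ.regular _ hq.2 _)
  have hr := radius_pos hq.2.2
  have hf := hγ.focal _ hq.2 (q 0)
  have hs : |q 1| < 1 / 2 := abs_lt.2 hq.1
  rw [tubularJacobian]
  set K : ℝ := inner ℝ (velocity (velocity γ) (q 0) (q 2)) (unitNormal (velocity γ (q 0) (q 2)))
  have h1 : radius Text (q 2) * q 1 * K ≤ |q 1| * (radius Text (q 2) * |K|) := by
    refine (le_abs_self _).trans (le_of_eq ?_)
    rw [abs_mul, abs_mul, abs_of_pos hr]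
    ring
  have h2 : |q 1| * (radius Text (q 2) * |K|) ≤ |q 1| * (2 * ‖velocity γ (q 0) (q 2)‖ ^ 2) := by
    gcongr
  nlinarith [pow_pos hv 2]

theorem contDiffOn_comp {V : Type*} [NormedAddCommGroup V] [NormedSpace ℝ V] {f : ℝ → ℝ → V}
    (hf : ContDiffOn ℝ ∞ (fun p : ℝ × ℝ => f p.1 p.2) (curveDomain Text)) :
    ContDiffOn ℝ ∞ (fun q : Fin 3 → ℝ => f (q 0) (q 2)) (paramDomain Text) := by
  have h1 : ContDiff ℝ ∞ fun q : Fin 3 → ℝ => (q 0, q 2) :=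
    (contDiff_apply ℝ ℝ 0).prodMk (contDiff_apply ℝ ℝ 2)
  exact hf.comp h1.contDiffOn fun q hq => ⟨mem_univ _, hq.2⟩

theorem contDiffOn_radius :
    ContDiffOn ℝ ∞ (fun q : Fin 3 → ℝ => radius Text (q 2)) (paramDomain Text) := by
  have h1 : ContDiff ℝ ∞ fun q : Fin 3 → ℝ => 2 * (Text - q 2) :=
    contDiff_const.mul (contDiff_const.sub (contDiff_apply ℝ ℝ 2))
  exact h1.contDiffOn.sqrt fun q hq => by
    have := hq.2.2
    exact (by linarith : 0 < 2 * (Text - q 2)).ne'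

theorem contDiffOn_normal (hγ : IsRegularFamily Text γ) :
    ContDiffOn ℝ ∞ (fun q : Fin 3 → ℝ => unitNormal (velocity γ (q 0) (q 2)))
      (paramDomain Text) := fun q hq =>
  ContDiffAt.comp_contDiffWithinAt (g := unitNormal)
    (f := fun q : Fin 3 → ℝ => velocity γ (q 0) (q 2)) q
    (contDiffAt_unitNormal (n := ⊤) (hγ.regular _ hq.2 _))
    (contDiffOn_comp (contDiffOn_velocity hγ.smooth) q hq)

theorem contDiffOn_tubularMap (hγ : IsRegularFamily Text γ) :
    ContDiffOn ℝ ∞ (tubularMap Text γ) (paramDomain Text) :=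
  (contDiffOn_comp hγ.smooth).add
    ((contDiffOn_radius.mul (contDiff_apply ℝ ℝ 1).contDiffOn).smul hγ.contDiffOn_normal)

theorem contDiffOn_tubularWeight (hγ : IsRegularFamily Text γ) (hζ : ContDiff ℝ ∞ ζ) :
    ContDiffOn ℝ ∞ (tubularWeight Text γ ζ) (paramDomain Text) := by
  have h1 : ContDiffOn ℝ ∞ (fun q : Fin 3 → ℝ => ‖velocity γ (q 0) (q 2)‖) (paramDomain Text) :=
    (contDiffOn_comp (contDiffOn_velocity hγ.smooth)).norm ℝ fun q hq => hγ.regular _ hq.2 _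
  have h2 : ContDiffOn ℝ ∞ (fun q : Fin 3 → ℝ => ζ (q 1)) (paramDomain Text) :=
    (hζ.comp (contDiff_apply ℝ ℝ 1)).contDiffOn
  have h3 : ContDiffOn ℝ ∞ (fun q : Fin 3 → ℝ => 6 / radius Text (q 2)) (paramDomain Text) :=
    contDiffOn_const.div contDiffOn_radius fun q hq => (radius_pos hq.2.2).ne'
  exact (h2.mul h1).smul ((h3.smul hγ.contDiffOn_normal).prodMk contDiffOn_const)

theorem contDiffOn_shiftField (hγ : IsRegularFamily Text γ) (j : Fin 3) :
    ContDiffOn ℝ ∞ (shiftField Text γ j) (paramDomain Text) := by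
  fin_cases j
  · exact contDiffOn_const
  · exact contDiffOn_const
  · exact (hγ.contDiffOn_tubularMap.fderivWithin (uniqueDiffOn_paramDomain Text)
      (by simp)).clm_apply contDiffOn_const

theorem contDiffOn_tangentCoeff (hγ : IsRegularFamily Text γ) (j : Fin 3) :
    ContDiffOn ℝ ∞ (tangentCoeff Text γ j) (paramDomain Text) := by
  have hX := contDiffOn_velocity hγ.smooth
  have hJ : ContDiffOn ℝ ∞ (tubularJacobian Text γ) (paramDomain Text) :=
    ((contDiffOn_comp hX).norm_sq ℝ).sub
      ((contDiffOn_radius.mul (contDiff_apply ℝ ℝ 1).contDiffOn).mul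
        ((contDiffOn_comp (contDiffOn_velocity hX)).inner ℝ hγ.contDiffOn_normal))
  exact ((hγ.contDiffOn_shiftField j).inner ℝ (contDiffOn_comp hX)).div hJ
    fun q hq => (hγ.tubularJacobian_pos hq).ne'

theorem contDiffOn_normalCoeff (hγ : IsRegularFamily Text γ) (j : Fin 3) :
    ContDiffOn ℝ ∞ (normalCoeff Text γ j) (paramDomain Text) :=
  ((hγ.contDiffOn_shiftField j).inner ℝ hγ.contDiffOn_normal).div contDiffOn_radius
    fun _ hq => (radius_pos hq.2.2).ne'

/-- By the Frenet formula n' is tangential, so moving along θ at fixed s stays parallel to the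
curve. With the normal s-derivative this gives an orthogonal frame. -/
theorem fderivWithin_tubularMap_zero (hγ : IsRegularFamily Text γ) {q : Fin 3 → ℝ}
    (hq : q ∈ paramDomain Text) :
    fderivWithin ℝ (tubularMap Text γ) (paramDomain Text) q (Pi.single 0 1) =
      (tubularJacobian Text γ q / ‖velocity γ (q 0) (q 2)‖ ^ 2) • velocity γ (q 0) (q 2) := by
  have hd := ((hγ.contDiffOn_tubularMap.differentiableOn (by simp)) q hq).hasFDerivWithinAt
  have hline : HasDerivAt (fun θ => Function.update q 0 θ) (Pi.single 0 1) (q 0) :=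
    hasDerivAt_update q 0 (q 0)
  have hupd : Function.update q 0 (q 0) = q := Function.update_eq_self 0 q
  rw [← hupd] at hd
  have h1 := hd.comp_hasDerivAt (q 0) hline (Eventually.of_forall fun θ => by
    simpa [paramDomain] using hq)
  have h2 : HasDerivAt (fun θ => tubularMap Text γ (Function.update q 0 θ))
      (velocity γ (q 0) (q 2) + (radius Text (q 2) * q 1) •
        (-((inner ℝ (velocity (velocity γ) (q 0) (q 2))
          (unitNormal (velocity γ (q 0) (q 2))) : ℝ) / ‖velocity γ (q 0) (q 2)‖ ^ 2) •
          velocity γ (q 0) (q 2))) (q 0) := by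
    simp only [tubularMap]
    simpa using (hasDerivAt_velocity hγ.smooth hq.2 (q 0)).fun_add
      ((hasDerivAt_unitNormal (hasDerivAt_velocity (contDiffOn_velocity hγ.smooth) hq.2 (q 0))
        (hγ.regular _ hq.2)).const_smul (radius Text (q 2) * q 1))
  have h3 := h1.unique h2
  rw [hupd] at h3
  rw [h3]
  have hv : ‖velocity γ (q 0) (q 2)‖ ≠ 0 := norm_ne_zero_iff.2 (hγ.regular _ hq.2 _)
  rw [tubularJacobian, sub_div, div_self (pow_ne_zero 2 hv), sub_smul, one_smul, smul_smul,
    sub_eq_add_neg, ← neg_smul]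
  congr 2
  ring

theorem fderivWithin_tubularMap_one (hγ : IsRegularFamily Text γ) {q : Fin 3 → ℝ}
    (hq : q ∈ paramDomain Text) :
    fderivWithin ℝ (tubularMap Text γ) (paramDomain Text) q (Pi.single 1 1) =
      radius Text (q 2) • unitNormal (velocity γ (q 0) (q 2)) := by
  have hd := ((hγ.contDiffOn_tubularMap.differentiableOn (by simp)) q hq).hasFDerivWithinAt
  have hline : HasDerivAt (fun θ => Function.update q 1 θ) (Pi.single 1 1) (q 1) :=
    hasDerivAt_update q 1 (q 1)
  have hupd : Function.update q 1 (q 1) = q := Function.update_eq_self 1 q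
  rw [← hupd] at hd
  have h1 := hd.comp_hasDerivAt (q 1) hline (by
    filter_upwards [Ioo_mem_nhds hq.1.1 hq.1.2] with s hs
    exact ⟨by simpa using hs, by simpa using hq.2⟩)
  have h2 : HasDerivAt (fun s => tubularMap Text γ (Function.update q 1 s))
      (radius Text (q 2) • unitNormal (velocity γ (q 0) (q 2))) (q 1) := by
    simp only [tubularMap]
    simpa using ((((hasDerivAt_id' (q 1)).const_mul (radius Text (q 2))).smul_const
      (unitNormal (velocity γ (q 0) (q 2)))).const_add (γ (q 0) (q 2)))
  have h3 := h1.unique h2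
  rw [hupd] at h3
  exact h3

end IsRegularFamily
end Weights
end SpaceTimeShift
end

noncomputable section

namespace SpaceTimeShift

variable {Text C : ℝ} {γ : ℝ → ℝ → Plane} {ζ : ℝ → ℝ}

/-- The cutoff lives in |s| ≤ 1/(8C) ≤ 1/8. The box |s| ≤ 1/4 thus loses nothing and produces no
lateral boundary terms. -/
theorem IsCutoff.eq_zero_of_quarter_le (hζ : IsCutoff C ζ) (hC : 1 ≤ C) {s : ℝ}
    (hs : 1 / 4 ≤ |s|) : ζ s = 0 := by
  refine hζ.eq_zero s (lt_of_lt_of_le ?_ hs)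
  rw [div_lt_div_iff₀ (by linarith) (by norm_num)]
  linarith

/-! ### Periodicity in θ and the transport structure -/

section Periodicity

theorem add_single_zero (q : Fin 3 → ℝ) : (q + Pi.single 0 1 : Fin 3 → ℝ) 0 = q 0 + 1 ∧
    (q + Pi.single 0 1 : Fin 3 → ℝ) 1 = q 1 ∧ (q + Pi.single 0 1 : Fin 3 → ℝ) 2 = q 2 := by
  simp

theorem add_single_mem {q : Fin 3 → ℝ} (hq : q ∈ paramDomain Text) :
    q + Pi.single 0 1 ∈ paramDomain Text := by
  simpa [paramDomain] using hq

namespace IsRegularFamily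

theorem velocity_add (hγ : IsRegularFamily Text γ) {q : Fin 3 → ℝ} (hq : q ∈ paramDomain Text) :
    velocity γ (q 0 + 1) (q 2) = velocity γ (q 0) (q 2) :=
  velocity_periodic (hγ.periodic _ hq.2) (q 0)

theorem tubularMap_add (hγ : IsRegularFamily Text γ) {q : Fin 3 → ℝ}
    (hq : q ∈ paramDomain Text) : tubularMap Text γ (q + Pi.single 0 1) = tubularMap Text γ q := by
  obtain ⟨e0, e1, e2⟩ := add_single_zero q
  have h := hγ.periodic _ hq.2 (q 0)
  simp only at h
  simp only [tubularMap, e0, e1, e2, hγ.velocity_add hq, h]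

/-- Translation by one period preserves both the domain and the tubular map, hence also its
derivative within the domain. -/
theorem shiftField_add (hγ : IsRegularFamily Text γ) {q : Fin 3 → ℝ}
    (hq : q ∈ paramDomain Text) (j : Fin 3) :
    shiftField Text γ j (q + Pi.single 0 1) = shiftField Text γ j q := by
  have hd : fderivWithin ℝ (tubularMap Text γ) (paramDomain Text) (q + Pi.single 0 1) =
      fderivWithin ℝ (tubularMap Text γ) (paramDomain Text) q := by
    have h1 := ((hγ.contDiffOn_tubularMap.differentiableOn (by simp)) _
      (add_single_mem hq)).hasFDerivWithinAt
    have h2 := h1.comp q (((hasFDerivAt_id q).add_const (Pi.single 0 1)).hasFDerivWithinAt)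
      (fun p hp => add_single_mem hp)
    have h3 := h2.congr (f₁ := tubularMap Text γ) (fun p hp => (hγ.tubularMap_add hp).symm)
      (hγ.tubularMap_add hq).symm
    exact (h3.fderivWithin (uniqueDiffOn_paramDomain Text q hq)).symm
  simp only [shiftField, hd]

theorem velocity_velocity_add (hγ : IsRegularFamily Text γ) {q : Fin 3 → ℝ}
    (hq : q ∈ paramDomain Text) :
    velocity (velocity γ) (q 0 + 1) (q 2) = velocity (velocity γ) (q 0) (q 2) :=
  velocity_periodic (velocity_periodic (hγ.periodic _ hq.2)) (q 0)

theorem tangentCoeff_add (hγ : IsRegularFamily Text γ) {q : Fin 3 → ℝ}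
    (hq : q ∈ paramDomain Text) (j : Fin 3) :
    tangentCoeff Text γ j (q + Pi.single 0 1) = tangentCoeff Text γ j q := by
  obtain ⟨e0, e1, e2⟩ := add_single_zero q
  simp only [tangentCoeff, tubularJacobian, e0, e1, e2, hγ.shiftField_add hq, hγ.velocity_add hq,
    hγ.velocity_velocity_add hq]

/-- Every field is expanded in the orthogonal frame (γ', n). The Jacobian and the radius in the
denominators convert this into an expansion in ∂_θ Φ and ∂_s Φ. -/
theorem isTransport (hγ : IsRegularFamily Text γ) (hζ : IsCutoff C ζ) (hC : 1 ≤ C) :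
    IsTransport Text (tubularMap Text γ) (tubularWeight Text γ ζ) (tangentCoeff Text γ)
      (normalCoeff Text γ) := by
  have h1 : (1 : WithTop ℕ∞) ≤ ∞ := by simp
  have hg := hγ.contDiffOn_tubularWeight hζ.smooth
  have hq1 : ∀ s τ : ℝ, (![1, s, τ] : Fin 3 → ℝ) = ![0, s, τ] + Pi.single 0 1 := fun s τ => by
    ext i; fin_cases i <;> simp
  refine ⟨hγ.contDiffOn_tubularMap.of_le h1, hg.of_le h1,
    fun j => ((hγ.contDiffOn_tangentCoeff j).smul hg).of_le h1,
    fun j => ((hγ.contDiffOn_normalCoeff j).smul hg).of_le h1, fun q hq j => ?_,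
    fun s τ hq => ?_, fun s τ hq => ?_, fun j s τ hq => ?_, fun q hq => ?_⟩
  · have hJ := (hγ.tubularJacobian_pos hq).ne'
    have hr := (radius_pos hq.2.2).ne'
    have hX := hγ.regular _ hq.2 (q 0)
    rw [hγ.fderivWithin_tubularMap_zero hq, hγ.fderivWithin_tubularMap_one hq]
    change shiftField Text γ j q = _
    conv_lhs => rw [frame_decomposition hX (shiftField Text γ j q)]
    rw [smul_smul, smul_smul, tangentCoeff, normalCoeff, div_mul_div_cancel₀ hJ,
      div_mul_cancel₀ _ hr]
  · rw [hq1, hγ.tubularMap_add hq]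
  · rw [hq1]
    obtain ⟨e0, e1, e2⟩ := add_single_zero ![0, s, τ]
    simp only [tubularWeight, e0, e1, e2, hγ.velocity_add hq]
  · rw [hq1, hγ.tangentCoeff_add hq]
  · rw [tubularWeight, hζ.eq_zero_of_quarter_le hC hq, zero_mul, zero_smul]

end IsRegularFamily
end Periodicity

/-! ### The scaled error height -/

section ErrorHeight

/-- The signed indicator, in tubular coordinates, of the region between the phase `χ` and the
shifted solution, weighted by the cutoff. -/
def tubularError (Text : ℝ) (γ : ℝ → ℝ → Plane) (ζ : ℝ → ℝ) (χ : Plane → ℝ) (z : Plane) (T θ s : ℝ) :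
    ℝ :=
  ((Ioi (0 : ℝ)).indicator (fun _ => (1 : ℝ)) s - χ (z + tubularMap Text γ ![θ, s, T])) * ζ s

/-- The interface error height in units of the radius. -/
def errorHeight (Text : ℝ) (γ : ℝ → ℝ → Plane) (ζ : ℝ → ℝ) (χ : Plane → ℝ) (z : Plane) (T θ : ℝ) :
    ℝ :=
  ∫ s in (-(1 / 4))..(1 / 4), tubularError Text γ ζ χ z T θ s

variable {χ : Plane → ℝ}

theorem tubularError_of_pos (hζ : IsCutoff C ζ) (h01 : ∀ x, χ x ∈ Icc (0 : ℝ) 1) (z : Plane)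
    (T θ : ℝ) {s : ℝ} (hs : 0 < s) : tubularError Text γ ζ χ z T θ s ∈ Icc (0 : ℝ) 1 := by
  have h1 := h01 (z + tubularMap Text γ ![θ, s, T])
  have h2 := hζ.mem_Icc s
  rw [tubularError, indicator_of_mem (mem_Ioi.2 hs)]
  exact ⟨mul_nonneg (by linarith [h1.2]) h2.1,
    mul_le_one₀ (by linarith [h1.1]) h2.1 h2.2⟩

theorem tubularError_of_nonpos (hζ : IsCutoff C ζ) (h01 : ∀ x, χ x ∈ Icc (0 : ℝ) 1) (z : Plane)
    (T θ : ℝ) {s : ℝ} (hs : s ≤ 0) : tubularError Text γ ζ χ z T θ s ∈ Icc (-1 : ℝ) 0 := by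
  have h1 := h01 (z + tubularMap Text γ ![θ, s, T])
  have h2 := hζ.mem_Icc s
  rw [tubularError, indicator_of_notMem (by simpa using hs), zero_sub, neg_mul]
  constructor
  · rw [neg_le_neg_iff]
    exact mul_le_one₀ h1.2 h2.1 h2.2
  · rw [neg_nonpos]
    exact mul_nonneg h1.1 h2.1

theorem abs_tubularError_le (hζ : IsCutoff C ζ) (h01 : ∀ x, χ x ∈ Icc (0 : ℝ) 1) (z : Plane)
    (T θ s : ℝ) : |tubularError Text γ ζ χ z T θ s| ≤ 1 := by
  rw [abs_le]
  rcases lt_or_ge 0 s with hs | hs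
  · have := tubularError_of_pos (Text := Text) (γ := γ) hζ h01 z T θ hs
    exact ⟨by linarith [this.1], this.2⟩
  · have := tubularError_of_nonpos (Text := Text) (γ := γ) hζ h01 z T θ hs
    exact ⟨this.1, by linarith [this.2]⟩

theorem measurable_tubularError (hζ : IsCutoff C ζ) (hχ : Measurable χ) (z : Plane) (T θ : ℝ) :
    Measurable (tubularError Text γ ζ χ z T θ) := by
  have h1 : Measurable fun s : ℝ => (Ioi (0 : ℝ)).indicator (fun _ => (1 : ℝ)) s :=
    measurable_const.indicator measurableSet_Ioi
  have h2 : Continuous fun s : ℝ => z + tubularMap Text γ ![θ, s, T] := by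
    simp only [tubularMap]
    simp
    fun_prop
  exact (h1.sub (hχ.comp h2.measurable)).mul hζ.smooth.continuous.measurable

theorem intervalIntegrable_tubularError (hζ : IsCutoff C ζ) (hχ : Measurable χ)
    (h01 : ∀ x, χ x ∈ Icc (0 : ℝ) 1) (z : Plane) (T θ x y : ℝ) :
    IntervalIntegrable (tubularError Text γ ζ χ z T θ) volume x y :=
  intervalIntegrable_of_norm_le (measurable_tubularError hζ hχ z T θ).aestronglyMeasurable
    (fun s => abs_tubularError_le hζ h01 z T θ s) x y

/-- The integrand is nonnegative for s > 0 and nonpositive for s ≤ 0. The two halves therefore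
partly cancel, and the bound is the size of one half, 1/(8C), not the sum of both. -/
theorem abs_errorHeight_le (hζ : IsCutoff C ζ) (hC : 1 ≤ C) (hχ : Measurable χ)
    (h01 : ∀ x, χ x ∈ Icc (0 : ℝ) 1) (z : Plane) (T θ : ℝ) :
    |errorHeight Text γ ζ χ z T θ| ≤ 1 / (8 * C) := by
  have hint := intervalIntegrable_tubularError (Text := Text) (γ := γ) hζ hχ h01 z T θ
  set f := tubularError Text γ ζ χ z T θ with hf
  set w : ℝ := 1 / (8 * C) with hw
  have hw0 : 0 < w := by positivity
  have hw4 : w ≤ 1 / 4 := by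
    rw [hw, div_le_div_iff₀ (by linarith) (by norm_num)]
    linarith
  have hz : ∀ s, w < |s| → f s = 0 := fun s hs => by
    rw [hf, tubularError, hζ.eq_zero s hs, mul_zero]
  have hsplit : errorHeight Text γ ζ χ z T θ =
      (∫ s in (-w)..0, f s) + ∫ s in (0 : ℝ)..w, f s := by
    have h1 : ∫ s in (-(1 / 4))..(-w), f s = 0 := by
      rw [← intervalIntegral.integral_zero (a := -(1 / 4)) (b := -w)]
      refine intervalIntegral.integral_congr_Ioo_of_le (by linarith) fun s hs => hz s ?_
      rw [lt_abs]; right; linarith [hs.2]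
    have h2 : ∫ s in w..(1 / 4), f s = 0 := by
      rw [← intervalIntegral.integral_zero (a := w) (b := 1 / 4)]
      refine intervalIntegral.integral_congr_Ioo_of_le (by linarith) fun s hs => hz s ?_
      rw [lt_abs]; left; linarith [hs.1]
    rw [errorHeight, ← hf, ← intervalIntegral.integral_add_adjacent_intervals (hint _ (-w)) (hint _ _),
      ← intervalIntegral.integral_add_adjacent_intervals (hint (-w) 0) (hint _ _),
      ← intervalIntegral.integral_add_adjacent_intervals (hint 0 w) (hint _ _), h1, h2]
    ring
  have hpos : 0 ≤ ∫ s in (0 : ℝ)..w, f s := by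
    refine intervalIntegral.integral_nonneg_of_ae_restrict hw0.le ?_
    filter_upwards [ae_restrict_mem measurableSet_Icc,
      ae_restrict_of_ae (Measure.ae_ne volume (0 : ℝ))] with s hs hs0
    exact (tubularError_of_pos hζ h01 z T θ (lt_of_le_of_ne hs.1 hs0.symm)).1
  have hneg : ∫ s in (-w)..0, f s ≤ 0 := by
    have h1 : 0 ≤ ∫ s in (-w)..0, -f s := intervalIntegral.integral_nonneg (by linarith) fun s hs =>
      neg_nonneg.2 (tubularError_of_nonpos hζ h01 z T θ hs.2).2
    rw [intervalIntegral.integral_neg] at h1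
    linarith
  have hb : ∀ x y, |∫ s in x..y, f s| ≤ 1 * |y - x| := fun x y =>
    intervalIntegral.norm_integral_le_of_norm_le_const (f := f) fun s _ =>
      abs_tubularError_le hζ h01 z T θ s
  have hb1 := hb 0 w
  have hb2 := hb (-w) 0
  rw [sub_zero, abs_of_pos hw0, abs_of_nonneg hpos] at hb1
  rw [sub_neg_eq_add, zero_add, abs_of_pos hw0, abs_of_nonpos hneg] at hb2
  rw [hsplit, abs_le]
  constructor <;> linarith

end ErrorHeight

/-! ### The shift velocity as an integral over the box -/

section Field

/-- Length of the evolving curve. -/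
def curveLength (γ : ℝ → ℝ → Plane) (T : ℝ) : ℝ := ∫ θ in Icc (0 : ℝ) 1, ‖velocity γ θ T‖

/-- The velocity of the space-time shift in tubular coordinates. -/
def shiftVelocity (Text : ℝ) (γ : ℝ → ℝ → Plane) (ζ : ℝ → ℝ) (χ : Plane → ℝ) (z : Plane) (T : ℝ) :
    Plane × ℝ :=
  (curveLength γ T)⁻¹ • ∫ x in paramBox,
    ((Ioi (0 : ℝ)).indicator (fun _ => (1 : ℝ)) (x 1) -
      χ (z + tubularMap Text γ ![x 0, x 1, T])) • tubularWeight Text γ ζ ![x 0, x 1, T]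

theorem integral_paramBox {E : Type*} [NormedAddCommGroup E] [NormedSpace ℝ E] {f : ℝ → ℝ → E}
    (hf : IntegrableOn (fun x : Fin 2 → ℝ => f (x 0) (x 1)) paramBox) :
    ∫ x in paramBox, f (x 0) (x 1) =
      ∫ θ in Icc (0 : ℝ) 1, ∫ s in Icc (-(1 / 4) : ℝ) (1 / 4), f θ s := by
  have hmp := volume_preserving_finTwoArrow ℝ
  have hpre : (MeasurableEquiv.finTwoArrow (α := ℝ)) ⁻¹' (Icc (0 : ℝ) 1 ×ˢ Icc (-(1 / 4) : ℝ) (1 / 4)) =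
      paramBox := by
    ext x
    rw [mem_paramBox]
    rfl
  have h1 : ∫ x in paramBox, f (x 0) (x 1) =
      ∫ p in Icc (0 : ℝ) 1 ×ˢ Icc (-(1 / 4) : ℝ) (1 / 4), f p.1 p.2 := by
    rw [← hpre]
    exact hmp.setIntegral_preimage_emb (MeasurableEquiv.measurableEmbedding _)
      (fun p : ℝ × ℝ => f p.1 p.2) _
  have h2 : IntegrableOn (fun p : ℝ × ℝ => f p.1 p.2)
      (Icc (0 : ℝ) 1 ×ˢ Icc (-(1 / 4) : ℝ) (1 / 4)) := by
    rw [← hmp.integrableOn_comp_preimage (MeasurableEquiv.measurableEmbedding _), hpre]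
    exact hf
  rw [h1, Measure.volume_eq_prod, setIntegral_prod _ h2]

variable {χ : Plane → ℝ}

theorem abs_indicator_sub_le (h01 : ∀ x, χ x ∈ Icc (0 : ℝ) 1) (s : ℝ) (y : Plane) :
    |(Ioi (0 : ℝ)).indicator (fun _ => (1 : ℝ)) s - χ y| ≤ 1 := by
  have := h01 y
  rw [abs_le]
  by_cases hs : s ∈ Ioi (0 : ℝ)
  · rw [indicator_of_mem hs]; constructor <;> linarith [this.1, this.2]
  · rw [indicator_of_notMem hs]; constructor <;> linarith [this.1, this.2]

namespace IsRegularFamily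

theorem continuous_speed (hγ : IsRegularFamily Text γ) {T : ℝ} (hT : T ∈ Ico 0 Text) :
    Continuous fun θ => ‖velocity γ θ T‖ :=
  (contDiff_slice_curve (contDiffOn_velocity hγ.smooth) hT).continuous.norm

theorem curveLength_pos (hγ : IsRegularFamily Text γ) {T : ℝ} (hT : T ∈ Ico 0 Text) :
    0 < curveLength γ T := by
  rw [curveLength, integral_Icc_eq_integral_Ioc, ← intervalIntegral.integral_of_le zero_le_one]
  exact intervalIntegral.intervalIntegral_pos_of_pos
    ((hγ.continuous_speed hT).intervalIntegrable _ _)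
    (fun θ => norm_pos_iff.2 (hγ.regular T hT θ)) one_pos

theorem integrableOn_error (hγ : IsRegularFamily Text γ) (hζ : IsCutoff C ζ) (hC : 1 ≤ C)
    (hχ : Measurable χ) (h01 : ∀ x, χ x ∈ Icc (0 : ℝ) 1) (z : Plane) {T : ℝ}
    (hT : T ∈ Ico 0 Text) :
    IntegrableOn (fun x : Fin 2 → ℝ => ((Ioi (0 : ℝ)).indicator (fun _ => (1 : ℝ)) (x 1) -
      χ (z + tubularMap Text γ ![x 0, x 1, T])) • tubularWeight Text γ ζ ![x 0, x 1, T]) paramBox := by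
  obtain ⟨hΦc, hgc⟩ := (hγ.isTransport hζ hC).continuousOn_slice hT
  refine Integrable.mono (g := fun x : Fin 2 → ℝ => tubularWeight Text γ ζ ![x 0, x 1, T])
    (hgc.integrableOn_compact isCompact_paramBox) (AEStronglyMeasurable.fun_smul ?_
      (hgc.aestronglyMeasurable_of_isCompact isCompact_paramBox measurableSet_paramBox)) ?_
  · have h1 : AEMeasurable (fun x : Fin 2 → ℝ => z + tubularMap Text γ ![x 0, x 1, T])
      (volume.restrict paramBox) := (continuousOn_const.add hΦc).aemeasurable measurableSet_paramBox
    refine AEMeasurable.aestronglyMeasurable (AEMeasurable.sub ?_ (hχ.comp_aemeasurable h1))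
    exact ((measurable_const.indicator measurableSet_Ioi).comp (measurable_pi_apply 1)).aemeasurable
  · refine Eventually.of_forall fun x => ?_
    rw [norm_smul, Real.norm_eq_abs]
    exact mul_le_of_le_one_left (norm_nonneg _) (abs_indicator_sub_le h01 _ _)

/-- The velocity of the shift as an average along the curve of the error height. -/
theorem shiftVelocity_eq (hγ : IsRegularFamily Text γ) (hζ : IsCutoff C ζ) (hC : 1 ≤ C)
    (hχ : Measurable χ) (h01 : ∀ x, χ x ∈ Icc (0 : ℝ) 1) (z : Plane) {T : ℝ}
    (hT : T ∈ Ico 0 Text) :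
    shiftVelocity Text γ ζ χ z T = (curveLength γ T)⁻¹ • ∫ θ in Icc (0 : ℝ) 1,
      (‖velocity γ θ T‖ * errorHeight Text γ ζ χ z T θ) •
        ((6 / radius Text T) • unitNormal (velocity γ θ T), (4 : ℝ)) := by
  rw [shiftVelocity]
  congr 1
  refine (integral_paramBox (f := fun θ s => ((Ioi (0 : ℝ)).indicator (fun _ => (1 : ℝ)) s -
      χ (z + tubularMap Text γ ![θ, s, T])) • tubularWeight Text γ ζ ![θ, s, T])
      (hγ.integrableOn_error hζ hC hχ h01 z hT)).trans ?_
  refine integral_congr_ae (Eventually.of_forall fun θ => ?_)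
  simp only
  rw [errorHeight, intervalIntegral.integral_of_le (by norm_num), ← integral_Icc_eq_integral_Ioc,
    mul_comm, mul_smul, ← integral_smul_const]
  refine integral_congr_ae (Eventually.of_forall fun s => ?_)
  simp only [tubularWeight, tubularError]
  simp [smul_smul, mul_assoc]

end IsRegularFamily
end Field
end SpaceTimeShift
end

/-! ### Carathéodory conditions for the shift velocity -/

noncomputable section
open scoped NNReal

namespace SpaceTimeShift

variable {Text C : ℝ} {γ : ℝ → ℝ → Plane} {ζ : ℝ → ℝ} {χ : Plane → ℝ}

/-- A bounded multiple of the speed has an average along the curve with the same bound. -/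
theorem norm_average_speed_le {V : Type*} [NormedAddCommGroup V] [NormedSpace ℝ V] {T B : ℝ}
    (hc : Continuous fun θ => ‖velocity γ θ T‖) (hl : 0 < curveLength γ T) {f : ℝ → V}
    (hf : ∀ θ, ‖f θ‖ ≤ ‖velocity γ θ T‖ * B) :
    ‖(curveLength γ T)⁻¹ • ∫ θ in Icc (0 : ℝ) 1, f θ‖ ≤ B := by
  have h1 : ‖∫ θ in Icc (0 : ℝ) 1, f θ‖ ≤ ∫ θ in Icc (0 : ℝ) 1, ‖velocity γ θ T‖ * B :=
    norm_integral_le_of_norm_le ((hc.mul continuous_const).integrableOn_Icc)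
      (Eventually.of_forall hf)
  rw [integral_mul_const] at h1
  rw [norm_smul, norm_inv, Real.norm_of_nonneg hl.le, inv_mul_le_iff₀ hl]
  exact h1

namespace IsRegularFamily

/-- Averages do not exceed the sup: the factors 6/r and 4 multiply the error height bound 1/(8C),
and 6/8 ≤ 1. -/
theorem shiftVelocity_bound (hγ : IsRegularFamily Text γ) (hζ : IsCutoff C ζ) (hC : 1 ≤ C)
    (hχ : Measurable χ) (h01 : ∀ x, χ x ∈ Icc (0 : ℝ) 1) (z : Plane) {T : ℝ}
    (hT : T ∈ Ico 0 Text) :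
    ‖(shiftVelocity Text γ ζ χ z T).1‖ ≤ 1 / C * (1 / radius Text T) ∧
      |(shiftVelocity Text γ ζ χ z T).2| ≤ 1 / (2 * C) := by
  have hr := radius_pos hT.2
  have hl := hγ.curveLength_pos hT
  have hc := hγ.continuous_speed hT
  have hC0 : 0 < C := by linarith
  rw [hγ.shiftVelocity_eq hζ hC hχ h01 z hT]
  set f : ℝ → Plane × ℝ := fun θ => (‖velocity γ θ T‖ * errorHeight Text γ ζ χ z T θ) •
        ((6 / radius Text T) • unitNormal (velocity γ θ T), (4 : ℝ)) with hf
  have hE := fun θ => abs_errorHeight_le (Text := Text) (γ := γ) hζ hC hχ h01 z T θ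
  -- Taking components of the integral requires integrability; otherwise the integral is 0 by
  -- default and the bounds are trivial.
  by_cases hint : IntegrableOn f (Icc 0 1)
  · rw [Prod.smul_fst, Prod.smul_snd, fst_integral hint, snd_integral hint]
    constructor
    · refine norm_average_speed_le hc hl fun θ => ?_
      simp only [hf, Prod.smul_fst]
      rw [norm_smul, norm_smul, norm_unitNormal (hγ.regular T hT θ), mul_one, norm_mul, norm_norm,
        mul_assoc, Real.norm_eq_abs, Real.norm_of_nonneg (by positivity)]
      refine mul_le_mul_of_nonneg_left ?_ (norm_nonneg _)
      calc _ ≤ 1 / (8 * C) * (6 / radius Text T) :=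
            mul_le_mul_of_nonneg_right (hE θ) (by positivity)
        _ = 6 / 8 * (1 / C * (1 / radius Text T)) := by field_simp
        _ ≤ 1 * (1 / C * (1 / radius Text T)) :=
            mul_le_mul_of_nonneg_right (by norm_num) (by positivity)
        _ = _ := one_mul _
    · rw [← Real.norm_eq_abs]
      refine norm_average_speed_le hc hl fun θ => ?_
      simp only [hf, Prod.smul_snd, smul_eq_mul]
      rw [norm_mul, norm_mul, norm_norm, mul_assoc, Real.norm_eq_abs (errorHeight _ _ _ _ _ _ _)]
      refine mul_le_mul_of_nonneg_left ?_ (norm_nonneg _)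
      calc _ ≤ 1 / (8 * C) * ‖(4 : ℝ)‖ :=
            mul_le_mul_of_nonneg_right (hE θ) (norm_nonneg _)
        _ = 1 / (2 * C) := by
            norm_num
            field_simp
            norm_num
  · rw [integral_undef hint]
    simp
    constructor <;> positivity

theorem exists_lipschitz_curveLength (hγ : IsRegularFamily Text γ) {c : ℝ} (hc : c ∈ Ico 0 Text) :
    ∃ K m : ℝ, 0 ≤ K ∧ 0 < m ∧ (∀ T ∈ Icc 0 c, m ≤ curveLength γ T) ∧
      ∀ T ∈ Icc 0 c, ∀ T' ∈ Icc 0 c, |curveLength γ T - curveLength γ T'| ≤ K * |T - T'| := by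
  have hmem : ∀ T ∈ Icc 0 c, T ∈ Ico 0 Text := fun T hT => ⟨hT.1, hT.2.trans_lt hc.2⟩
  have hsub : Icc (0 : ℝ) 1 ×ˢ Icc 0 c ⊆ curveDomain Text := fun p hp =>
    ⟨mem_univ _, hmem _ hp.2⟩
  have hcomp : IsCompact (Icc (0 : ℝ) 1 ×ˢ Icc 0 c) := isCompact_Icc.prod isCompact_Icc
  have hX := (contDiffOn_velocity hγ.smooth).mono hsub
  obtain ⟨K, hK⟩ := (hX.of_le (m := 1) (by simp)).exists_lipschitzOnWith one_ne_zero
    ((convex_Icc (0 : ℝ) 1).prod (convex_Icc 0 c)) hcomp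
  have hlip : ∀ T ∈ Icc 0 c, ∀ T' ∈ Icc 0 c,
      |curveLength γ T - curveLength γ T'| ≤ K * |T - T'| := fun T hT T' hT' => by
    rw [curveLength, curveLength, ← integral_sub
      (hγ.continuous_speed (hmem T hT)).integrableOn_Icc
      (hγ.continuous_speed (hmem T' hT')).integrableOn_Icc]
    refine (norm_setIntegral_le_of_norm_le_const (μ := volume) (s := Icc (0 : ℝ) 1)
      (f := fun θ => ‖velocity γ θ T‖ - ‖velocity γ θ T'‖) (C := K * |T - T'|)
      isCompact_Icc.measure_lt_top fun θ hθ => ?_).trans (by simp)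
    refine (abs_norm_sub_norm_le _ _).trans ?_
    rw [← dist_eq_norm]
    refine (hK.dist_le_mul (θ, T) ⟨hθ, hT⟩ (θ, T') ⟨hθ, hT'⟩).trans (le_of_eq ?_)
    rw [Prod.dist_eq, dist_self, max_eq_right dist_nonneg, Real.dist_eq]
  have hcont : ContinuousOn (curveLength γ) (Icc 0 c) := by
    refine (LipschitzOnWith.of_dist_le_mul (K := K) fun T hT T' hT' => ?_).continuousOn
    rw [Real.dist_eq, Real.dist_eq]
    exact hlip T hT T' hT'
  obtain ⟨T₀, hT₀, hmin⟩ := isCompact_Icc.exists_isMinOn ⟨0, le_rfl, hc.1⟩ hcont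
  exact ⟨K, curveLength γ T₀, K.2, hγ.curveLength_pos (hmem _ hT₀), fun T hT => hmin hT, hlip⟩

/-- In tubular coordinates the shifted phase is the fixed set s > 0. Only the smooth weight depends
on T, and no integration by parts is needed. -/
theorem exists_lipschitz_phase (hγ : IsRegularFamily Text γ) (hζ : IsCutoff C ζ) {c : ℝ}
    (hc : c ∈ Ico 0 Text) :
    ∃ K B : ℝ, 0 ≤ K ∧ 0 ≤ B ∧
      (∀ T ∈ Icc 0 c, ∀ x ∈ paramBox, ‖tubularWeight Text γ ζ ![x 0, x 1, T]‖ ≤ B) ∧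
      ∀ T ∈ Icc 0 c, ∀ T' ∈ Icc 0 c,
        ‖(∫ x in paramBox, (Ioi (0 : ℝ)).indicator (fun _ => (1 : ℝ)) (x 1) •
            tubularWeight Text γ ζ ![x 0, x 1, T]) -
          ∫ x in paramBox, (Ioi (0 : ℝ)).indicator (fun _ => (1 : ℝ)) (x 1) •
            tubularWeight Text γ ζ ![x 0, x 1, T']‖ ≤ K * |T - T'| := by
  set Q : Set (Fin 3 → ℝ) := Icc ![0, -(1 / 4), 0] ![1, 1 / 4, c] with hQ
  have hmemQ : ∀ T ∈ Icc 0 c, ∀ x ∈ paramBox, (![x 0, x 1, T] : Fin 3 → ℝ) ∈ Q := fun T hT x hx => by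
    obtain ⟨h0, h1⟩ := mem_paramBox.1 hx
    constructor
    · intro i; fin_cases i
      exacts [h0.1, h1.1, hT.1]
    · intro i; fin_cases i
      exacts [h0.2, h1.2, hT.2]
  have hsub : Q ⊆ paramDomain Text := fun q hq => by
    have h1 := hq.1 1
    have h2 := hq.2 1
    have h3 := hq.1 2
    have h4 := hq.2 2
    simp at h1 h2 h3 h4
    exact ⟨⟨by linarith, by linarith⟩, h3, h4.trans_lt hc.2⟩
  have hg := (hγ.contDiffOn_tubularWeight hζ.smooth).mono hsub
  obtain ⟨K, hK⟩ := (hg.of_le (m := 1) (by simp)).exists_lipschitzOnWith one_ne_zero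
    (convex_Icc _ _) isCompact_Icc
  obtain ⟨B, hB⟩ := isCompact_Icc.exists_bound_of_continuousOn hg.continuousOn
  have hind : ∀ s : ℝ, |(Ioi (0 : ℝ)).indicator (fun _ => (1 : ℝ)) s| ≤ 1 := fun s => by
    by_cases hs : s ∈ Ioi (0 : ℝ)
    · rw [indicator_of_mem hs]; simp
    · rw [indicator_of_notMem hs]; simp
  have hcont : ∀ T ∈ Icc 0 c, ContinuousOn
      (fun x : Fin 2 → ℝ => tubularWeight Text γ ζ ![x 0, x 1, T]) paramBox := fun T hT =>
    hg.continuousOn.comp (contDiff_slice T).continuous.continuousOn (hmemQ T hT)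
  have hint : ∀ T ∈ Icc 0 c, IntegrableOn (fun x : Fin 2 → ℝ =>
      (Ioi (0 : ℝ)).indicator (fun _ => (1 : ℝ)) (x 1) • tubularWeight Text γ ζ ![x 0, x 1, T])
      paramBox := fun T hT => by
    refine Integrable.mono ((hcont T hT).integrableOn_compact isCompact_paramBox)
      (AEStronglyMeasurable.fun_smul ?_ ((hcont T hT).aestronglyMeasurable_of_isCompact
        isCompact_paramBox measurableSet_paramBox)) (Eventually.of_forall fun x => ?_)
    · exact ((measurable_const.indicator measurableSet_Ioi).comp
        (measurable_pi_apply 1)).aestronglyMeasurable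
    · rw [norm_smul, Real.norm_eq_abs]
      exact mul_le_of_le_one_left (norm_nonneg _) (hind _)
  refine ⟨K, max B 0, K.2, le_max_right _ _, fun T hT x hx =>
    (hB _ (hmemQ T hT x hx)).trans (le_max_left _ _), fun T hT T' hT' => ?_⟩
  rw [← integral_sub (hint T hT) (hint T' hT')]
  refine (norm_setIntegral_le_of_norm_le_const (C := K * |T - T'|) volume_paramBox_lt_top
    fun x hx => ?_).trans ?_
  · rw [← smul_sub, norm_smul, Real.norm_eq_abs, ← dist_eq_norm]
    refine (mul_le_of_le_one_left dist_nonneg (hind _)).trans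
      ((hK.dist_le_mul _ (hmemQ T hT x hx) _ (hmemQ T' hT' x hx)).trans ?_)
    gcongr
    rw [dist_pi_le_iff (abs_nonneg _)]
    intro i
    fin_cases i <;> simp [Real.dist_eq]
  · rw [volume_real_paramBox]
    have : 0 ≤ K * |T - T'| := by positivity
    linarith

/-- Product rule for 1/length times the integral. The length is bounded below on [0, c]; the
integral splits into the fixed half-plane part and the transport integral of χ. -/
theorem exists_lipschitz_shiftVelocity (hγ : IsRegularFamily Text γ) (hζ : IsCutoff C ζ)
    (hC : 1 ≤ C) {c : ℝ} (hc : c ∈ Ico 0 Text) :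
    ∃ K : ℝ≥0, ∀ χ : Plane → ℝ, Measurable χ → (∀ x, χ x ∈ Icc (0 : ℝ) 1) → ∀ z z' : Plane,
      ∀ T ∈ Icc 0 c, ∀ T' ∈ Icc 0 c,
        dist (shiftVelocity Text γ ζ χ z T) (shiftVelocity Text γ ζ χ z' T') ≤
          K * dist (z, T) (z', T') := by
  obtain ⟨K₁, m, hK₁, hm, hlow, hlip₁⟩ := hγ.exists_lipschitz_curveLength hc
  obtain ⟨K₂, B, hK₂, hB0, hB, hlip₂⟩ := hγ.exists_lipschitz_phase hζ hc
  obtain ⟨K₃, hlip₃⟩ := (hγ.isTransport hζ hC).exists_lipschitz hc.2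
  refine ⟨⟨m⁻¹ * (K₂ + K₃) + K₁ / (m * m) * B, by positivity⟩,
    fun χ hχ h01 z z' T hT T' hT' => ?_⟩
  have hmem : ∀ T ∈ Icc 0 c, T ∈ Ico 0 Text := fun T hT => ⟨hT.1, hT.2.trans_lt hc.2⟩
  have hχ1 : ∀ x, |χ x| ≤ 1 := fun x => abs_le.2 ⟨by linarith [(h01 x).1], (h01 x).2⟩
  set d := dist (z, T) (z', T') with hd
  have hTd : |T - T'| ≤ d := by
    rw [hd, Prod.dist_eq, ← Real.dist_eq]; exact le_max_right _ _
  let n : Plane → ℝ → Plane × ℝ := fun z T => ∫ x in paramBox,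
    ((Ioi (0 : ℝ)).indicator (fun _ => (1 : ℝ)) (x 1) -
      χ (z + tubularMap Text γ ![x 0, x 1, T])) • tubularWeight Text γ ζ ![x 0, x 1, T]
  have hsplit : ∀ z, ∀ T ∈ Icc 0 c, n z T =
      (∫ x in paramBox, (Ioi (0 : ℝ)).indicator (fun _ => (1 : ℝ)) (x 1) •
        tubularWeight Text γ ζ ![x 0, x 1, T]) -
      transportIntegral (tubularMap Text γ) (tubularWeight Text γ ζ) χ z T := fun z T hT => by
    have h1 := hγ.integrableOn_error hζ hC hχ h01 z (hmem T hT)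
    have h2 := hγ.integrableOn_error hζ hC (χ := fun _ => 0) measurable_const
      (fun _ => ⟨le_rfl, zero_le_one⟩) z (hmem T hT)
    simp only [sub_zero] at h2
    have h3 := h2.sub h1
    rw [transportIntegral, ← integral_sub h2]
    · refine integral_congr_ae (Eventually.of_forall fun x => ?_)
      simp only [sub_smul]
    · refine h3.congr (Eventually.of_forall fun x => ?_)
      simp only [Pi.sub_apply, sub_smul, sub_sub_cancel]
  have hnl : ‖n z T - n z' T'‖ ≤ (K₂ + K₃) * d := by
    rw [hsplit z T hT, hsplit z' T' hT', sub_sub_sub_comm]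
    refine (norm_sub_le _ _).trans ?_
    rw [add_mul]
    refine add_le_add ((hlip₂ T hT T' hT').trans (by gcongr)) ?_
    rw [← dist_eq_norm]
    exact hlip₃ χ hχ hχ1 z z' T hT T' hT'
  have hnB : ‖n z' T'‖ ≤ B := by
    refine (norm_setIntegral_le_of_norm_le_const (C := B) volume_paramBox_lt_top
      fun x hx => ?_).trans ?_
    · rw [norm_smul, Real.norm_eq_abs]
      exact (mul_le_of_le_one_left (norm_nonneg _) (abs_indicator_sub_le h01 _ _)).trans
        (hB T' hT' x hx)
    · rw [volume_real_paramBox]; linarith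
  have hl := hlow T hT
  have hl' := hlow T' hT'
  have hl0 := hm.trans_le hl
  have hl0' := hm.trans_le hl'
  have hinv : |(curveLength γ T)⁻¹ - (curveLength γ T')⁻¹| ≤ K₁ / (m * m) * d := by
    rw [inv_sub_inv hl0.ne' hl0'.ne', abs_div, abs_sub_comm, abs_of_pos (mul_pos hl0 hl0'),
      div_mul_eq_mul_div]
    gcongr
    exact (hlip₁ T hT T' hT').trans (by gcongr)
  change dist ((curveLength γ T)⁻¹ • n z T) ((curveLength γ T')⁻¹ • n z' T') ≤
    (m⁻¹ * (K₂ + K₃) + K₁ / (m * m) * B) * d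
  have hdec : (curveLength γ T)⁻¹ • n z T - (curveLength γ T')⁻¹ • n z' T' =
      (curveLength γ T)⁻¹ • (n z T - n z' T') +
      ((curveLength γ T)⁻¹ - (curveLength γ T')⁻¹) • n z' T' := by module
  rw [dist_eq_norm, hdec]
  refine (norm_add_le _ _).trans ?_
  rw [norm_smul, norm_smul, Real.norm_eq_abs, Real.norm_eq_abs, abs_of_pos (inv_pos.2 hl0)]
  calc _ ≤ m⁻¹ * ((K₂ + K₃) * d) + K₁ / (m * m) * d * B := by gcongr
    _ = _ := by ring

/-- The integrand is jointly measurable in time and box variables, by joint measurability of χ and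
continuity of the curve; integrating out the box keeps measurability in time. -/
theorem aestronglyMeasurable_shiftVelocity (hγ : IsRegularFamily Text γ) (hζ : IsCutoff C ζ)
    {χ : Plane → ℝ → ℝ} (hχ : Measurable fun p : Plane × ℝ => χ p.1 p.2) {c : ℝ}
    (hc : c ∈ Ico 0 Text) {u : ℝ → Plane × ℝ} (hu : Continuous u) :
    AEStronglyMeasurable (fun t => shiftVelocity Text γ ζ (fun x => χ x t) (u t).1
      (max 0 (min (u t).2 c))) volume := by
  set τ : ℝ → ℝ := fun t => max 0 (min (u t).2 c) with hτ
  have hτc : Continuous τ := by fun_prop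
  have hτm : ∀ t, τ t ∈ Icc 0 c := fun t => clamp_mem hc.1 _
  obtain ⟨K, m, hK, hm, hlow, hlip⟩ := hγ.exists_lipschitz_curveLength hc
  have hlen : Continuous fun t => (curveLength γ (τ t))⁻¹ := by
    have h1 : ContinuousOn (curveLength γ) (Icc 0 c) := by
      refine (LipschitzOnWith.of_dist_le_mul (K := ⟨K, hK⟩) fun T hT T' hT' => ?_).continuousOn
      rw [Real.dist_eq, Real.dist_eq]
      exact hlip T hT T' hT'
    exact (h1.comp_continuous hτc hτm).inv₀ fun t => (hm.trans_le (hlow _ (hτm t))).ne'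
  refine hlen.aestronglyMeasurable.smul ?_
  set μ : Measure (ℝ × (Fin 2 → ℝ)) := (volume : Measure ℝ).prod (volume.restrict paramBox) with hμ
  have hμr : μ = ((volume : Measure ℝ).prod volume).restrict (univ ×ˢ paramBox) := by
    rw [hμ, ← Measure.prod_restrict, Measure.restrict_univ]
  have hms : MeasurableSet ((univ : Set ℝ) ×ˢ paramBox) := MeasurableSet.univ.prod measurableSet_paramBox
  have hpath : ContinuousOn (fun p : ℝ × (Fin 2 → ℝ) => (![p.2 0, p.2 1, τ p.1] : Fin 3 → ℝ))
      (univ ×ˢ paramBox) := by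
    refine Continuous.continuousOn (continuous_pi fun i => ?_)
    fin_cases i
    · change Continuous fun p : ℝ × (Fin 2 → ℝ) => p.2 0
      fun_prop
    · change Continuous fun p : ℝ × (Fin 2 → ℝ) => p.2 1
      fun_prop
    · exact hτc.comp continuous_fst
  have hmaps : MapsTo (fun p : ℝ × (Fin 2 → ℝ) => (![p.2 0, p.2 1, τ p.1] : Fin 3 → ℝ))
      (univ ×ˢ paramBox) (paramDomain Text) := fun p hp =>
    ⟨paramBox_subset_strip hp.2, (hτm p.1).1, (hτm p.1).2.trans_lt hc.2⟩
  have hΦ : AEMeasurable (fun p : ℝ × (Fin 2 → ℝ) =>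
      tubularMap Text γ ![p.2 0, p.2 1, τ p.1]) μ := by
    rw [hμr]
    exact (hγ.contDiffOn_tubularMap.continuousOn.comp hpath hmaps).aemeasurable hms
  have hg : AEMeasurable (fun p : ℝ × (Fin 2 → ℝ) =>
      tubularWeight Text γ ζ ![p.2 0, p.2 1, τ p.1]) μ := by
    rw [hμr]
    exact ((hγ.contDiffOn_tubularWeight hζ.smooth).continuousOn.comp hpath hmaps).aemeasurable hms
  have hind : Measurable fun p : ℝ × (Fin 2 → ℝ) =>
      (Ioi (0 : ℝ)).indicator (fun _ => (1 : ℝ)) (p.2 1) :=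
    (measurable_const.indicator measurableSet_Ioi).comp
      ((measurable_pi_apply 1).comp measurable_snd)
  have hz : AEMeasurable (fun p : ℝ × (Fin 2 → ℝ) =>
      ((u p.1).1 + tubularMap Text γ ![p.2 0, p.2 1, τ p.1], p.1)) μ :=
    (((hu.fst.measurable.comp measurable_fst).aemeasurable).add hΦ).prodMk
      measurable_fst.aemeasurable
  have hall : AEStronglyMeasurable (fun p : ℝ × (Fin 2 → ℝ) =>
      ((Ioi (0 : ℝ)).indicator (fun _ => (1 : ℝ)) (p.2 1) -
      χ ((u p.1).1 + tubularMap Text γ ![p.2 0, p.2 1, τ p.1]) p.1) •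
        tubularWeight Text γ ζ ![p.2 0, p.2 1, τ p.1]) μ :=
    ((hind.aemeasurable.sub (hχ.comp_aemeasurable hz)).smul hg).aestronglyMeasurable
  exact hall.integral_prod_right'

/-- The velocity of the space-time shift satisfies the Carathéodory conditions. -/
theorem isTimeChangeField (hγ : IsRegularFamily Text γ) (hζ : IsCutoff C ζ) (hC : 1 ≤ C)
    {χ : Plane → ℝ → ℝ} (hχ : Measurable fun p : Plane × ℝ => χ p.1 p.2)
    (h01 : ∀ x t, χ x t ∈ Icc (0 : ℝ) 1) :
    IsTimeChangeField Text fun t z T => shiftVelocity Text γ ζ (fun x => χ x t) z T := by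
  have hχt : ∀ t, Measurable fun x => χ x t := fun t => hχ.comp (measurable_id.prodMk measurable_const)
  refine ⟨fun t z T hT => ?_, fun c hc => ⟨1 / radius Text c, fun t z T hT => ?_⟩, fun c hc => ?_,
    fun c hc u hu => hγ.aestronglyMeasurable_shiftVelocity hζ hχ hc hu⟩
  · refine (hγ.shiftVelocity_bound hζ hC (hχt t) (fun x => h01 x t) z hT).2.trans ?_
    gcongr
    linarith
  · have hr := radius_pos hc.2
    have hrT : radius Text c ≤ radius Text T := Real.sqrt_le_sqrt (by linarith [hT.2])
    refine (hγ.shiftVelocity_bound hζ hC (hχt t) (fun x => h01 x t) z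
      ⟨hT.1, hT.2.trans_lt hc.2⟩).1.trans ?_
    calc _ ≤ 1 * (1 / radius Text c) := by
          have h1 : 1 / C ≤ 1 := by rw [div_le_one (by linarith)]; exact hC
          have h2 : 1 / radius Text T ≤ 1 / radius Text c := one_div_le_one_div_of_le hr hrT
          have h3 : 0 ≤ 1 / radius Text T := one_div_nonneg.2 (hr.le.trans hrT)
          exact mul_le_mul h1 h2 h3 zero_le_one
      _ = _ := one_mul _
  · obtain ⟨K, hK⟩ := hγ.exists_lipschitz_shiftVelocity hζ hC hc
    exact ⟨K, fun t z z' T hT T' hT' => hK _ (hχt t) (fun x => h01 x t) z z' T hT T' hT'⟩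

end IsRegularFamily
end SpaceTimeShift
end

/-! ### Identification with the geometric equations -/

noncomputable section

namespace SpaceTimeShift

/-- The average of a function over a simple closed curve with respect to length. -/
theorem setAverage_image_curve {γ : ℝ → Plane} (hγ : ContDiff ℝ 1 γ) (hinj : InjOn γ (Ico 0 1))
    {G : Type*} [NormedAddCommGroup G] [NormedSpace ℝ G] [CompleteSpace G] (f : Plane → G) :
    ⨍ x in γ '' Ico 0 1, f x ∂μH[1] =
      (∫ θ in Icc (0 : ℝ) 1, ‖deriv γ θ‖)⁻¹ • ∫ θ in Icc (0 : ℝ) 1, ‖deriv γ θ‖ • f (γ θ) := by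
  have h1 := setIntegral_image_curve hγ hinj fun _ => (1 : ℝ)
  rw [setIntegral_const] at h1
  simp only [smul_eq_mul, mul_one] at h1
  rw [setAverage_eq, setIntegral_image_curve hγ hinj, h1, integral_Icc_eq_integral_Ico,
    integral_Icc_eq_integral_Ico]

variable {Text C δ : ℝ} {γ : ℝ → ℝ → Plane} {ζ : ℝ → ℝ} {A : ℝ → Set Plane}

/-- The curves `γ(·, t)` are simple parametrizations of the boundaries of `A t` whose left normal is
the inner normal. -/
def IsBoundaryFamily (Text : ℝ) (A : ℝ → Set Plane) (γ : ℝ → ℝ → Plane) : Prop :=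
  ∀ t ∈ Ico 0 Text, InjOn (fun θ => γ θ t) (Ico 0 1) ∧
    (fun θ => γ θ t) '' Ico 0 1 = frontier (A t) ∧
    ∀ θ, innerNormal (A t) (γ θ t) = unitNormal (velocity γ θ t)

theorem IsNearlyCircularMCF.isTubularWidth (hA : IsNearlyCircularMCF δ Text A) {t : ℝ}
    (ht : t ∈ Ioo 0 Text) : IsTubularWidth (A t) (radius Text t / 2) := by
  obtain ⟨L, c, -, hw, -⟩ := (hA.close t ht).exists_param
  exact hw

/-- A nearly circular solution is parametrized by a regular family of curves. -/
theorem IsNearlyCircularMCF.exists_isRegularFamily (hA : IsNearlyCircularMCF δ Text A)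
    (hText : 0 < Text) : ∃ γ, IsRegularFamily Text γ ∧ IsBoundaryFamily Text A γ := by
  obtain ⟨γ, hsm, hγ, -⟩ := hA.mcf.exists_param
  have hne : ∀ t ∈ Ico 0 Text, ∀ θ, velocity γ θ t ≠ 0 := fun t ht θ => ((hγ t ht).2.2.2 θ).1
  have hn : ∀ t ∈ Ico 0 Text, ∀ θ, innerNormal (A t) (γ θ t) = unitNormal (velocity γ θ t) :=
    fun t ht θ => ((hγ t ht).2.2.2 θ).2
  refine ⟨γ, ⟨hsm, fun t ht => (hγ t ht).1, hne, ?_⟩,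
    fun t ht => ⟨(hγ t ht).2.1, (hγ t ht).2.2.1, hn t ht⟩⟩
  -- The focal inequality is available for all |ℓ| < r/2 of either sign. If the claim failed, an ℓ
  -- strictly between |γ'|²/|K| and r/2 would violate it.
  have hpos : ∀ t ∈ Ioo 0 Text, ∀ θ, radius Text t *
      |(inner ℝ (velocity (velocity γ) θ t) (unitNormal (velocity γ θ t)) : ℝ)| ≤
        2 * ‖velocity γ θ t‖ ^ 2 := fun t ht θ => by
    have ht' : t ∈ Ico 0 Text := ⟨ht.1.le, ht.2⟩
    have hr := radius_pos ht.2
    have hv : 0 < ‖velocity γ θ t‖ ^ 2 := pow_pos (norm_pos_iff.2 (hne t ht' θ)) 2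
    have h1 : ∀ ℓ, |ℓ| < radius Text t / 2 →
        ℓ * inner ℝ (velocity (velocity γ) θ t) (unitNormal (velocity γ θ t)) ≤
          ‖velocity γ θ t‖ ^ 2 := fun ℓ hℓ =>
      mul_inner_le_of_isTubularWidth (hA.isTubularWidth ht)
        ((contDiff_slice_curve hsm ht').of_le (by norm_cast)) (hγ t ht').1
        (hγ t ht').2.2.1 (hne t ht') (hn t ht') hℓ θ
    set K : ℝ := inner ℝ (velocity (velocity γ) θ t) (unitNormal (velocity γ θ t))
    set V := ‖velocity γ θ t‖ ^ 2
    have h2 : ∀ ℓ, 0 ≤ ℓ → ℓ < radius Text t / 2 → ℓ * |K| ≤ V := fun ℓ h0 hℓ => by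
      rcases abs_cases K with ⟨h, -⟩ | ⟨h, -⟩
      · rw [h]
        exact h1 ℓ (by rwa [abs_of_nonneg h0])
      · rw [h, mul_neg, ← neg_mul]
        exact h1 (-ℓ) (by rwa [abs_neg, abs_of_nonneg h0])
    by_contra! hlt
    have hK : 0 < |K| := by
      by_contra! hK
      nlinarith
    have h3 : V / |K| < radius Text t / 2 := by
      rw [div_lt_iff₀ hK]
      linarith
    obtain ⟨ℓ, hℓ1, hℓ2⟩ := exists_between h3
    have h4 := h2 ℓ ((div_pos hv hK).trans hℓ1).le hℓ2
    rw [div_lt_iff₀ hK] at hℓ1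
    linarith
  intro t ht θ
  -- Closeness to a circle is assumed at positive times only; at t = 0 the inequality follows by
  -- continuity of both sides.
  rcases ht.1.eq_or_lt with rfl | h0
  swap
  · exact hpos t ⟨h0, ht.2⟩ θ
  have hslice : ContinuousOn (fun t : ℝ => (θ, t)) (Ico 0 Text) := by fun_prop
  have hmaps : MapsTo (fun t : ℝ => (θ, t)) (Ico 0 Text) (curveDomain Text) :=
    fun t ht => ⟨mem_univ _, ht⟩
  have hX : ContinuousOn (fun t => velocity γ θ t) (Ico 0 Text) :=
    (contDiffOn_velocity hsm).continuousOn.comp hslice hmaps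
  have hX' : ContinuousOn (fun t => velocity (velocity γ) θ t) (Ico 0 Text) :=
    (contDiffOn_velocity (contDiffOn_velocity hsm)).continuousOn.comp hslice hmaps
  have hN : ContinuousOn (fun t => unitNormal (velocity γ θ t)) (Ico 0 Text) := fun t ht =>
    (contDiffAt_unitNormal (n := 0) (hne t ht θ)).continuousAt.comp_continuousWithinAt (hX t ht)
  have hr : ContinuousOn (fun t => radius Text t) (Ico 0 Text) := by
    unfold radius
    fun_prop
  have hmono : 𝓝[Ioo 0 Text] (0 : ℝ) ≤ 𝓝[Ico 0 Text] 0 := nhdsWithin_mono _ Ioo_subset_Ico_self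
  have hlhs := ((hr.mul (hX'.inner hN).abs) 0 ht).mono_left hmono
  have hrhs := ((continuousOn_const (c := (2 : ℝ)).mul (hX.norm.pow 2)) 0 ht).mono_left hmono
  have := left_nhdsWithin_Ioo_neBot hText
  refine le_of_tendsto_of_tendsto hlhs hrhs ?_
  filter_upwards [self_mem_nhdsWithin] with t ht
  exact hpos t ht θ

section Identification

variable {χ : Plane → ℝ → ℝ} {z : ℝ → Plane} {T : ℝ → ℝ} {t : ℝ}

theorem IsBoundaryFamily.mem_frontier (hA : IsBoundaryFamily Text A γ) (hγ : IsRegularFamily Text γ)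
    {t : ℝ} (ht : t ∈ Ico 0 Text) (θ : ℝ) : γ θ t ∈ frontier (A t) := by
  obtain ⟨θ', hθ', h⟩ := (hγ.periodic t ht).exists_mem_Ico₀ zero_lt_one θ
  rw [← (hA t ht).2.1]
  exact ⟨θ', hθ', h.symm⟩

theorem IsBoundaryFamily.shiftedNormal_eq (hA : IsBoundaryFamily Text A γ)
    (hT : T t ∈ Ico 0 Text) (θ : ℝ) :
    shiftedNormal A z T (z t + γ θ (T t)) t = unitNormal (velocity γ θ (T t)) := by
  rw [shiftedNormal, add_sub_cancel_left, (hA _ hT).2.2 θ]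

theorem IsBoundaryFamily.shiftedInterface_eq (hA : IsBoundaryFamily Text A γ)
    (hT : T t ∈ Ico 0 Text) :
    shiftedInterface A z T t = (fun θ => z t + γ θ (T t)) '' Ico 0 1 := by
  rw [shiftedInterface, ← (hA _ hT).2.1, image_image]

/-- The interface error height in tubular coordinates. -/
theorem rho_eq_radius_mul_errorHeight (hA : IsNearlyCircularMCF δ Text A)
    (hγ : IsRegularFamily Text γ) (hAγ : IsBoundaryFamily Text A γ) (hζ : IsCutoff C ζ)
    (hC : 1 ≤ C) (hχ : Measurable fun x => χ x t) (h01 : ∀ x, χ x t ∈ Icc (0 : ℝ) 1)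
    (hT : T t ∈ Ioo 0 Text) (θ : ℝ) :
    rho Text A χ ζ z T (z t + γ θ (T t)) t =
      radius Text (T t) * errorHeight Text γ ζ (fun x => χ x t) (z t) (T t) θ := by
  have hT' : T t ∈ Ico 0 Text := ⟨hT.1.le, hT.2⟩
  have hr := radius_pos hT.2
  set r := radius Text (T t) with hrdef
  have hN := hAγ.shiftedNormal_eq (z := z) hT' θ
  have hnorm : innerNormal (A (T t)) (γ θ (T t)) = unitNormal (velocity γ θ (T t)) :=
    (hAγ _ hT').2.2 θ
  have hfr := hAγ.mem_frontier hγ hT' θ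
  set N := unitNormal (velocity γ θ (T t)) with hNdef
  have hN1 : ‖N‖ = 1 := norm_unitNormal (hγ.regular _ hT' θ)
  set e := tubularError Text γ ζ (fun x => χ x t) (z t) (T t) θ with he
  have hg : ∀ ℓ : ℝ, (shiftedPhase A z T (z t + γ θ (T t) + ℓ • N) t -
      χ (z t + γ θ (T t) + ℓ • N) t) * ζ (ℓ / r) = e (ℓ / r) := fun ℓ => by
    have hpoint : z t + γ θ (T t) + ℓ • N =
        z t + tubularMap Text γ ![θ, ℓ / r, T t] := by
      simp only [tubularMap, Matrix.cons_val]
      rw [← hrdef, mul_div_cancel₀ _ hr.ne', add_assoc]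
    -- Inside the tubular width the phase is decided by the sign of ℓ; outside, the cutoff makes
    -- both sides 0.
    by_cases hℓ : |ℓ| < r / 2
    · rw [he, tubularError, ← hpoint]
      congr 2
      have h1 := normal_mem_iff (hA.mcf.isOpen _ hT') (hA.isTubularWidth hT) hfr
        (by rw [hnorm, hN1]) hℓ
      rw [hnorm] at h1
      have h2 : z t + γ θ (T t) + ℓ • N - z t = γ θ (T t) + ℓ • N := by abel
      rw [shiftedPhase, h2]
      by_cases h0 : 0 < ℓ
      · rw [indicator_of_mem (h1.2 h0), indicator_of_mem (mem_Ioi.2 (div_pos h0 hr))]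
      · rw [indicator_of_notMem (fun h => h0 (h1.1 h)), indicator_of_notMem]
        exact fun h => h0 ((div_pos_iff_of_pos_right hr).1 h)
    · have hζ0 : ζ (ℓ / r) = 0 := hζ.eq_zero_of_quarter_le hC (by
        rw [abs_div, abs_of_pos hr, le_div_iff₀ hr]
        linarith)
      rw [he, tubularError, hζ0, mul_zero, mul_zero]
  have hplus : rhoPlus Text A χ ζ z T (z t + γ θ (T t)) t = r * ∫ s in (0 : ℝ)..(1 / 2), e s := by
    simp only [rhoPlus, hN, ← hrdef, hg]
    rw [intervalIntegral.integral_comp_div _ hr.ne', smul_eq_mul, zero_div, div_right_comm,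
      div_self hr.ne']
  have hminus : rhoMinus Text A χ ζ z T (z t + γ θ (T t)) t =
      -(r * ∫ s in (-(1 / 2))..(0 : ℝ), e s) := by
    have hneg : ∀ ℓ : ℝ, (χ (z t + γ θ (T t) + ℓ • N) t -
        shiftedPhase A z T (z t + γ θ (T t) + ℓ • N) t) * ζ (ℓ / r) = -e (ℓ / r) := fun ℓ => by
      rw [← hg, ← neg_mul, neg_sub]
    simp only [rhoMinus, hN, ← hrdef, hneg]
    rw [intervalIntegral.integral_neg, intervalIntegral.integral_comp_div _ hr.ne', smul_eq_mul,
      zero_div, neg_div, div_right_comm, div_self hr.ne']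
  -- The integrals of ρ run over |s| ≤ 1/2, that of the error height over |s| ≤ 1/4; the support
  -- makes them equal.
  have hsupp : Function.support e ⊆ Ioc (-(1 / 4)) (1 / 4) := fun s hs => by
    by_contra hmem
    refine hs ?_
    have h4 : 1 / 4 ≤ |s| := by
      by_contra! hlt
      exact hmem ⟨(abs_lt.1 hlt).1, (abs_lt.1 hlt).2.le⟩
    rw [he, tubularError, hζ.eq_zero_of_quarter_le hC h4, mul_zero]
  have hint := intervalIntegrable_tubularError (Text := Text) (γ := γ) hζ hχ h01 (z t) (T t) θ
  rw [rho, hplus, hminus, sub_neg_eq_add, add_comm, ← mul_add,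
    intervalIntegral.integral_add_adjacent_intervals (hint _ _) (hint _ _), errorHeight,
    intervalIntegral.integral_eq_integral_of_support_subset hsupp,
    intervalIntegral.integral_eq_integral_of_support_subset
      (hsupp.trans (Ioc_subset_Ioc (by norm_num) (by norm_num)))]

theorem IsRegularFamily.continuous_velocity (hγ : IsRegularFamily Text γ) {T : ℝ}
    (hT : T ∈ Ico 0 Text) : Continuous fun θ => velocity γ θ T :=
  (contDiff_slice_curve hγ.smooth hT).continuous_deriv (by simp)

theorem IsRegularFamily.continuous_normal (hγ : IsRegularFamily Text γ) {T : ℝ}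
    (hT : T ∈ Ico 0 Text) : Continuous fun θ => unitNormal (velocity γ θ T) :=
  continuous_iff_continuousAt.2 fun θ =>
    ContinuousAt.comp (f := fun θ => velocity γ θ T)
      (contDiffAt_unitNormal (n := 0) (hγ.regular T hT θ)).continuousAt
      (hγ.continuous_velocity hT).continuousAt

theorem IsRegularFamily.stronglyMeasurable_errorHeight (hγ : IsRegularFamily Text γ)
    (hζ : IsCutoff C ζ) {χ : Plane → ℝ} (hχ : Measurable χ) (z : Plane) {T : ℝ}
    (hT : T ∈ Ico 0 Text) : StronglyMeasurable (errorHeight Text γ ζ χ z T) := by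
  have hmap : Continuous fun p : ℝ × ℝ => z + tubularMap Text γ ![p.1, p.2, T] := by
    simp only [tubularMap, Matrix.cons_val]
    have h1 := (contDiff_slice_curve hγ.smooth hT).continuous
    have h2 := hγ.continuous_normal hT
    exact continuous_const.add ((h1.comp continuous_fst).add
      ((continuous_const.mul continuous_snd).smul (h2.comp continuous_fst)))
  have hmeas : Measurable fun p : ℝ × ℝ => tubularError Text γ ζ χ z T p.1 p.2 :=
    (((measurable_const.indicator measurableSet_Ioi).comp measurable_snd).sub
      (hχ.comp hmap.measurable)).mul (hζ.smooth.continuous.measurable.comp measurable_snd)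
  have h1 : errorHeight Text γ ζ χ z T = fun θ =>
      ∫ s in Ioc (-(1 / 4)) (1 / 4), tubularError Text γ ζ χ z T θ s := by
    funext θ
    exact intervalIntegral.integral_of_le (by norm_num)
  rw [h1]
  exact hmeas.stronglyMeasurable.integral_prod_right

/-- The right-hand sides of the shift equations agree with their expression in tubular
coordinates. -/
theorem average_rho_eq_shiftVelocity (hA : IsNearlyCircularMCF δ Text A)
    (hγ : IsRegularFamily Text γ) (hAγ : IsBoundaryFamily Text A γ) (hζ : IsCutoff C ζ)
    (hC : 1 ≤ C) (hχ : Measurable fun x => χ x t) (h01 : ∀ x, χ x t ∈ Icc (0 : ℝ) 1)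
    (hT : T t ∈ Ioo 0 Text) :
    ((6 / radius Text (T t) ^ 2) • ⨍ x in shiftedInterface A z T t,
        rho Text A χ ζ z T x t • shiftedNormal A z T x t ∂μH[1],
      (4 / radius Text (T t)) * ⨍ x in shiftedInterface A z T t, rho Text A χ ζ z T x t ∂μH[1]) =
    shiftVelocity Text γ ζ (fun x => χ x t) (z t) (T t) := by
  have hT' : T t ∈ Ico 0 Text := ⟨hT.1.le, hT.2⟩
  have hr := radius_pos hT.2
  have hc1 : ContDiff ℝ 1 fun θ => z t + γ θ (T t) :=
    contDiff_const.add ((contDiff_slice_curve hγ.smooth hT').of_le (by simp))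
  have hinj : InjOn (fun θ => z t + γ θ (T t)) (Ico 0 1) := fun θ hθ θ' hθ' h =>
    (hAγ _ hT').1 hθ hθ' (add_left_cancel h)
  have hderiv : ∀ θ, deriv (fun θ => z t + γ θ (T t)) θ = velocity γ θ (T t) := fun θ =>
    deriv_const_add _
  rw [hAγ.shiftedInterface_eq hT', setAverage_image_curve hc1 hinj,
    setAverage_image_curve hc1 hinj, hγ.shiftVelocity_eq hζ hC hχ h01 _ hT']
  simp only [hderiv, rho_eq_radius_mul_errorHeight hA hγ hAγ hζ hC hχ h01 hT,
    hAγ.shiftedNormal_eq hT']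
  set r := radius Text (T t)
  set E := errorHeight Text γ ζ (fun x => χ x t) (z t) (T t)
  have hint : IntegrableOn (fun θ => (‖velocity γ θ (T t)‖ * E θ) •
      ((6 / r) • unitNormal (velocity γ θ (T t)), (4 : ℝ))) (Icc 0 1) := by
    have h1 : Continuous fun θ => ‖velocity γ θ (T t)‖ • ((6 / r) •
        unitNormal (velocity γ θ (T t)), (4 : ℝ)) :=
      (hγ.continuous_speed hT').smul
        (((hγ.continuous_normal hT').const_smul (6 / r)).prodMk continuous_const)
    have h2 : IntegrableOn (fun θ => E θ • ‖velocity γ θ (T t)‖ • ((6 / r) •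
        unitNormal (velocity γ θ (T t)), (4 : ℝ))) (Icc 0 1) :=
      (h1.integrableOn_Icc).bdd_smul (1 / (8 * C))
        (hγ.stronglyMeasurable_errorHeight hζ hχ (z t) hT').aestronglyMeasurable
        (Eventually.of_forall fun θ => abs_errorHeight_le hζ hC hχ h01 _ _ θ)
    refine h2.congr (Eventually.of_forall fun θ => ?_)
    simp only [smul_smul, mul_comm]
  -- The factor r in ρ = r * `errorHeight` turns 6/r² into 6/r and 4/r into 4, the constants of the
  -- weight.
  refine Prod.ext ?_ ?_
  · change (6 / r ^ 2) • (curveLength γ (T t))⁻¹ • _ = _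
    rw [Prod.smul_fst, fst_integral hint, smul_comm, ← integral_smul]
    congr 2
    funext θ
    simp only [Prod.smul_fst, smul_smul]
    congr 1
    field_simp
  · change (4 / r) • (curveLength γ (T t))⁻¹ • (_ : ℝ) = _
    rw [Prod.smul_snd, snd_integral hint, smul_comm, ← integral_smul]
    congr 2
    funext θ
    simp only [Prod.smul_snd, smul_eq_mul]
    field_simp

/-- Only the right-hand sides differ. For t in (0, a) the bijection puts T t in the open interval
(0, Text), where the tubular width is available. -/
theorem isShift_iff_isTimeChangeSolution (hA : IsNearlyCircularMCF δ Text A)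
    (hγ : IsRegularFamily Text γ) (hAγ : IsBoundaryFamily Text A γ) (hζ : IsCutoff C ζ)
    (hC : 1 ≤ C) (hχ : ∀ t, Measurable fun x => χ x t) (h01 : ∀ x t, χ x t ∈ Icc (0 : ℝ) 1)
    {a : ℝ} : IsShift Text A χ ζ a z T ↔
      IsTimeChangeSolution Text (fun t z T => shiftVelocity Text γ ζ (fun x => χ x t) z T) a z T := by
  have key : BijOn T (Ioo 0 a) (Ioo 0 Text) → ∀ t ∈ Ioo 0 a, _ := fun hb t ht =>
    average_rho_eq_shiftVelocity (z := z) hA hγ hAγ hζ hC (hχ t) (fun x => h01 x t)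
      (hb.mapsTo ht)
  constructor
  · rintro ⟨h1, h2, h3, h4, h5, h6, h7, h8, h9⟩
    refine ⟨h1, h2, h3, h4, h5, h6, h7, h8, ?_⟩
    filter_upwards [h9, ae_restrict_mem measurableSet_Ioo] with t h ht
    rw [← key h6 t ht]
    exact h
  · rintro ⟨h1, h2, h3, h4, h5, h6, h7, h8, h9⟩
    refine ⟨h1, h2, h3, h4, h5, h6, h7, h8, ?_⟩
    filter_upwards [h9, ae_restrict_mem measurableSet_Ioo] with t h ht
    rw [← key h6 t ht] at h
    exact h

end Identification

theorem IsPhaseFamily.mem_Icc {P : ℕ} {χ : Fin P → Plane → ℝ → ℝ} (hχ : IsPhaseFamily χ)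
    (i : Fin P) (x : Plane) (t : ℝ) : χ i x t ∈ Icc (0 : ℝ) 1 := by
  rcases (hχ i).2 x t with h | h <;> rw [h] <;> simp

theorem IsPhaseFamily.measurable_slice {P : ℕ} {χ : Fin P → Plane → ℝ → ℝ} (hχ : IsPhaseFamily χ)
    (i : Fin P) (t : ℝ) : Measurable fun x => χ i x t :=
  (hχ i).1.comp (measurable_id.prodMk measurable_const)

end SpaceTimeShift
end

/-! ### The main theorem -/

theorem mainTheorem4 :
    (∀ (P : ℕ) (hP : 2 ≤ P) (χ : Fin P → SpaceTimeShift.Plane → ℝ → ℝ)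
        (δasymp Text : ℝ) (A : ℝ → Set SpaceTimeShift.Plane) (Cζ : ℝ) (ζ : ℝ → ℝ),
      SpaceTimeShift.IsPhaseFamily χ →
      δasymp ∈ Set.Ioo (0 : ℝ) (1 / 2) → 0 < Text →
      SpaceTimeShift.IsNearlyCircularMCF δasymp Text A →
      1 ≤ Cζ → SpaceTimeShift.IsCutoff Cζ ζ →
      ∃ (tχ : ℝ) (z : ℝ → SpaceTimeShift.Plane) (T : ℝ → ℝ),
        SpaceTimeShift.IsShift Text A (χ ⟨0, by omega⟩) ζ tχ z T ∧
        ∀ (tχ' : ℝ) (z' : ℝ → SpaceTimeShift.Plane) (T' : ℝ → ℝ),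
          SpaceTimeShift.IsShift Text A (χ ⟨0, by omega⟩) ζ tχ' z' T' →
          tχ' = tχ ∧ Set.EqOn z' z (Set.Ico 0 tχ) ∧ Set.EqOn T' T (Set.Ico 0 tχ)) ∧
    (∀ δerr ∈ Set.Ioo (0 : ℝ) (1 / 2), ∃ C₀ : ℝ, 1 ≤ C₀ ∧
      ∀ (P : ℕ) (hP : 2 ≤ P) (χ : Fin P → SpaceTimeShift.Plane → ℝ → ℝ)
        (δasymp Text : ℝ) (A : ℝ → Set SpaceTimeShift.Plane) (Cζ : ℝ) (ζ : ℝ → ℝ),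
      SpaceTimeShift.IsPhaseFamily χ →
      δasymp ∈ Set.Ioo (0 : ℝ) (1 / 2) → 0 < Text →
      SpaceTimeShift.IsNearlyCircularMCF δasymp Text A →
      C₀ ≤ Cζ → SpaceTimeShift.IsCutoff Cζ ζ →
      ∀ (tχ : ℝ) (z : ℝ → SpaceTimeShift.Plane) (T : ℝ → ℝ),
        SpaceTimeShift.IsShift Text A (χ ⟨0, by omega⟩) ζ tχ z T →
        ∀ᵐ t ∂(MeasureTheory.volume.restrict (Set.Ioo 0 tχ)),
          ‖deriv z t‖ ≤ δerr * (1 / SpaceTimeShift.radius Text (T t)) ∧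
          |deriv (fun s => T s - s) t| ≤ δerr) := by
  constructor
  · intro P hP χ δ Text A C ζ hχ _ hText hA hC hζ
    obtain ⟨γ, hγ, hAγ⟩ := hA.exists_isRegularFamily hText
    obtain ⟨a, z, T, hsol, huniq⟩ := (hγ.isTimeChangeField hζ hC (hχ ⟨0, by omega⟩).1
      (hχ.mem_Icc _)).exists_unique_solution hText
    have hiff := fun a z T => SpaceTimeShift.isShift_iff_isTimeChangeSolution (z := z) (T := T)
      (a := a) hA hγ hAγ hζ hC (hχ.measurable_slice ⟨0, by omega⟩) (hχ.mem_Icc _)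
    exact ⟨a, z, T, (hiff a z T).2 hsol, fun a' z' T' h => huniq a' z' T' ((hiff a' z' T').1 h)⟩
  · intro δerr hδ
    have hδ0 : 0 < δerr := hδ.1
    have hC₀ : 1 ≤ 1 / δerr := by
      rw [le_div_iff₀ hδ0]
      linarith [hδ.2]
    -- The velocity bounds are 1/(C r) and 1/(2C), so 1/C ≤ δerr is enough for both.
    refine ⟨1 / δerr, hC₀, fun P hP χ δ Text A C ζ hχ _ hText hA hC hζ a z T hshift => ?_⟩
    have hC1 : 1 ≤ C := hC₀.trans hC
    have hCδ : 1 / C ≤ δerr := by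
      rw [div_le_iff₀ hδ0] at hC
      rw [div_le_iff₀ (by linarith)]
      linarith
    obtain ⟨γ, hγ, hAγ⟩ := hA.exists_isRegularFamily hText
    have hsol := (SpaceTimeShift.isShift_iff_isTimeChangeSolution hA hγ hAγ hζ hC1
      (hχ.measurable_slice ⟨0, by omega⟩) (hχ.mem_Icc _)).1 hshift
    filter_upwards [hsol.ode, ae_restrict_mem measurableSet_Ioo] with t h ht
    have hT := hsol.T_bijOn.mapsTo ht
    have hb := hγ.shiftVelocity_bound hζ hC1 (hχ.measurable_slice ⟨0, by omega⟩ t)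
      (fun x => hχ.mem_Icc _ x t) (z t) (Ioo_subset_Ico_self hT)
    rw [h.1.deriv, h.2.deriv]
    refine ⟨hb.1.trans (mul_le_mul_of_nonneg_right hCδ
      (one_div_nonneg.2 (SpaceTimeShift.radius_pos hT.2).le)), hb.2.trans (le_trans ?_ hCδ)⟩
    exact one_div_le_one_div_of_le (by linarith) (by linarith)
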